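/- Let $n\ge 4$, let $A\in\mathbb{R}^{m\times n}$ have non-negative entries and no zero column, and write $$f(x)=\tfrac12\|Ax\|_2^2-\mathbf 1^\top x,\qquad \|x\|_\Lambda^2=\sum_{j=1}^n x_j^2\,\|A_{:j}\|_2^2,\qquad \mathcal X=\prod_{j=1}^n\Big[0,\tfrac{1}{\|A_{:j}\|_2^2}\Big],$$ where $A_{:j}$ is the $j$-th column. Let $x^\star\in\arg\min_{x\ge 0}f(x)$, $x_0\in\mathcal X$, $\phi_0(x)=\frac12\|x-x_0\|_\Lambda^2$. Let $\log$ be the natural logarithm, let $\mathrm{nnz}(A)$ be the number of non-zero entries of $A$, and put $$a_1=\frac{1}{\sqrt2\,n^{3/2}},\quad a_2=\frac{a_1}{n-1},\quad a_{k+1}=\min\Big\{\frac{n a_k}{n-1},\frac{\sqrt{A_k}}{2n}\Big\}\ (k\ge2),\quad A_k=a_1+\dots+a_k .$$ **SI-NNLS+.** Set $\bar y_0=y_0=Ax_0$ and draw $j_1,j_2,\dots$ independently and uniformly from $\{1,\dots,n\}$. For $k=1,2,\dots$ let $$x_k=\arg\min_{x\in\mathcal X}\phi_k(x),\qquad y_k=\arg\max_{y\in\mathbb{R}^m}\psi_k(y),\qquad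 \bar y_k=y_k+\frac{a_k}{a_{k+1}}(y_k-y_{k-1}),$$ where $$\phi_k(x)=a_1\langle A^\top\bar y_0-\mathbf 1,x\rangle+\sum_{i=2}^k n a_i\langle A^\top\bar y_{i-1}-\mathbf 1,x_{j_i}e_{j_i}\rangle+\phi_0(x),$$ $$\psi_k(y)=a_1\langle A^\top y-\mathbf 1,x_1\rangle+\sum_{i=2}^k a_i\langle A^\top y-\mathbf 1,n x_i-(n-1)x_{i-1}\rangle-\tfrac{A_k}{2}\|y\|_2^2 ,$$ and let $\tilde x_1=x_1$ and $\tilde x_k=\frac1{A_k}\big[A_{k-1}\tilde x_{k-1}+a_k(n x_k-(n-1)x_{k-1})\big]$ for $k\ge2$. The output after $K$ iterations is $\tilde x_K$. **Theorem.** 1. For all $K\ge2$, $\tilde x_K\ge 0$ always, and $$\mathbb E[\langle\nabla f(\tilde x_K),\tilde x_K-x^\star\rangle]\le\frac{\|x_0-x^\star\|_\Lambda^2}{A_K},\qquad \mathbb E[f(\tilde x_K)-f(x^\star)]\le\frac{\|x_0-x^\star\|_\Lambda^2}{2A_K}.$$ 2. If $K\ge\frac52 n\log n$, then $A_K\ge\dfrac{(K-\frac52n\log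 n)^2}{36n^2}$. 3. If $\phi_0(x^\star)\le|f(x^\star)|$, then for all $\varepsilon>0$ and all $K\ge\frac52n\log n+\frac{6n}{\sqrt\varepsilon}$ we have $\mathbb E[f(\tilde x_K)-f(x^\star)]\le\varepsilon|f(x^\star)|$. The condition $\phi_0(x^\star)\le|f(x^\star)|$ holds if $x_0=0$. 4. The expected total cost of $K=\big\lceil\frac52n\log n+\frac{6n}{\sqrt\varepsilon}\big\rceil$ iterations is $O\big(\mathrm{nnz}(A)(\log n+\frac1{\sqrt\varepsilon})\big)$. That is, there are one program for a random access machine over the reals and an absolute constant $C$ with the following property. Given $m$, $n$, $K\ge2$, $x_0$ and $A$ (in compressed-column sparse form), and drawing the samples $j_1,j_2,\dots$ one after the other, the program always outputs exactly $\tilde x_K$. For every $\varepsilon>0$ and $K$ as above, its expected number of steps is at most $C\,\mathrm{nnz}(A)(\log n+\frac1{\sqrt\varepsilon})$. Here each of the following counts as one step: an arithmetic operation $+,-,\times,/,\sqrt{\cdot},\min,\max$, the evaluation of a constant, a conversion of an integer to a real, a memory access, an assignment, a random draw, a pass through a loop. -/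

import Mathlib

open MeasureTheory ProbabilityTheory Matrix

noncomputable section

namespace NNLS

/-! ## The problem -/

variable {m n : ℕ}

/-- The objective `f(x) = ½ ‖A x‖₂² - 𝟏ᵀ x`. -/
def objective (A : Matrix (Fin m) (Fin n) ℝ) (x : Fin n → ℝ) : ℝ :=
  (1 / 2) * ∑ i, (A *ᵥ x) i ^ 2 - ∑ j, x j

/-- The gradient of `g : ℝⁿ → ℝ`, the vector of its partial derivatives. -/
def grad (g : (Fin n → ℝ) → ℝ) (x : Fin n → ℝ) : Fin n → ℝ :=
  fun j => fderiv ℝ g x (Pi.single j 1)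

/-- `‖A_{:j}‖₂²`, the squared Euclidean norm of the `j`-th column. -/
def colSq (A : Matrix (Fin m) (Fin n) ℝ) (j : Fin n) : ℝ := ∑ i, A i j ^ 2

/-- `‖x‖_Λ² = ∑ j, x_j² ‖A_{:j}‖₂²`. -/
def lamSq (A : Matrix (Fin m) (Fin n) ℝ) (x : Fin n → ℝ) : ℝ := ∑ j, x j ^ 2 * colSq A j

/-- The box `X = ∏ j, [0, 1 / ‖A_{:j}‖₂²]`. -/
def box (A : Matrix (Fin m) (Fin n) ℝ) : Set (Fin n → ℝ) :=
  {x | ∀ j, 0 ≤ x j ∧ x j ≤ 1 / colSq A j}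

/-- The set of minimizers of `f` over the non-negative orthant. -/
def minimizers (A : Matrix (Fin m) (Fin n) ℝ) : Set (Fin n → ℝ) :=
  {x | (∀ j, 0 ≤ x j) ∧ ∀ z : Fin n → ℝ, (∀ j, 0 ≤ z j) → objective A x ≤ objective A z}

/-- The number of non-zero entries of `A`. -/
def nnz (A : Matrix (Fin m) (Fin n) ℝ) : ℕ :=
  {p : Fin m × Fin n | A p.1 p.2 ≠ 0}.ncard

/-! ## The algorithm SI-NNLS+ -/

/-- The pair `(a_k, A_k)`: `a_1 = 1 / (√2 n^{3/2})`, `a_2 = a_1 / (n - 1)`,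
`a_{k+1} = min {n a_k / (n - 1), √A_k / (2 n)}` for `k ≥ 2`, and `A_k = a_1 + ⋯ + a_k`. -/
def stepPair (n : ℕ) : ℕ → ℝ × ℝ
  | 0 => (0, 0)
  | 1 => (1 / (√2 * (n : ℝ) ^ (3 / 2 : ℝ)), 1 / (√2 * (n : ℝ) ^ (3 / 2 : ℝ)))
  | 2 => ((stepPair n 1).1 / ((n : ℝ) - 1),
          (stepPair n 1).2 + (stepPair n 1).1 / ((n : ℝ) - 1))
  | k + 3 =>
      let a' := min ((n : ℝ) * (stepPair n (k + 2)).1 / ((n : ℝ) - 1))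
        (√((stepPair n (k + 2)).2) / (2 * (n : ℝ)))
      (a', (stepPair n (k + 2)).2 + a')

/-- The step size `a_k`. -/
def stepSize (n k : ℕ) : ℝ := (stepPair n k).1

/-- The accumulated step size `A_k`. -/
def stepSum (n k : ℕ) : ℝ := (stepPair n k).2

/-- A minimizer of `g` over `s` (meaningful when there is one). -/
def argminOn {d : ℕ} (g : (Fin d → ℝ) → ℝ) (s : Set (Fin d → ℝ)) : Fin d → ℝ :=
  Classical.epsilon fun x => x ∈ s ∧ ∀ z ∈ s, g x ≤ g z

/-- A maximizer of `g` over the whole space (meaningful when there is one). -/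
def argmax {d : ℕ} (g : (Fin d → ℝ) → ℝ) : Fin d → ℝ :=
  Classical.epsilon fun y => ∀ z, g z ≤ g y

/-- What the algorithm holds after an iteration `k`: the estimate sequences `φ_k` and `ψ_k`, the
iterates `x_k` and `y_k`, the extrapolated point `ȳ_k` and the output point `x̃_k`. -/
structure Iterate (m n : ℕ) where
  phi : (Fin n → ℝ) → ℝ
  psi : (Fin m → ℝ) → ℝ
  x : Fin n → ℝ
  y : Fin m → ℝ
  ybar : Fin m → ℝ
  xt : Fin n → ℝ

/-- `φ_0(x) = ½ ‖x - x₀‖_Λ²`. -/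
def phi0 (A : Matrix (Fin m) (Fin n) ℝ) (x₀ x : Fin n → ℝ) : ℝ :=
  (1 / 2) * lamSq A (x - x₀)

/-- The state of SI-NNLS+ after iteration `k`, where `j k` is the coordinate that is sampled in
iteration `k + 1`, so that the samples are `j 0, j 1, …`.
* Iteration `1` is a full step and makes no use of the sample `j 0`.
* In iteration `k ≥ 2`, with the sample `i`:
  `φ_k(x) = φ_{k-1}(x) + n a_k ⟨Aᵀ ȳ_{k-1} - 𝟏, x_i e_i⟩`, `x_k = argmin_{x ∈ X} φ_k(x)`,
  `ψ_k(y) = ψ_{k-1}(y) + a_k ⟨Aᵀ y - 𝟏, n x_k - (n-1) x_{k-1}⟩ - (a_k / 2) ‖y‖₂²`,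
  `y_k = argmax_y ψ_k(y)`, `ȳ_k = y_k + (a_k / a_{k+1}) (y_k - y_{k-1})` and
  `x̃_k = (A_{k-1} x̃_{k-1} + a_k (n x_k - (n-1) x_{k-1})) / A_k`. -/
def iterate (A : Matrix (Fin m) (Fin n) ℝ) (x₀ : Fin n → ℝ) (j : ℕ → Fin n) :
    ℕ → Iterate m n
  | 0 =>
      { phi := phi0 A x₀
        psi := fun _ => 0
        x := x₀
        y := A *ᵥ x₀
        ybar := A *ᵥ x₀
        xt := x₀ }
  | 1 =>
      let s := iterate A x₀ j 0
      let φ : (Fin n → ℝ) → ℝ := fun x => s.phi x + stepSize n 1 * ((Aᵀ *ᵥ s.ybar - 1) ⬝ᵥ x)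
      let x' := argminOn φ (box A)
      let ψ : (Fin m → ℝ) → ℝ := fun y =>
        s.psi y + stepSize n 1 * ((Aᵀ *ᵥ y - 1) ⬝ᵥ x') - stepSize n 1 / 2 * (y ⬝ᵥ y)
      let y' := argmax ψ
      { phi := φ
        psi := ψ
        x := x'
        y := y'
        ybar := y' + (stepSize n 1 / stepSize n 2) • (y' - s.y)
        xt := x' }
  | k + 2 =>
      let s := iterate A x₀ j (k + 1)
      let a := stepSize n (k + 2)
      let i := j (k + 1)
      let φ : (Fin n → ℝ) → ℝ := fun x =>
        s.phi x + n * a * ((Aᵀ *ᵥ s.ybar - 1) ⬝ᵥ Pi.single i (x i))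
      let x' := argminOn φ (box A)
      let v : Fin n → ℝ := (n : ℝ) • x' - ((n : ℝ) - 1) • s.x
      let ψ : (Fin m → ℝ) → ℝ := fun y =>
        s.psi y + a * ((Aᵀ *ᵥ y - 1) ⬝ᵥ v) - a / 2 * (y ⬝ᵥ y)
      let y' := argmax ψ
      { phi := φ
        psi := ψ
        x := x'
        y := y'
        ybar := y' + (a / stepSize n (k + 3)) • (y' - s.y)
        xt := (stepSum n (k + 2))⁻¹ • (stepSum n (k + 1) • s.xt + a • v) }

/-- The point `x̃_K` that SI-NNLS+ returns after `K` iterations with the samples `j`. -/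
def output (A : Matrix (Fin m) (Fin n) ℝ) (x₀ : Fin n → ℝ) (j : ℕ → Fin n) (K : ℕ) :
    Fin n → ℝ :=
  (iterate A x₀ j K).xt

/-- The samples are independent and uniformly distributed on the `n` coordinates. -/
structure UniformSamples {Ω : Type*} [MeasurableSpace Ω] (P : Measure Ω)
    (j : ℕ → Ω → Fin n) : Prop where
  measurable : ∀ k, Measurable (j k)
  indep : iIndepFun j P
  uniform : ∀ k i, P.real {ω | j k ω = i} = 1 / (n : ℝ)

/-! ## A real random access machine with a step count

The memory consists of arrays of natural numbers and arrays of real numbers; a program names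
finitely many of them, and addresses in an array are computed. Every arithmetic operation, every
memory access, every assignment, every random draw and every pass through a loop costs one step. -/

/-- Expressions with values in `ℕ`; `get a i` reads entry `i` of the integer array `a`. -/
inductive NatExpr where
  | const (c : ℕ)
  | get (a : ℕ) (i : NatExpr)
  | add (e₁ e₂ : NatExpr)
  | sub (e₁ e₂ : NatExpr)

/-- Expressions with values in `ℝ`; `get a i` reads entry `i` of the real array `a`. -/
inductive RealExpr where
  | ofNat (e : NatExpr)
  | get (a : ℕ) (i : NatExpr)
  | add (e₁ e₂ : RealExpr)
  | sub (e₁ e₂ : RealExpr)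
  | mul (e₁ e₂ : RealExpr)
  | div (e₁ e₂ : RealExpr)
  | sqrt (e : RealExpr)
  | min (e₁ e₂ : RealExpr)
  | max (e₁ e₂ : RealExpr)

namespace NatExpr

/-- The value of an expression. -/
def eval (ints : ℕ → ℕ → ℕ) : NatExpr → ℕ
  | const c => c
  | get a i => ints a (i.eval ints)
  | add e₁ e₂ => e₁.eval ints + e₂.eval ints
  | sub e₁ e₂ => e₁.eval ints - e₂.eval ints

/-- The number of steps that the evaluation takes. -/
def cost : NatExpr → ℕ
  | const _ => 1
  | get _ i => i.cost + 1
  | add e₁ e₂ => e₁.cost + e₂.cost + 1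
  | sub e₁ e₂ => e₁.cost + e₂.cost + 1

end NatExpr

namespace RealExpr

/-- The value of an expression. -/
def eval (ints : ℕ → ℕ → ℕ) (reals : ℕ → ℕ → ℝ) : RealExpr → ℝ
  | ofNat e => (e.eval ints : ℝ)
  | get a i => reals a (i.eval ints)
  | add e₁ e₂ => e₁.eval ints reals + e₂.eval ints reals
  | sub e₁ e₂ => e₁.eval ints reals - e₂.eval ints reals
  | mul e₁ e₂ => e₁.eval ints reals * e₂.eval ints reals
  | div e₁ e₂ => e₁.eval ints reals / e₂.eval ints reals
  | sqrt e => √(e.eval ints reals)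
  | min e₁ e₂ => Min.min (e₁.eval ints reals) (e₂.eval ints reals)
  | max e₁ e₂ => Max.max (e₁.eval ints reals) (e₂.eval ints reals)

/-- The number of steps that the evaluation takes. -/
def cost : RealExpr → ℕ
  | ofNat e => e.cost + 1
  | get _ i => i.cost + 1
  | add e₁ e₂ => e₁.cost + e₂.cost + 1
  | sub e₁ e₂ => e₁.cost + e₂.cost + 1
  | mul e₁ e₂ => e₁.cost + e₂.cost + 1
  | div e₁ e₂ => e₁.cost + e₂.cost + 1
  | sqrt e => e.cost + 1
  | min e₁ e₂ => e₁.cost + e₂.cost + 1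
  | max e₁ e₂ => e₁.cost + e₂.cost + 1

end RealExpr

/-- Programs. `sample a i` draws the next random coordinate into entry `i` of the integer array
`a`; `loop a b c` evaluates the bound `b` once, to `N`, and then runs `c` for the values
`0, 1, …, N - 1` of the counter, which is kept in entry `0` of the integer array `a`. -/
inductive Program where
  | setNat (a : ℕ) (i : NatExpr) (e : NatExpr)
  | setReal (a : ℕ) (i : NatExpr) (e : RealExpr)
  | sample (a : ℕ) (i : NatExpr)
  | seq (c₁ c₂ : Program)
  | loop (a : ℕ) (bound : NatExpr) (body : Program)

/-- The state of the machine: its memory, the number of random draws and of steps so far. -/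
structure Machine where
  ints : ℕ → ℕ → ℕ
  reals : ℕ → ℕ → ℝ
  draws : ℕ
  time : ℕ

namespace Machine

/-- Write `v` into entry `i` of the integer array `a`, and count `t` steps. -/
def writeNat (s : Machine) (a i v t : ℕ) : Machine :=
  { s with
    ints := Function.update s.ints a (Function.update (s.ints a) i v)
    time := s.time + t }

/-- Write `v` into entry `i` of the real array `a`, and count `t` steps. -/
def writeReal (s : Machine) (a i : ℕ) (v : ℝ) (t : ℕ) : Machine :=
  { s with
    reals := Function.update s.reals a (Function.update (s.reals a) i v)
    time := s.time + t }

end Machine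

/-- Run a program; the random draws return `tape 0, tape 1, …` in this order. -/
def Program.run (tape : ℕ → ℕ) : Program → Machine → Machine
  | setNat a i e, s =>
      s.writeNat a (i.eval s.ints) (e.eval s.ints) (i.cost + e.cost + 1)
  | setReal a i e, s =>
      s.writeReal a (i.eval s.ints) (e.eval s.ints s.reals) (i.cost + e.cost + 1)
  | sample a i, s =>
      { s.writeNat a (i.eval s.ints) (tape s.draws) (i.cost + 1) with draws := s.draws + 1 }
  | seq c₁ c₂, s => c₂.run tape (c₁.run tape s)
  | loop a bound body, s =>
      Nat.rec { s with time := s.time + bound.cost }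
        (fun t s' => body.run tape (s'.writeNat a 0 t 1)) (bound.eval s.ints)

/-- A sparse (compressed column) representation of `A`: the non-zero entries of column `j` are
stored at the positions `ptr j, …, ptr (j + 1) - 1`, in any order, each with its row index in
`row` and its value in `val`. -/
structure SparseMatrix (A : Matrix (Fin m) (Fin n) ℝ) where
  ptr : ℕ → ℕ
  row : ℕ → ℕ
  val : ℕ → ℝ
  ptr_zero : ptr 0 = 0
  ptr_succ : ∀ j : Fin n, ptr (j + 1) = ptr j + {i : Fin m | A i j ≠ 0}.ncard
  entry : ∀ (j : Fin n) (i : Fin m), A i j ≠ 0 →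
    ∃ p, ptr j ≤ p ∧ p < ptr (j + 1) ∧ row p = i ∧ val p = A i j

/-- Every matrix has a sparse representation. -/
theorem sparseMatrix_nonempty (A : Matrix (Fin m) (Fin n) ℝ) : Nonempty (SparseMatrix A) := by
  classical
  let c : Fin n → ℕ := fun j => {i : Fin m | A i j ≠ 0}.ncard
  have e : ∀ j, Fin (c j) ≃ {i : Fin m // A i j ≠ 0} := fun j =>
    (finCongr (by simp [c, Set.ncard_eq_toFinset_card', Fintype.card_subtype])).trans
      (Fintype.equivFin {i : Fin m // A i j ≠ 0}).symm
  let g := @finSigmaFinEquiv n c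
  let ptr : ℕ → ℕ := fun k => ∑ j ∈ Finset.univ.filter (fun j : Fin n => j.val < k), c j
  have hs : ∀ j : Fin n, ptr (j + 1) = ptr j + c j := by
    intro j
    have : Finset.univ.filter (fun i : Fin n => i.val < j + 1)
        = insert j (Finset.univ.filter (fun i : Fin n => i.val < j)) := by
      ext i; simp [Fin.ext_iff]; omega
    simp only [ptr]
    rw [this, Finset.sum_insert (by simp)]; omega
  have hg : ∀ q : (Σ j : Fin n, Fin (c j)), ((g q : Fin _) : ℕ) = ptr q.1 + q.2 := by
    intro q
    simp only [g, finSigmaFinEquiv_apply, ptr]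
    congr 1
    refine Finset.sum_bij (fun i _ => Fin.castLE q.1.2.le i) ?_ ?_ ?_ ?_
    · intro i _; exact Finset.mem_filter.mpr ⟨Finset.mem_univ _, i.2⟩
    · intro a _ b _ h; simpa [Fin.ext_iff] using h
    · intro b hb; simp at hb; exact ⟨⟨b, hb⟩, by simp, by ext; simp⟩
    · intro i _; rfl
  refine ⟨⟨ptr, fun p => if h : p < ∑ j, c j then (e (g.symm ⟨p, h⟩).1 (g.symm ⟨p, h⟩).2).1 else 0,
    fun p => if h : p < ∑ j, c j then A (e (g.symm ⟨p, h⟩).1 (g.symm ⟨p, h⟩).2).1 (g.symm ⟨p, h⟩).1 else 0, by simp [ptr], hs, ?_⟩⟩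
  intro j i hi
  let q : (Σ j : Fin n, Fin (c j)) := ⟨j, (e j).symm ⟨i, hi⟩⟩
  have h1 := hg q
  refine ⟨g q, by rw [h1]; simp [q], by rw [hs, h1]; exact Nat.add_lt_add_left q.2.2 _, ?_, ?_⟩ <;>
  · rw [dif_pos (g q).2]
    have h2 : g.symm ⟨(g q).1, (g q).2⟩ = q := g.symm_apply_apply q
    rw [h2]; simp [q]

/-- The memory at the start: the integer array `0` holds `m`, `n` and the number `K` of iterations,
the integer arrays `1`, `2` and the real array `0` hold the sparse matrix, the real array `1` holds
the initial point, and everything else is zero. -/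
def startMachine {A : Matrix (Fin m) (Fin n) ℝ} (S : SparseMatrix A) (x₀ : Fin n → ℝ) (K : ℕ) :
    Machine where
  ints := fun a i =>
    match a, i with
    | 0, 0 => m
    | 0, 1 => n
    | 0, 2 => K
    | 1, i => S.ptr i
    | 2, i => S.row i
    | _, _ => 0
  reals := fun a i =>
    match a with
    | 0 => S.val i
    | 1 => if h : i < n then x₀ ⟨i, h⟩ else 0
    | _ => 0
  draws := 0
  time := 0

/-- The state in which the program `prog` halts, for `K` iterations and the samples `j`. -/
def runOn (prog : Program) {A : Matrix (Fin m) (Fin n) ℝ} (S : SparseMatrix A)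
    (x₀ : Fin n → ℝ) (K : ℕ) (j : ℕ → Fin n) : Machine :=
  prog.run (fun t => (j t : ℕ)) (startMachine S x₀ K)

/-- The program `prog` implements SI-NNLS+: for every input, every number `K ≥ 2` of iterations and
every sequence of samples, the first `n` entries of the real array `2` are `x̃_K` at the end. -/
def Implements (prog : Program) : Prop :=
  ∀ (m n : ℕ) (A : Matrix (Fin m) (Fin n) ℝ), 4 ≤ n → (∀ i j, 0 ≤ A i j) →
    (∀ j, ∃ i, A i j ≠ 0) → ∀ (S : SparseMatrix A), ∀ x₀ ∈ box A, ∀ (K : ℕ), 2 ≤ K →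
    ∀ (j : ℕ → Fin n) (i : Fin n), (runOn prog S x₀ K j).reals 2 i = output A x₀ j K i

end NNLS

end

namespace NNLS

variable {m n : ℕ}

/-! ## The problem -/

/-! Error bounds. With `L(x, y) = ⟨Aᵀy - 𝟏, x⟩ - ½‖y‖²` one has `f(x) = max_y L(x, y)`, attained
only at `y = Ax`. The estimate sequence satisfies `ψ_k = A_k L(x̃_k, ·)`, so `y_k = A x̃_k`
(`psi_eq`, `y_eq`). On the primal side `φ_k` is a linear function plus `½‖x - x₀‖_Λ²`. It is
therefore strongly convex and separable, and a sampled step moves a single coordinate (`boxMin_le`,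
`x_succ`). `gap_le_potential` bounds `A_k (f(x̃_k) - f(x⋆))` by induction along every sample path.
The extrapolation in `ȳ_k` makes the bilinear terms telescope. Young's inequality splits the
remaining cross terms into `‖y_k - y_{k-1}‖²`, paid for by the concavity of `L` because `n² a_k² ≤
A_{k-1} / 4`, and `‖A(x_k - x_{k-1})‖²`. In a one-coordinate direction the latter equals `‖x_k -
x_{k-1}‖_Λ²`, without a factor `n`, and strong convexity pays for it. What remains is `φ_0(x⋆)` plus
the noise of the sampled gradient coordinates, which has mean zero because each sample is
independent of the state it acts on (`gap_le_totalNoise`, `UniformSamples.integral_totalNoise`).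
Strong convexity is tested at `x⋆`, which is allowed because non-negativity of `A` puts every
minimizer into the box (`minimizers_subset_box`). Growth of `A_K`. The step rule has a geometric
phase with ratio `n / (n - 1)`, and then a phase in which `√A_k` gains at least `1 / (6n)` per
iteration (`step_phases`). The geometric phase stays above the same linear bound since `(n / (n -
1))^k ≥ exp(k / n)`. Cost. Neither `x̃_k` nor `ȳ_k` is updated sparsely. But `A_k x̃_k = A_k x_k +
r_k`, where `r_k` changes in one coordinate per iteration, and `ȳ_k` is a scalar combination of `A
x_k`, `A r_k` and `A(x_k - x_{k-1})` (`stepSum_smul_xt`, `ybar_succ_eq`). An iteration thus touches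
one column, with `nnz(A) / n` entries on average. Loop invariants verify the program and count its
steps exactly (`run_nnlsProgram`). -/

theorem dotProduct_self_nonneg {d : ℕ} (v : Fin d → ℝ) : 0 ≤ v ⬝ᵥ v :=
  Finset.sum_nonneg fun _ _ => mul_self_nonneg _

/-- Young's inequality, from `‖2c v - w‖² ≥ 0`. With the weight `1 / 4` on `w`, two uses add up to
the `1 / 2` available from strong convexity. -/
theorem mul_dotProduct_le {d : ℕ} (c : ℝ) (v w : Fin d → ℝ) :
    c * (v ⬝ᵥ w) ≤ c ^ 2 * (v ⬝ᵥ v) + 1 / 4 * (w ⬝ᵥ w) := by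
  have h := dotProduct_self_nonneg ((2 * c) • v - w)
  simp only [sub_dotProduct, dotProduct_sub, smul_dotProduct, dotProduct_smul, smul_eq_mul,
    dotProduct_comm w v] at h
  linarith

theorem transpose_mulVec_dotProduct (A : Matrix (Fin m) (Fin n) ℝ) (y : Fin m → ℝ)
    (x : Fin n → ℝ) : (Aᵀ *ᵥ y) ⬝ᵥ x = y ⬝ᵥ (A *ᵥ x) := by
  rw [mulVec_transpose, dotProduct_mulVec]

theorem objective_eq (A : Matrix (Fin m) (Fin n) ℝ) (x : Fin n → ℝ) :
    objective A x = 1 / 2 * (A *ᵥ x ⬝ᵥ A *ᵥ x) - 1 ⬝ᵥ x := by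
  simp [objective, dotProduct, sq]

/-- The gradient of the objective in closed form. -/
noncomputable def gradient (A : Matrix (Fin m) (Fin n) ℝ) (x : Fin n → ℝ) : Fin n → ℝ :=
  Aᵀ *ᵥ (A *ᵥ x) - 1

theorem objective_add (A : Matrix (Fin m) (Fin n) ℝ) (x h : Fin n → ℝ) :
    objective A (x + h)
      = objective A x + gradient A x ⬝ᵥ h + 1 / 2 * (A *ᵥ h ⬝ᵥ A *ᵥ h) := by
  simp only [objective_eq, gradient, mulVec_add, add_dotProduct, dotProduct_add, sub_dotProduct,
    transpose_mulVec_dotProduct, dotProduct_comm (A *ᵥ h) (A *ᵥ x)]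
  ring

theorem differentiable_objective (A : Matrix (Fin m) (Fin n) ℝ) :
    Differentiable ℝ (objective A) := by
  unfold objective mulVec dotProduct
  fun_prop

/-- Along a coordinate line the objective is an explicit quadratic polynomial in `t`, whose
derivative at `0` is read off. -/
theorem grad_objective (A : Matrix (Fin m) (Fin n) ℝ) (x : Fin n → ℝ) :
    grad (objective A) x = gradient A x := by
  funext j
  rw [grad, ← (differentiable_objective A x).lineDeriv_eq_fderiv, lineDeriv]
  have h : (fun t : ℝ => objective A (x + t • Pi.single j 1)) = fun t =>
      objective A x + t * gradient A x j
        + t ^ 2 * (1 / 2 * (A *ᵥ Pi.single j 1 ⬝ᵥ A *ᵥ Pi.single j 1)) := by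
    funext t
    rw [objective_add]
    simp only [mulVec_smul, dotProduct_smul, smul_dotProduct, smul_eq_mul, dotProduct_single]
    ring
  rw [h]
  have h1 : HasDerivAt (fun t : ℝ => objective A x + t * gradient A x j
      + t ^ 2 * (1 / 2 * (A *ᵥ Pi.single j 1 ⬝ᵥ A *ᵥ Pi.single j 1))) (gradient A x j) 0 := by
    have := (((hasDerivAt_id (0 : ℝ)).mul_const (gradient A x j)).const_add (objective A x)).add
      (((hasDerivAt_id (0 : ℝ)).pow 2).mul_const
        (1 / 2 * (A *ᵥ Pi.single j 1 ⬝ᵥ A *ᵥ Pi.single j 1)))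
    exact this.congr_deriv (by simp)
  exact h1.deriv

theorem nonneg_of_forall_small {a b : ℝ} (h : ∀ t : ℝ, 0 < t → t ≤ 1 → 0 ≤ t * a + t ^ 2 * b) :
    0 ≤ a := by
  by_contra! ha
  have hb : 0 < b := by
    by_contra! hb
    have := h 1 one_pos le_rfl
    nlinarith
  -- This `t` satisfies `t * b ≤ -a / 2`, so `a + t * b ≤ a / 2 < 0`.
  have h1 := h (min 1 (-a / (2 * b))) (lt_min one_pos (by apply div_pos <;> linarith))
    (min_le_left _ _)
  have h2 : min 1 (-a / (2 * b)) * b ≤ -a / 2 := by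
    calc min 1 (-a / (2 * b)) * b ≤ (-a / (2 * b)) * b :=
          mul_le_mul_of_nonneg_right (min_le_right _ _) hb.le
      _ = -a / 2 := by field_simp
  have h3 : 0 < min 1 (-a / (2 * b)) := lt_min one_pos (by apply div_pos <;> linarith)
  nlinarith

/-! ### Optimality conditions and quadratic growth. -/

section Minimizers

variable {A : Matrix (Fin m) (Fin n) ℝ} {xs : Fin n → ℝ}

theorem gradient_dotProduct_sub_nonneg (hxs : xs ∈ minimizers A) {z : Fin n → ℝ}
    (hz : ∀ j, 0 ≤ z j) : 0 ≤ gradient A xs ⬝ᵥ (z - xs) := by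
  apply nonneg_of_forall_small (b := 1 / 2 * (A *ᵥ (z - xs) ⬝ᵥ A *ᵥ (z - xs)))
  intro t ht ht1
  have h := hxs.2 (xs + t • (z - xs)) fun j => by
    have h1 := hxs.1 j
    have h2 := hz j
    simp only [Pi.add_apply, Pi.smul_apply, Pi.sub_apply, smul_eq_mul]
    nlinarith
  rw [objective_add] at h
  simp only [mulVec_smul, dotProduct_smul, smul_dotProduct, smul_eq_mul] at h
  linarith

/-- The expansion of the quadratic `f` at `xs` is exact, and its linear term is non-negative by the
first-order condition. -/
theorem half_le_objective_sub (hxs : xs ∈ minimizers A) {z : Fin n → ℝ} (hz : ∀ j, 0 ≤ z j) :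
    1 / 2 * (A *ᵥ (z - xs) ⬝ᵥ A *ᵥ (z - xs)) ≤ objective A z - objective A xs := by
  have h := objective_add A xs (z - xs)
  rw [add_sub_cancel] at h
  linarith [gradient_dotProduct_sub_nonneg hxs hz]

/-- Expanding at `z` shows that the left side is the gap plus `½‖A(z - xs)‖²`, and quadratic growth
bounds the second term by the gap again. Hence the factor `2` between the two bounds on the output.
-/
theorem gradient_dotProduct_sub_le (hxs : xs ∈ minimizers A) {z : Fin n → ℝ}
    (hz : ∀ j, 0 ≤ z j) :
    gradient A z ⬝ᵥ (z - xs) ≤ 2 * (objective A z - objective A xs) := by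
  have h := objective_add A z (xs - z)
  rw [add_sub_cancel, ← neg_sub z xs, mulVec_neg, dotProduct_neg, neg_dotProduct,
    dotProduct_neg] at h
  linarith [half_le_objective_sub hxs hz]

/-- The ray through `xs` is feasible in both directions: the first-order condition is tested at `0`
and at `2 xs`. -/
theorem gradient_dotProduct_self (hxs : xs ∈ minimizers A) : gradient A xs ⬝ᵥ xs = 0 := by
  have h0 := gradient_dotProduct_sub_nonneg hxs (z := 0) fun _ => le_rfl
  have h2 := gradient_dotProduct_sub_nonneg hxs (z := xs + xs) fun j => by
    have := hxs.1 j; simp only [Pi.add_apply]; linarith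
  rw [zero_sub, dotProduct_neg] at h0
  rw [add_sub_cancel_right] at h2
  linarith

theorem gradient_nonneg (hxs : xs ∈ minimizers A) (j : Fin n) : 0 ≤ gradient A xs j := by
  have h := gradient_dotProduct_sub_nonneg hxs (z := xs + Pi.single j 1) fun i => by
    have h1 := hxs.1 i
    have h2 : (0 : Fin n → ℝ) ≤ Pi.single j 1 := Pi.single_nonneg.2 zero_le_one
    have h3 := h2 i
    simp only [Pi.zero_apply] at h3
    simp only [Pi.add_apply]
    linarith
  simpa using h

theorem gradient_mul_eq_zero (hxs : xs ∈ minimizers A) (j : Fin n) :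
    gradient A xs j * xs j = 0 :=
  (Finset.sum_eq_zero_iff_of_nonneg fun i _ => mul_nonneg (gradient_nonneg hxs i) (hxs.1 i)).1
    (gradient_dotProduct_self hxs) j (Finset.mem_univ j)

end Minimizers

/-! ### Comparison of `‖Ax‖²` with the weighted norm. -/

section Norms

variable {A : Matrix (Fin m) (Fin n) ℝ}

theorem colSq_nonneg (A : Matrix (Fin m) (Fin n) ℝ) (j : Fin n) : 0 ≤ colSq A j :=
  Finset.sum_nonneg fun _ _ => sq_nonneg _

theorem colSq_pos (hc : ∀ j, ∃ i, A i j ≠ 0) (j : Fin n) : 0 < colSq A j := by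
  obtain ⟨i, hi⟩ := hc j
  exact Finset.sum_pos' (fun _ _ => sq_nonneg _) ⟨i, Finset.mem_univ i, by positivity⟩

theorem lamSq_nonneg (A : Matrix (Fin m) (Fin n) ℝ) (x : Fin n → ℝ) : 0 ≤ lamSq A x :=
  Finset.sum_nonneg fun _ _ => mul_nonneg (sq_nonneg _) (colSq_nonneg A _)

theorem lamSq_sub_comm (A : Matrix (Fin m) (Fin n) ℝ) (x y : Fin n → ℝ) :
    lamSq A (x - y) = lamSq A (y - x) := by
  simp only [lamSq, Pi.sub_apply]
  exact Finset.sum_congr rfl fun j _ => by ring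

theorem lamSq_eq_sum_sum (A : Matrix (Fin m) (Fin n) ℝ) (x : Fin n → ℝ) :
    lamSq A x = ∑ i, ∑ j, (A i j * x j) ^ 2 := by
  rw [Finset.sum_comm]
  simp only [lamSq, colSq, Finset.mul_sum]
  exact Finset.sum_congr rfl fun j _ => Finset.sum_congr rfl fun i _ => by ring

/-- Cauchy–Schwarz in each row. The factor `n` is affordable only in the full first step and in the
final estimate. -/
theorem mulVec_dotProduct_self_le (A : Matrix (Fin m) (Fin n) ℝ) (x : Fin n → ℝ) :
    A *ᵥ x ⬝ᵥ A *ᵥ x ≤ n * lamSq A x := by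
  rw [lamSq_eq_sum_sum, Finset.mul_sum]
  refine Finset.sum_le_sum fun i _ => ?_
  rw [← sq]
  have h := sq_sum_le_card_mul_sum_sq (s := Finset.univ) (f := fun j => A i j * x j)
  rwa [Finset.card_univ, Fintype.card_fin] at h

/-- All cross terms in the squares of the rows are non-negative. -/
theorem lamSq_le_mulVec_dotProduct_self (hA : ∀ i j, 0 ≤ A i j) {x : Fin n → ℝ}
    (hx : ∀ j, 0 ≤ x j) : lamSq A x ≤ A *ᵥ x ⬝ᵥ A *ᵥ x := by
  rw [lamSq_eq_sum_sum]
  refine Finset.sum_le_sum fun i _ => ?_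
  rw [← sq]
  exact Finset.sum_sq_le_sq_sum_of_nonneg fun j _ => mul_nonneg (hA i j) (hx j)

theorem mulVec_single_dotProduct_self (A : Matrix (Fin m) (Fin n) ℝ) (j : Fin n) (c : ℝ) :
    A *ᵥ Pi.single j c ⬝ᵥ A *ᵥ Pi.single j c = lamSq A (Pi.single j c) := by
  simp only [lamSq, colSq, dotProduct, mulVec_single, Pi.smul_apply, col_apply,
    MulOpposite.smul_eq_mul_unop, MulOpposite.unop_op]
  rw [Finset.sum_eq_single j (fun i _ hi => by simp [hi]) (by simp), Finset.mul_sum]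
  exact Finset.sum_congr rfl fun i _ => by simp; ring

end Norms

/-! ### Location of the minimizers and the optimal value. -/

section Minimizers

variable {A : Matrix (Fin m) (Fin n) ℝ} {xs : Fin n → ℝ}

/-- If `xs j > 0`, complementary slackness gives `⟨A_{:j}, A xs⟩ = 1`. Since all entries are
non-negative, `A xs ≥ xs j • A_{:j}` entrywise, so this inner product is at least `xs j *
‖A_{:j}‖²`. -/
theorem minimizers_subset_box (hA : ∀ i j, 0 ≤ A i j) (hc : ∀ j, ∃ i, A i j ≠ 0) :
    minimizers A ⊆ box A := by
  intro xs hxs j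
  refine ⟨hxs.1 j, ?_⟩
  rw [le_div_iff₀ (colSq_pos hc j)]
  rcases (hxs.1 j).eq_or_lt with h | h
  · rw [← h]; simp
  have h1 : gradient A xs j = 0 :=
    (mul_eq_zero.1 (gradient_mul_eq_zero hxs j)).resolve_right h.ne'
  have h2 : ∑ i, A i j * (A *ᵥ xs) i = 1 := by
    have : ∑ i, A i j * (A *ᵥ xs) i - 1 = 0 := h1
    linarith
  rw [← h2, colSq, Finset.mul_sum]
  refine Finset.sum_le_sum fun i _ => ?_
  have h3 : A i j * xs j ≤ (A *ᵥ xs) i :=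
    Finset.single_le_sum (f := fun j => A i j * xs j)
      (fun k _ => mul_nonneg (hA i k) (hxs.1 k)) (Finset.mem_univ j)
  have := mul_le_mul_of_nonneg_left h3 (hA i j)
  linarith

/-- Orthogonality of `xs` to its gradient gives `f(xs) = -½‖A xs‖²`, and `‖xs‖_Λ ≤ ‖A xs‖` by
non-negativity. -/
theorem phi0_zero_le (hA : ∀ i j, 0 ≤ A i j) (hxs : xs ∈ minimizers A) :
    phi0 A 0 xs ≤ |objective A xs| := by
  have h1 := gradient_dotProduct_self hxs
  rw [gradient, sub_dotProduct, transpose_mulVec_dotProduct] at h1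
  have h2 := lamSq_le_mulVec_dotProduct_self hA hxs.1
  have h3 : objective A xs = -(1 / 2 * (A *ᵥ xs ⬝ᵥ A *ᵥ xs)) := by
    rw [objective_eq]; linarith
  rw [h3, abs_neg, phi0, sub_zero]
  exact le_trans (by linarith) (le_abs_self _)

end Minimizers

/-! ## The step sizes -/

section Steps

theorem stepSize_one (n : ℕ) : stepSize n 1 = 1 / (√2 * (n : ℝ) ^ (3 / 2 : ℝ)) := rfl

theorem stepSum_one (n : ℕ) : stepSum n 1 = stepSize n 1 := rfl

theorem stepSize_two (n : ℕ) : stepSize n 2 = stepSize n 1 / ((n : ℝ) - 1) := rfl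

theorem stepSize_add_three (n k : ℕ) : stepSize n (k + 3)
    = min ((n : ℝ) * stepSize n (k + 2) / ((n : ℝ) - 1)) (√(stepSum n (k + 2)) / (2 * (n : ℝ))) :=
  rfl

theorem stepSum_succ (n k : ℕ) : stepSum n (k + 1) = stepSum n k + stepSize n (k + 1) := by
  match k with
  | 0 => simp [stepSum, stepSize, stepPair]
  | 1 => rfl
  | k + 2 => rfl

theorem rpow_three_halves (n : ℕ) : (n : ℝ) ^ (3 / 2 : ℝ) = n * √n := by
  rcases Nat.eq_zero_or_pos n with rfl | hn
  · rw [Nat.cast_zero, Real.zero_rpow (by norm_num), zero_mul]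
  · have h : (3 / 2 : ℝ) = 1 + 1 / 2 := by norm_num
    rw [h, Real.rpow_add (by exact_mod_cast hn), Real.rpow_one, Real.sqrt_eq_rpow]

theorem stepSize_one_pos (hn : 4 ≤ n) : 0 < stepSize n 1 := by
  have : (0 : ℝ) < n := by exact_mod_cast (by omega : 0 < n)
  rw [stepSize_one]; positivity

/-- This normalization of `a_1` lets `φ_0(x_1)` absorb the error of the full first step, where a
factor `n` is lost. -/
theorem cube_mul_stepSize_one_sq (hn : 4 ≤ n) : (n : ℝ) ^ 3 * stepSize n 1 ^ 2 = 1 / 2 := by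
  have h0 : (0 : ℝ) < n := by exact_mod_cast (by omega : 0 < n)
  have h1 : √(n : ℝ) ^ 2 = n := Real.sq_sqrt h0.le
  have h2 : √(2 : ℝ) ^ 2 = 2 := Real.sq_sqrt (by norm_num)
  rw [stepSize_one, rpow_three_halves, div_pow, mul_pow, mul_pow, h1, h2]
  field_simp

theorem step_pos (hn : 4 ≤ n) (k : ℕ) : 0 < stepSize n (k + 1) ∧ 0 < stepSum n (k + 1) := by
  have h0 : (4 : ℝ) ≤ n := by exact_mod_cast hn
  have h1 : (0 : ℝ) < n - 1 := by linarith
  induction k with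
  | zero => exact ⟨stepSize_one_pos hn, stepSize_one_pos hn⟩
  | succ k ih =>
    have h2 : 0 < stepSize n (k + 2) := by
      match k with
      | 0 => rw [stepSize_two]; exact div_pos ih.1 h1
      | k + 1 =>
        rw [stepSize_add_three]
        have := Real.sqrt_pos.2 ih.2
        exact lt_min (div_pos (mul_pos (by linarith) ih.1) h1) (by positivity)
    exact ⟨h2, by rw [stepSum_succ]; exact add_pos ih.2 h2⟩

theorem stepSize_pos (hn : 4 ≤ n) (k : ℕ) : 0 < stepSize n (k + 1) := (step_pos hn k).1

theorem stepSum_pos (hn : 4 ≤ n) (k : ℕ) : 0 < stepSum n (k + 1) := (step_pos hn k).2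

theorem sub_one_mul_stepSize_two (hn : 4 ≤ n) :
    ((n : ℝ) - 1) * stepSize n 2 = stepSize n 1 := by
  have h0 : (4 : ℝ) ≤ n := by exact_mod_cast hn
  rw [stepSize_two, mul_div_cancel₀]
  linarith

/-- The purpose of the first branch of the step rule: it keeps `x̃_k` non-negative. -/
theorem sub_one_mul_stepSize_le (hn : 4 ≤ n) (k : ℕ) :
    ((n : ℝ) - 1) * stepSize n (k + 2) ≤ n * stepSize n (k + 1) := by
  have h0 : (4 : ℝ) ≤ n := by exact_mod_cast hn
  have h1 : (0 : ℝ) < n - 1 := by linarith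
  match k with
  | 0 =>
    rw [sub_one_mul_stepSize_two hn]
    nlinarith [stepSize_pos hn 0]
  | k + 1 =>
    have := min_le_left ((n : ℝ) * stepSize n (k + 2) / ((n : ℝ) - 1))
      (√(stepSum n (k + 2)) / (2 * (n : ℝ)))
    rw [← stepSize_add_three, le_div_iff₀ h1] at this
    linarith

/-- The purpose of the second branch: `2 n² a_{k+1}² ≤ A_k / 2`, so concavity in `y` pays both for a
Young term and for the reserve carried to the next iteration. -/
theorem sq_mul_stepSize_sq_le (hn : 4 ≤ n) (k : ℕ) :
    (n : ℝ) ^ 2 * stepSize n (k + 2) ^ 2 ≤ stepSum n (k + 1) / 4 := by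
  have h0 : (4 : ℝ) ≤ n := by exact_mod_cast hn
  match k with
  | 0 =>
    have h1 := stepSize_pos hn 0
    have h2 := stepSize_pos hn 1
    have h3 := sub_one_mul_stepSize_two hn
    have h4 := cube_mul_stepSize_one_sq hn
    rw [stepSum_one]
    simp only [zero_add] at *
    have h6 : (n : ℝ) * stepSize n 2 ≤ 4 / 3 * stepSize n 1 := by
      rw [← h3]; nlinarith
    -- `9 / 64` is the threshold for `(4 / 3 * a)² ≤ a / 4`.
    have h5 : stepSize n 1 ≤ 9 / 64 := by
      have : (64 : ℝ) ≤ (n : ℝ) ^ 3 := by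
        calc (64 : ℝ) = 4 ^ 3 := by norm_num
          _ ≤ (n : ℝ) ^ 3 := by gcongr
      nlinarith [mul_le_mul_of_nonneg_right this (sq_nonneg (stepSize n 1))]
    calc (n : ℝ) ^ 2 * stepSize n 2 ^ 2 = ((n : ℝ) * stepSize n 2) ^ 2 := by ring
      _ ≤ (4 / 3 * stepSize n 1) ^ 2 := by gcongr
      _ ≤ stepSize n 1 / 4 := by nlinarith
  | k + 1 =>
    have h1 := min_le_right ((n : ℝ) * stepSize n (k + 2) / ((n : ℝ) - 1))
      (√(stepSum n (k + 2)) / (2 * (n : ℝ)))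
    rw [← stepSize_add_three, le_div_iff₀ (by positivity)] at h1
    have h2 := stepSize_pos hn (k + 2)
    calc (n : ℝ) ^ 2 * stepSize n (k + 3) ^ 2 = (stepSize n (k + 3) * (2 * n)) ^ 2 / 4 := by ring
      _ ≤ √(stepSum n (k + 2)) ^ 2 / 4 := by gcongr
      _ = stepSum n (k + 2) / 4 := by rw [Real.sq_sqrt (stepSum_pos hn (k + 1)).le]

/-- Both sides are raised to the fourth power, which makes `a_1² = 1 / (2 n³)` rational. The ratio
is at least `exp(1 / n)`; the shift `5/2 n log n` supplies a factor `n⁵`, which outweighs `a_1²`;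
the rest is `exp(u) ≥ u² / 2` with `u = t / n`. -/
theorem sub_div_le_sqrt_geometric (hn : 4 ≤ n) (k : ℕ) :
    (((k + 2 : ℕ) : ℝ) - 5 / 2 * n * Real.log n) / (6 * n)
      ≤ √(stepSize n 1 * ((n : ℝ) / (n - 1)) ^ (k + 1)) := by
  have h0 : (4 : ℝ) ≤ n := by exact_mod_cast hn
  have h1 : (0 : ℝ) < n - 1 := by linarith
  have hn0 : (0 : ℝ) < n := by linarith
  set t : ℝ := ((k + 2 : ℕ) : ℝ) - 5 / 2 * n * Real.log n with ht
  rcases le_or_gt t 0 with h | h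
  · exact (div_nonpos_of_nonpos_of_nonneg h (by positivity)).trans (Real.sqrt_nonneg _)
  have ha := stepSize_one_pos hn
  have hq : Real.exp (1 / n) ≤ (n : ℝ) / (n - 1) := by
    rw [le_div_iff₀ h1, ← le_div_iff₀' (Real.exp_pos _), div_eq_mul_inv, ← Real.exp_neg]
    have := Real.add_one_le_exp (-(1 / (n : ℝ)))
    calc (n : ℝ) - 1 = n * (-(1 / n) + 1) := by field_simp; ring
      _ ≤ _ := by gcongr
  have hq2 : Real.exp ((k + 1 : ℕ) * (1 / n)) ≤ ((n : ℝ) / (n - 1)) ^ (k + 1) := by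
    rw [Real.exp_nat_mul]
    gcongr
  have hexp : 2 * ((k + 1 : ℕ) * (1 / (n : ℝ))) = 5 * Real.log n + 2 * (t / n) + -(2 / n) := by
    rw [ht]; push_cast; field_simp; ring
  have h5 : Real.exp (5 * Real.log n) = (n : ℝ) ^ 5 := by
    rw [show (5 : ℝ) = ((5 : ℕ) : ℝ) by norm_num, Real.exp_nat_mul, Real.exp_log hn0]
  have h6 : (t / n) ^ 2 / 2 ≤ Real.exp (t / n) := by
    have := Real.quadratic_le_exp_of_nonneg (div_nonneg h.le hn0.le)
    have := div_nonneg h.le hn0.le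
    linarith
  have h7 : 1 / 2 ≤ Real.exp (-(2 / n)) := by
    have := Real.add_one_le_exp (-(2 / (n : ℝ)))
    have h8 : 2 / (n : ℝ) ≤ 1 / 2 := by rw [div_le_div_iff₀ hn0 two_pos]; linarith
    linarith
  apply Real.le_sqrt_of_sq_le
  -- Second squaring; the square root was removed by the first.
  refine abs_le_of_sq_le_sq' ?_ (by positivity) |>.2
  calc ((t / (6 * n)) ^ 2) ^ 2 = (t / n) ^ 4 / 1296 := by field_simp; norm_num
    _ ≤ (t / n) ^ 4 := by
      have : 0 ≤ (t / n) ^ 4 := by positivity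
      linarith
    _ ≤ (1 / 2 * (n : ℝ) ^ 2) * ((t / n) ^ 2 / 2) ^ 2 * (1 / 2) := by
      have h8 : 16 ≤ (n : ℝ) ^ 2 := by nlinarith
      have h9 : ∀ s : ℝ, s ^ 4 ≤ 1 / 2 * (n : ℝ) ^ 2 * (s ^ 2 / 2) ^ 2 * (1 / 2) := fun s => by
        nlinarith [mul_le_mul_of_nonneg_right h8 (by positivity : 0 ≤ s ^ 4)]
      exact h9 _
    _ ≤ (1 / 2 * (n : ℝ) ^ 2) * Real.exp (t / n) ^ 2 * Real.exp (-(2 / n)) := by gcongr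
    _ = ((n : ℝ) ^ 3 * stepSize n 1 ^ 2) * (n : ℝ) ^ 2 * Real.exp (t / n) ^ 2
        * Real.exp (-(2 / n)) := by
      rw [cube_mul_stepSize_one_sq hn]
    _ = stepSize n 1 ^ 2 * Real.exp ((k + 1 : ℕ) * (1 / n)) ^ 2 := by
      have h8 : ∀ x : ℝ, Real.exp x ^ 2 = Real.exp (2 * x) := fun x => by
        rw [two_mul, Real.exp_add, sq]
      rw [h8, h8, hexp, Real.exp_add, Real.exp_add, h5]
      ring
    _ ≤ (stepSize n 1 * ((n : ℝ) / (n - 1)) ^ (k + 1)) ^ 2 := by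
      rw [← mul_pow]
      gcongr

/-- As long as the first branch of the step size rule is taken, the step sums grow geometrically;
from some iteration on, the second branch is always taken. -/
theorem step_phases (hn : 4 ≤ n) (k : ℕ) :
    ((n : ℝ) * stepSize n (k + 2) = stepSum n (k + 2) ∧
      stepSum n (k + 2) = stepSize n 1 * ((n : ℝ) / (n - 1)) ^ (k + 1)) ∨
    (((n : ℝ) - 1) / (2 * n) ≤ √(stepSum n (k + 2)) ∧
      √(stepSum n (k + 2)) / (2 * n) ≤ n * stepSize n (k + 2) / (n - 1) ∧
      (((k + 2 : ℕ) : ℝ) - 5 / 2 * n * Real.log n) / (6 * n) ≤ √(stepSum n (k + 2))) := by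
  have h0 : (4 : ℝ) ≤ n := by exact_mod_cast hn
  have h1 : (0 : ℝ) < n - 1 := by linarith
  have hn0 : (0 : ℝ) < n := by linarith
  induction k with
  | zero =>
    left
    simp only [zero_add]
    rw [stepSum_succ, stepSum_one, ← sub_one_mul_stepSize_two hn]
    constructor
    · ring
    · field_simp; ring
  | succ k ih =>
    have hA := stepSum_pos hn (k + 1)
    have hs : √(stepSum n (k + 2)) ^ 2 = stepSum n (k + 2) := Real.sq_sqrt hA.le
    have hb := Real.sqrt_pos.2 hA
    simp only [add_assoc, Nat.reduceAdd] at *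
    set b := √(stepSum n (k + 2)) with hbdef
    -- The second phase is absorbing, whether it has just been entered or was entered before.
    have key : ((n : ℝ) - 1) / (2 * n) ≤ b → b / (2 * n) ≤ n * stepSize n (k + 2) / (n - 1) →
        (((k + 2 : ℕ) : ℝ) - 5 / 2 * n * Real.log n) / (6 * n) ≤ b →
        (((n : ℝ) - 1) / (2 * n) ≤ √(stepSum n (k + 3)) ∧
          √(stepSum n (k + 3)) / (2 * n) ≤ n * stepSize n (k + 3) / (n - 1) ∧
          (((k + 3 : ℕ) : ℝ) - 5 / 2 * n * Real.log n) / (6 * n) ≤ √(stepSum n (k + 3))) := by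
      intro h2 h3 h4
      have h5 : stepSize n (k + 3) = b / (2 * n) := by
        rw [stepSize_add_three, min_eq_right h3]
      have h6 : stepSum n (k + 3) = b ^ 2 + b / (2 * n) := by
        rw [stepSum_succ, h5, hs]
      -- With `c = 1 / (6n)` the new sum is `b² + 3bc`, and `(b + c)² = b² + 2bc + c²` is smaller
      -- because `c ≤ b`.
      have h7 : b + 1 / (6 * n) ≤ √(stepSum n (k + 3)) := by
        apply Real.le_sqrt_of_sq_le
        rw [h6]
        have h8 : 1 / (6 * (n : ℝ)) ≤ b := by
          refine le_trans ?_ h2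
          rw [div_le_div_iff₀ (by positivity) (by positivity)]
          nlinarith
        have h9 : 1 / (6 * (n : ℝ)) * (1 / (6 * n)) ≤ b * (1 / (6 * n)) := by gcongr
        have h10 : b / (2 * n) = 3 * (b * (1 / (6 * n))) := by field_simp; norm_num
        rw [h10]; nlinarith
      have h8 : 0 < 1 / (6 * (n : ℝ)) := by positivity
      refine ⟨by linarith, ?_, ?_⟩
      -- Since `√A` grows by a factor of at most `n / (n - 1)`, the second branch remains the
      -- smaller one.
      · have h9 : √(stepSum n (k + 3)) ≤ n / (n - 1) * b := by
          apply Real.sqrt_le_iff.2 ⟨by positivity, ?_⟩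
          rw [h6]
          have h10 : b / (2 * n) ≤ 1 / (n - 1) * b ^ 2 := by
            rw [div_le_iff₀ (by positivity)] at h2
            rw [div_mul_eq_mul_div, one_mul, div_le_div_iff₀ (by positivity) h1]
            nlinarith
          have h11 : b ^ 2 + 1 / (n - 1) * b ^ 2 = n / (n - 1) * b ^ 2 := by
            field_simp; ring
          have h12 : 1 ≤ (n : ℝ) / (n - 1) := by rw [le_div_iff₀ h1]; linarith
          have h13 : n / (n - 1) * b ^ 2 ≤ n / (n - 1) * (n / (n - 1) * b ^ 2) :=
            le_mul_of_one_le_left (by positivity) h12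
          calc _ ≤ n / (n - 1) * (n / (n - 1) * b ^ 2) := by linarith
            _ = _ := by ring
        rw [h5]
        calc √(stepSum n (k + 3)) / (2 * n) ≤ n / (n - 1) * b / (2 * n) := by gcongr
          _ = _ := by ring
      · refine le_trans (le_of_eq ?_) ((add_le_add_left h4 _).trans h7)
        push_cast
        field_simp
        ring
    rcases ih with ⟨h2, h3⟩ | ⟨h2, h3, h4⟩
    · rcases le_or_gt (n * stepSize n (k + 2) / (n - 1)) (b / (2 * n)) with h4 | h4
      · left
        have h5 : stepSize n (k + 3) = stepSum n (k + 2) / (n - 1) := by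
          rw [stepSize_add_three, min_eq_left h4, h2]
        rw [stepSum_succ, h5]
        constructor
        · field_simp; ring
        · rw [pow_succ, ← mul_assoc, ← h3]; field_simp; ring
      -- At the switch `n a_k = A_k`, so the second branch being smaller means `√A_k > (n - 1) /
      -- (2n)`.
      · right
        refine key ?_ h4.le ?_
        · rw [h2, ← hs, div_lt_div_iff₀ (by positivity) h1] at h4
          rw [div_le_iff₀ (by positivity)]
          nlinarith
        · rw [hbdef, h3]; exact sub_div_le_sqrt_geometric hn k
    · exact Or.inr (key h2 h3 h4)

theorem sub_div_le_sqrt_stepSum (hn : 4 ≤ n) (k : ℕ) :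
    (((k + 2 : ℕ) : ℝ) - 5 / 2 * n * Real.log n) / (6 * n) ≤ √(stepSum n (k + 2)) := by
  rcases step_phases hn k with ⟨-, h⟩ | ⟨-, -, h⟩
  · rw [h]; exact sub_div_le_sqrt_geometric hn k
  · exact h

theorem one_lt_log (hn : 4 ≤ n) : 1 < Real.log n := by
  have h0 : (4 : ℝ) ≤ n := by exact_mod_cast hn
  rw [Real.lt_log_iff_exp_lt (by linarith)]
  linarith [Real.exp_one_lt_d9]

theorem stepSum_lower_bound (hn : 4 ≤ n) {K : ℕ} (hK : 5 / 2 * (n : ℝ) * Real.log n ≤ K) :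
    ((K : ℝ) - 5 / 2 * n * Real.log n) ^ 2 / (36 * (n : ℝ) ^ 2) ≤ stepSum n K := by
  have h0 : (4 : ℝ) ≤ n := by exact_mod_cast hn
  have h1 := one_lt_log hn
  have h2 : 2 ≤ K := by
    have : (2 : ℝ) ≤ K := by nlinarith
    exact_mod_cast this
  obtain ⟨k, rfl⟩ := Nat.exists_eq_add_of_le' h2
  have h3 := sub_div_le_sqrt_stepSum hn k
  calc _ = ((((k + 2 : ℕ) : ℝ) - 5 / 2 * n * Real.log n) / (6 * n)) ^ 2 := by
        rw [div_pow]; ring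
    _ ≤ √(stepSum n (k + 2)) ^ 2 :=
        pow_le_pow_left₀ (div_nonneg (by linarith) (by positivity)) h3 2
    _ = stepSum n (k + 2) := Real.sq_sqrt (stepSum_pos hn (k + 1)).le

end Steps

/-! ## The iterates in closed form -/

/-- The Lagrangian `L(x, y) = ⟨Aᵀ y - 𝟏, x⟩ - ½ ‖y‖²`, whose maximum over `y` is `f(x)`. -/
noncomputable def lagrangian (A : Matrix (Fin m) (Fin n) ℝ) (x : Fin n → ℝ) (y : Fin m → ℝ) : ℝ :=
  (Aᵀ *ᵥ y - 1) ⬝ᵥ x - 1 / 2 * (y ⬝ᵥ y)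

theorem lagrangian_eq (A : Matrix (Fin m) (Fin n) ℝ) (x : Fin n → ℝ) (y : Fin m → ℝ) :
    lagrangian A x y = objective A x - 1 / 2 * ((y - A *ᵥ x) ⬝ᵥ (y - A *ᵥ x)) := by
  simp only [lagrangian, objective_eq, sub_dotProduct, dotProduct_sub,
    transpose_mulVec_dotProduct, dotProduct_comm (A *ᵥ x) y]
  ring

/-- By `lagrangian_eq` the function is a constant minus a positive multiple of `‖y - Ax‖²`. Its
maximizer is unique, so the arbitrary choice in `argmax` does no harm. -/
theorem argmax_eq {A : Matrix (Fin m) (Fin n) ℝ} {g : (Fin m → ℝ) → ℝ} {c : ℝ} (hc : 0 < c)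
    {x : Fin n → ℝ} (hg : ∀ y, g y = c * lagrangian A x y) : argmax g = A *ᵥ x := by
  have h1 : ∀ z, g z ≤ g (A *ᵥ x) := fun z => by
    rw [hg, hg, lagrangian_eq, lagrangian_eq, sub_self, zero_dotProduct]
    have := dotProduct_self_nonneg (z - A *ᵥ x)
    exact mul_le_mul_of_nonneg_left (by linarith) hc.le
  have h2 : ∀ z, g z ≤ g (argmax g) := Classical.epsilon_spec (p := fun y => ∀ z, g z ≤ g y) ⟨_, h1⟩
  have h3 := h2 (A *ᵥ x)
  rw [hg, hg, lagrangian_eq, lagrangian_eq, sub_self, zero_dotProduct] at h3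
  have h4 := le_of_mul_le_mul_left h3 hc
  have h5 := dotProduct_self_nonneg (argmax g - A *ᵥ x)
  have h6 : (argmax g - A *ᵥ x) ⬝ᵥ (argmax g - A *ᵥ x) = 0 := by linarith
  exact sub_eq_zero.1 (dotProduct_self_eq_zero.1 h6)

/-- The minimizer of `⟨p, x⟩ + ½ ‖x - x₀‖_Λ²` over the box. -/
noncomputable def boxMin (A : Matrix (Fin m) (Fin n) ℝ) (x₀ p : Fin n → ℝ) : Fin n → ℝ := fun j =>
  max 0 (min (1 / colSq A j) (x₀ j - p j / colSq A j))

/-! ### Minimization of the estimate functions over the box. -/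

section BoxMin

variable {A : Matrix (Fin m) (Fin n) ℝ}

theorem boxMin_mem (x₀ p : Fin n → ℝ) : boxMin A x₀ p ∈ box A := fun j =>
  ⟨le_max_left _ _, max_le (one_div_nonneg.2 (colSq_nonneg A j)) (min_le_left _ _)⟩

/-- The problem splits into one-dimensional quadratics with curvature `colSq A j`. Adding the exact
second-order term to the first-order condition at the clamped point gives the strong-convexity
surplus. -/
theorem boxMin_le (hc : ∀ j, ∃ i, A i j ≠ 0) (x₀ p : Fin n → ℝ) {z : Fin n → ℝ}
    (hz : z ∈ box A) :
    p ⬝ᵥ boxMin A x₀ p + phi0 A x₀ (boxMin A x₀ p) + 1 / 2 * lamSq A (z - boxMin A x₀ p)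
      ≤ p ⬝ᵥ z + phi0 A x₀ z := by
  simp only [phi0, lamSq, dotProduct, Finset.mul_sum, ← Finset.sum_add_distrib, Pi.sub_apply]
  refine Finset.sum_le_sum fun j _ => ?_
  have hL := colSq_pos hc j
  obtain ⟨hz0, hz1⟩ := hz j
  -- At the upper end both factors are `≤ 0`, in the interior the first vanishes, at the lower end
  -- both are `≥ 0`.
  have key : 0 ≤ (p j + colSq A j * (boxMin A x₀ p j - x₀ j)) * (z j - boxMin A x₀ p j) := by
    have hp : colSq A j * (p j / colSq A j) = p j := mul_div_cancel₀ _ hL.ne'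
    have hb : (0 : ℝ) ≤ 1 / colSq A j := hz0.trans hz1
    unfold boxMin
    rcases le_total (1 / colSq A j) (x₀ j - p j / colSq A j) with h | h
    · rw [min_eq_left h, max_eq_right hb]
      refine mul_nonneg_of_nonpos_of_nonpos ?_ (by linarith)
      nlinarith
    · rw [min_eq_right h]
      rcases le_total 0 (x₀ j - p j / colSq A j) with h' | h'
      · rw [max_eq_right h']
        have : p j + colSq A j * (x₀ j - p j / colSq A j - x₀ j) = 0 := by linarith
        rw [this, zero_mul]
      · rw [max_eq_left h']
        refine mul_nonneg ?_ (by linarith)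
        nlinarith
  nlinarith

theorem lamSq_eq_zero (hc : ∀ j, ∃ i, A i j ≠ 0) {x : Fin n → ℝ} (h : lamSq A x = 0) : x = 0 := by
  funext j
  have := (Finset.sum_eq_zero_iff_of_nonneg fun i _ =>
    mul_nonneg (sq_nonneg (x i)) (colSq_nonneg A i)).1 h j (Finset.mem_univ j)
  simpa [(colSq_pos hc j).ne'] using this

theorem argminOn_eq (hc : ∀ j, ∃ i, A i j ≠ 0) {x₀ p : Fin n → ℝ} {g : (Fin n → ℝ) → ℝ}
    (hg : ∀ x, g x = p ⬝ᵥ x + phi0 A x₀ x) : argminOn g (box A) = boxMin A x₀ p := by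
  have h1 : boxMin A x₀ p ∈ box A ∧ ∀ z ∈ box A, g (boxMin A x₀ p) ≤ g z := by
    refine ⟨boxMin_mem x₀ p, fun z hz => ?_⟩
    rw [hg, hg]
    linarith [boxMin_le hc x₀ p hz, lamSq_nonneg A (z - boxMin A x₀ p)]
  have h2 : argminOn g (box A) ∈ box A ∧ ∀ z ∈ box A, g (argminOn g (box A)) ≤ g z :=
    Classical.epsilon_spec (p := fun x => x ∈ box A ∧ ∀ z ∈ box A, g x ≤ g z) ⟨_, h1⟩
  have h3 := h2.2 _ (boxMin_mem x₀ p)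
  rw [hg, hg] at h3
  have h4 := boxMin_le hc x₀ p h2.1
  exact sub_eq_zero.1 (lamSq_eq_zero hc
    (le_antisymm (by linarith) (lamSq_nonneg A _)))

end BoxMin

section Iterates

variable (A : Matrix (Fin m) (Fin n) ℝ) (x₀ : Fin n → ℝ) (j : ℕ → Fin n)

/-- The accumulated linear part of the estimate sequence `φ_k`. -/
noncomputable def dual : ℕ → Fin n → ℝ
  | 0 => 0
  | 1 => stepSize n 1 • (Aᵀ *ᵥ (A *ᵥ x₀) - 1)
  | k + 2 => dual (k + 1) + Pi.single (j (k + 1))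
      (n * stepSize n (k + 2) * (Aᵀ *ᵥ (iterate A x₀ j (k + 1)).ybar - 1) (j (k + 1)))

theorem phi_eq (k : ℕ) (x : Fin n → ℝ) :
    (iterate A x₀ j k).phi x = dual A x₀ j k ⬝ᵥ x + phi0 A x₀ x := by
  induction k with
  | zero => simp [iterate, dual]
  | succ k ih =>
    match k with
    | 0 => simp [iterate, dual, add_comm]
    | k + 1 =>
      rw [iterate, dual]
      simp only [ih, add_dotProduct, dotProduct_single, single_dotProduct]
      ring

variable {A}

theorem x_eq (hc : ∀ j, ∃ i, A i j ≠ 0) (k : ℕ) :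
    (iterate A x₀ j (k + 1)).x = boxMin A x₀ (dual A x₀ j (k + 1)) := by
  rw [← argminOn_eq hc (phi_eq A x₀ j (k + 1))]
  cases k <;> rfl

theorem x_nonneg (hc : ∀ j, ∃ i, A i j ≠ 0) (k : ℕ) (i : Fin n) :
    0 ≤ (iterate A x₀ j (k + 1)).x i := by
  rw [x_eq x₀ j hc]
  exact le_max_left _ _

theorem phi_le (hc : ∀ j, ∃ i, A i j ≠ 0) (k : ℕ) {z : Fin n → ℝ} (hz : z ∈ box A) :
    (iterate A x₀ j (k + 1)).phi (iterate A x₀ j (k + 1)).x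
        + 1 / 2 * lamSq A (z - (iterate A x₀ j (k + 1)).x)
      ≤ (iterate A x₀ j (k + 1)).phi z := by
  rw [phi_eq, phi_eq, x_eq x₀ j hc]
  exact boxMin_le hc x₀ _ hz

/-- The linear part changes only in the sampled coordinate, and minimization over the box is
coordinatewise. -/
theorem x_succ (hc : ∀ j, ∃ i, A i j ≠ 0) (k : ℕ) :
    (iterate A x₀ j (k + 2)).x = (iterate A x₀ j (k + 1)).x + Pi.single (j (k + 1))
      ((iterate A x₀ j (k + 2)).x (j (k + 1)) - (iterate A x₀ j (k + 1)).x (j (k + 1))) := by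
  funext i
  rcases eq_or_ne i (j (k + 1)) with rfl | h
  · simp
  · rw [Pi.add_apply, Pi.single_eq_of_ne h, add_zero, x_eq x₀ j hc, x_eq x₀ j hc]
    simp [boxMin, dual, h]

variable (A)

/-- The point `n x_k - (n - 1) x_{k-1}`. -/
noncomputable def extrapolation (k : ℕ) : Fin n → ℝ :=
  (n : ℝ) • (iterate A x₀ j (k + 1)).x - ((n : ℝ) - 1) • (iterate A x₀ j k).x

variable {A}

theorem stepSum_smul_xt_succ (hn : 4 ≤ n) (k : ℕ) :
    stepSum n (k + 2) • (iterate A x₀ j (k + 2)).xt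
      = stepSum n (k + 1) • (iterate A x₀ j (k + 1)).xt
        + stepSize n (k + 2) • extrapolation A x₀ j (k + 1) :=
  smul_inv_smul₀ (stepSum_pos hn (k + 1)).ne' _

/-- A strengthening of `x̃_k ≥ 0` that is inductive: the reserve `(n - 1) a_{k+1} x_k` cancels the
negative part of the next extrapolation, leaving `n a_{k+1} x_{k+1}`, which dominates the next
reserve. -/
theorem smul_xt_nonneg (hn : 4 ≤ n) (hc : ∀ j, ∃ i, A i j ≠ 0) (k : ℕ) (i : Fin n) :
    ((n : ℝ) - 1) * stepSize n (k + 2) * (iterate A x₀ j (k + 1)).x i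
      ≤ stepSum n (k + 1) * (iterate A x₀ j (k + 1)).xt i := by
  induction k with
  | zero =>
    rw [sub_one_mul_stepSize_two hn]
    exact le_of_eq rfl
  | succ k ih =>
    have h := congrFun (stepSum_smul_xt_succ (A := A) x₀ j hn k) i
    simp only [extrapolation, Pi.add_apply, Pi.smul_apply, Pi.sub_apply, smul_eq_mul] at h
    rw [h]
    have h1 := mul_le_mul_of_nonneg_right (sub_one_mul_stepSize_le hn (k + 1))
      (x_nonneg x₀ j hc (k + 1) i)
    linarith

theorem xt_nonneg (hn : 4 ≤ n) (hc : ∀ j, ∃ i, A i j ≠ 0) (k : ℕ) (i : Fin n) :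
    0 ≤ (iterate A x₀ j (k + 1)).xt i := by
  have h0 : (4 : ℝ) ≤ n := by exact_mod_cast hn
  refine nonneg_of_mul_nonneg_right (le_trans ?_ (smul_xt_nonneg x₀ j hn hc k i))
    (stepSum_pos hn k)
  exact mul_nonneg (mul_nonneg (by linarith) (stepSize_pos hn (k + 1)).le) (x_nonneg x₀ j hc k i)

variable (A)

theorem lagrangian_combine (hn : 4 ≤ n) (k : ℕ) (y : Fin m → ℝ) :
    stepSum n (k + 2) * lagrangian A (iterate A x₀ j (k + 2)).xt y
      = stepSum n (k + 1) * lagrangian A (iterate A x₀ j (k + 1)).xt y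
        + stepSize n (k + 2) * lagrangian A (extrapolation A x₀ j (k + 1)) y := by
  have h := congrArg ((Aᵀ *ᵥ y - 1) ⬝ᵥ ·) (stepSum_smul_xt_succ (A := A) x₀ j hn k)
  simp only [dotProduct_add, dotProduct_smul, smul_eq_mul] at h
  simp only [lagrangian, mul_sub, h]
  rw [stepSum_succ n (k + 1)]
  ring

/-- `L` is affine in `x`, so accumulating with weights `a_i` is the same as evaluating at the
weighted average `x̃_k`. -/
theorem psi_eq (hn : 4 ≤ n) (k : ℕ) (y : Fin m → ℝ) :
    (iterate A x₀ j (k + 1)).psi y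
      = stepSum n (k + 1) * lagrangian A (iterate A x₀ j (k + 1)).xt y := by
  induction k with
  | zero =>
    rw [show stepSum n (0 + 1) = stepSize n 1 from rfl]
    simp only [iterate, lagrangian]
    ring
  | succ k ih =>
    rw [lagrangian_combine A x₀ j hn, ← ih]
    simp only [lagrangian, extrapolation]
    conv_lhs => rw [iterate]
    simp only [iterate]
    ring

theorem y_eq (hn : 4 ≤ n) (k : ℕ) :
    (iterate A x₀ j k).y = A *ᵥ (iterate A x₀ j k).xt := by
  cases k with
  | zero => rfl
  | succ k =>
    rw [← argmax_eq (stepSum_pos hn k) (psi_eq A x₀ j hn k)]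
    cases k <;> rfl

theorem ybar_eq (k : ℕ) :
    (iterate A x₀ j (k + 1)).ybar = (iterate A x₀ j (k + 1)).y
      + (stepSize n (k + 1) / stepSize n (k + 2)) •
        ((iterate A x₀ j (k + 1)).y - (iterate A x₀ j k).y) := by
  cases k <;> rfl

theorem stepSize_smul_ybar (hn : 4 ≤ n) (k : ℕ) :
    stepSize n (k + 2) • (iterate A x₀ j (k + 1)).ybar
      = stepSize n (k + 2) • (iterate A x₀ j (k + 1)).y
      + stepSize n (k + 1) • ((iterate A x₀ j (k + 1)).y - (iterate A x₀ j k).y) := by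
  rw [ybar_eq, smul_add, smul_smul, mul_div_cancel₀ _ (stepSize_pos hn (k + 1)).ne']

/-- Adaptedness: the state after iteration `k` does not see the sample `j k`, which is the source of
independence in the expectations. -/
theorem iterate_congr {j j' : ℕ → Fin n} (k : ℕ) (h : ∀ i < k, j i = j' i) :
    iterate A x₀ j k = iterate A x₀ j' k := by
  induction k with
  | zero => rfl
  | succ k ih =>
    have ih' := ih fun i hi => h i (hi.trans k.lt_succ_self)
    match k with
    | 0 => rfl
    | k + 1 => simp only [iterate] at ih' ⊢; rw [h (k + 1) (by omega)]; simp only [ih']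

end Iterates

/-! ## The bound along a sample path -/

section Path

variable (A : Matrix (Fin m) (Fin n) ℝ) (x₀ xs : Fin n → ℝ) (j : ℕ → Fin n)

theorem phi_succ (k : ℕ) (x : Fin n → ℝ) :
    (iterate A x₀ j (k + 2)).phi x = (iterate A x₀ j (k + 1)).phi x
      + n * stepSize n (k + 2) *
        ((Aᵀ *ᵥ (iterate A x₀ j (k + 1)).ybar - 1) (j (k + 1)) * x (j (k + 1))) := by
  conv_lhs => rw [iterate]
  simp only [dotProduct_single]

/-- The error of the sampled gradient coordinate `i` at the state after iteration `k`. -/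
noncomputable def noise (k : ℕ) (i : Fin n) : ℝ :=
  (Aᵀ *ᵥ (iterate A x₀ j k).ybar - 1) ⬝ᵥ ((iterate A x₀ j k).x - xs)
    - n * ((Aᵀ *ᵥ (iterate A x₀ j k).ybar - 1) i * ((iterate A x₀ j k).x - xs) i)

/-- The weighted sum of the errors of the sampled gradient coordinates. -/
noncomputable def totalNoise (K : ℕ) : ℝ :=
  ∑ k ∈ Finset.range K, stepSize n (k + 2) * noise A x₀ xs j (k + 1) (j (k + 1))

variable {A x₀ xs}

/-- The last two terms are what the induction carries: the bilinear term telescopes, and the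
negative square is a reserve for the cross term that the next step produces. -/
theorem gap_le_potential (hn : 4 ≤ n) (hc : ∀ j, ∃ i, A i j ≠ 0) (k : ℕ) :
    stepSum n (k + 1) * (objective A (iterate A x₀ j (k + 1)).xt - objective A xs)
      ≤ phi0 A x₀ xs + totalNoise A x₀ xs j k
        + ((iterate A x₀ j (k + 1)).phi (iterate A x₀ j (k + 1)).x
            - (iterate A x₀ j (k + 1)).phi xs)
        + stepSize n (k + 1) * (((iterate A x₀ j (k + 1)).y - (iterate A x₀ j k).y) ⬝ᵥ
            A *ᵥ ((iterate A x₀ j (k + 1)).x - xs))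
        - (n : ℝ) ^ 2 * stepSize n (k + 1) ^ 2 *
          (((iterate A x₀ j (k + 1)).y - (iterate A x₀ j k).y) ⬝ᵥ
            ((iterate A x₀ j (k + 1)).y - (iterate A x₀ j k).y)) := by
  have h0 : (4 : ℝ) ≤ n := by exact_mod_cast hn
  induction k with
  | zero =>
    have hy0 : (iterate A x₀ j 0).y = A *ᵥ x₀ := rfl
    have hy1 : (iterate A x₀ j 1).y = A *ᵥ (iterate A x₀ j 1).x := y_eq A x₀ j hn 1
    have hxt : (iterate A x₀ j 1).xt = (iterate A x₀ j 1).x := rfl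
    have hd : dual A x₀ j 1 = stepSize n 1 • (Aᵀ *ᵥ (A *ᵥ x₀) - 1) := rfl
    have h1 := lagrangian_eq A (iterate A x₀ j 1).x (iterate A x₀ j 1).y
    have h2 := lagrangian_eq A xs (iterate A x₀ j 1).y
    have h3 := dotProduct_self_nonneg ((iterate A x₀ j 1).y - A *ᵥ xs)
    rw [hy1, sub_self, zero_dotProduct] at h1
    rw [hy1] at h2 h3
    have h4 := mulVec_dotProduct_self_le A ((iterate A x₀ j 1).x - x₀)
    have ha := stepSize_one_pos hn
    simp only [zero_add, totalNoise, Finset.range_zero, Finset.sum_empty]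
    rw [phi_eq, phi_eq, hxt, hy1, hy0, hd, stepSum_one, ← mulVec_sub]
    generalize (iterate A x₀ j 1).x = x at *
    -- The first step moves all coordinates, so the factor `n` of Cauchy–Schwarz is paid by `n³ a_1²
    -- = 1 / 2`.
    have h5 : (n : ℝ) ^ 2 * stepSize n 1 ^ 2 * (A *ᵥ (x - x₀) ⬝ᵥ A *ᵥ (x - x₀))
        ≤ phi0 A x₀ x := by
      calc _ ≤ (n : ℝ) ^ 2 * stepSize n 1 ^ 2 * (n * lamSq A (x - x₀)) := by gcongr
        _ = (n : ℝ) ^ 3 * stepSize n 1 ^ 2 * lamSq A (x - x₀) := by ring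
        _ = phi0 A x₀ x := by rw [cube_mul_stepSize_one_sq hn]; rfl
    have h6 : objective A x - objective A xs
        ≤ (Aᵀ *ᵥ (A *ᵥ x₀) - 1) ⬝ᵥ (x - xs) + A *ᵥ (x - x₀) ⬝ᵥ A *ᵥ (x - xs) := by
      have : lagrangian A x (A *ᵥ x) - lagrangian A xs (A *ᵥ x)
          = (Aᵀ *ᵥ (A *ᵥ x₀) - 1) ⬝ᵥ (x - xs) + A *ᵥ (x - x₀) ⬝ᵥ A *ᵥ (x - xs) := by
        simp only [lagrangian, sub_dotProduct, dotProduct_sub, transpose_mulVec_dotProduct,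
          mulVec_sub]
        ring
      linarith
    have h7 := mul_le_mul_of_nonneg_left h6 ha.le
    rw [mul_add, dotProduct_sub, mul_sub (stepSize n 1)] at h7
    simp only [smul_dotProduct, smul_eq_mul]
    linarith
  | succ k ih =>
    have hbox : (iterate A x₀ j (k + 2)).x ∈ box A := by
      rw [x_eq x₀ j hc]; exact boxMin_mem _ _
    have h1 := phi_le x₀ j hc k hbox
    have h2 := phi_succ A x₀ j k (iterate A x₀ j (k + 2)).x
    have h2' := phi_succ A x₀ j k xs
    have h3 := lagrangian_combine A x₀ j hn k (iterate A x₀ j (k + 2)).y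
    have h4 := lagrangian_eq A (iterate A x₀ j (k + 2)).xt (iterate A x₀ j (k + 2)).y
    have h5 := lagrangian_eq A (iterate A x₀ j (k + 1)).xt (iterate A x₀ j (k + 2)).y
    have h6 := lagrangian_eq A xs (iterate A x₀ j (k + 2)).y
    have h7 := dotProduct_self_nonneg ((iterate A x₀ j (k + 2)).y - A *ᵥ xs)
    rw [← y_eq A x₀ j hn] at h4 h5
    rw [sub_self, zero_dotProduct] at h4
    have hx := x_succ x₀ j hc k
    have hyb := stepSize_smul_ybar A x₀ j hn k
    have ha := (stepSize_pos hn (k + 1)).le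
    have hb := sq_mul_stepSize_sq_le hn k
    have hS := stepSum_succ n (k + 1)
    have hT : totalNoise A x₀ xs j (k + 1) = totalNoise A x₀ xs j k
        + stepSize n (k + 2) * noise A x₀ xs j (k + 1) (j (k + 1)) := Finset.sum_range_succ _ _
    rw [hT]
    clear hT
    simp only [noise, Pi.sub_apply (iterate A x₀ j (k + 1)).x] at *
    simp only [extrapolation, add_assoc, Nat.reduceAdd] at *
    generalize (iterate A x₀ j (k + 2)).phi = φ' at *
    generalize (iterate A x₀ j (k + 2)).x = x' at *
    generalize (iterate A x₀ j (k + 2)).y = y' at *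
    generalize (iterate A x₀ j (k + 2)).xt = xt' at *
    generalize (iterate A x₀ j (k + 1)).phi = φ at *
    generalize (iterate A x₀ j (k + 1)).x = x at *
    generalize (iterate A x₀ j (k + 1)).y = y at *
    generalize (iterate A x₀ j (k + 1)).xt = xt at *
    generalize (iterate A x₀ j (k + 1)).ybar = yb at *
    generalize (iterate A x₀ j k).y = y₀ at *
    generalize stepSize n (k + 2) = a at *
    generalize stepSize n (k + 1) = b at *
    generalize stepSum n (k + 2) = S' at *
    generalize stepSum n (k + 1) = S at *
    generalize j (k + 1) = i at *
    generalize totalNoise A x₀ xs j k = T at *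
    generalize hδ : x' i - x i = δ at *
    have hx' : x' - x = Pi.single i δ := by rw [hx, add_sub_cancel_left]
    -- No factor `n` is lost here, since only one coordinate has moved.
    have he : A *ᵥ (x' - x) ⬝ᵥ A *ᵥ (x' - x) = lamSq A (x' - x) := by
      rw [hx', mulVec_single_dotProduct_self]
    have hz : (Aᵀ *ᵥ yb - 1) ⬝ᵥ (x' - x) = (Aᵀ *ᵥ yb - 1) i * (x' i - x i) := by
      rw [hx', dotProduct_single, hδ]
    -- Uses `a y' = a ȳ + a(y' - y) - b(y - y₀)` and `n x' - (n-1) x - xs = (x - xs) + n(x' - x)`.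
    -- The terms paired with `x' - xs` and `x - xs` telescope.
    have hgrad : a * (lagrangian A ((n : ℝ) • x' - ((n : ℝ) - 1) • x) y' - lagrangian A xs y')
        = a * ((Aᵀ *ᵥ yb - 1) ⬝ᵥ (x - xs)) + n * a * ((Aᵀ *ᵥ yb - 1) ⬝ᵥ (x' - x))
          + a * ((y' - y) ⬝ᵥ A *ᵥ (x' - xs)) + (n - 1) * a * ((y' - y) ⬝ᵥ A *ᵥ (x' - x))
          - b * ((y - y₀) ⬝ᵥ A *ᵥ (x - xs)) - n * b * ((y - y₀) ⬝ᵥ A *ᵥ (x' - x)) := by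
      have e1 := congrArg (· ⬝ᵥ A *ᵥ (x - xs)) hyb
      have e2 := congrArg (· ⬝ᵥ A *ᵥ (x' - x)) hyb
      simp only [add_dotProduct, smul_dotProduct, smul_eq_mul, sub_dotProduct, dotProduct_sub,
        mulVec_sub] at e1 e2
      simp only [lagrangian, sub_dotProduct, dotProduct_sub, transpose_mulVec_dotProduct,
        mulVec_sub, dotProduct_smul, smul_eq_mul]
      linear_combination -e1 - n * e2
    -- The two quarters of `‖A(x' - x)‖²` are covered by the strong convexity of `φ`. The square of
    -- `y - y₀` from `hF` cancels against the reserve in the induction hypothesis.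
    have hE := mul_dotProduct_le ((n - 1) * a) (y' - y) (A *ᵥ (x' - x))
    have hF := mul_dotProduct_le (-(n * b)) (y - y₀) (A *ᵥ (x' - x))
    have hD := dotProduct_self_nonneg (y' - y)
    have h8 : ((n - 1) * a) ^ 2 * ((y' - y) ⬝ᵥ (y' - y))
        ≤ (n : ℝ) ^ 2 * a ^ 2 * ((y' - y) ⬝ᵥ (y' - y)) := by
      rw [← mul_pow]
      have h10 : (0 : ℝ) ≤ n - 1 := by linarith
      have h11 : (n : ℝ) - 1 ≤ n := by linarith
      gcongr
    have h9 := mul_le_mul_of_nonneg_right hb hD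
    have h10 : a * lagrangian A xs y' ≤ a * objective A xs :=
      mul_le_mul_of_nonneg_left (by linarith) ha
    rw [h4, h5] at h3
    subst hS
    have hz' := congrArg (n * a * ·) hz
    rw [he] at hE hF
    linarith

/-- Since `xs` lies in the box, `φ_k(x_k) - φ_k(xs) ≤ -½‖x_k - xs‖_Λ²`. This and the reserved
negative square absorb the bilinear term. -/
theorem gap_le_totalNoise (hn : 4 ≤ n) (hA : ∀ i j, 0 ≤ A i j) (hc : ∀ j, ∃ i, A i j ≠ 0)
    (hxs : xs ∈ minimizers A) (k : ℕ) :
    stepSum n (k + 2) * (objective A (iterate A x₀ j (k + 2)).xt - objective A xs)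
      ≤ phi0 A x₀ xs + totalNoise A x₀ xs j (k + 1) := by
  have h0 : (4 : ℝ) ≤ n := by exact_mod_cast hn
  have h1 := gap_le_potential (x₀ := x₀) (xs := xs) j hn hc (k + 1)
  have h2 := phi_le x₀ j hc (k + 1) (minimizers_subset_box hA hc hxs)
  simp only [add_assoc, Nat.reduceAdd] at h1 h2
  have hb := sq_mul_stepSize_sq_le hn k
  rw [lamSq_sub_comm] at h2
  generalize (iterate A x₀ j (k + 2)).x = x at *
  generalize (iterate A x₀ j (k + 2)).y - (iterate A x₀ j (k + 1)).y = d at *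
  -- The scaling by `1 / n` matches the coefficient `n² a²` of the reserve.
  have h3 := mul_dotProduct_le (n * stepSize n (k + 2)) d ((1 / (n : ℝ)) • A *ᵥ (x - xs))
  have h4 := mulVec_dotProduct_self_le A (x - xs)
  have h5 := lamSq_nonneg A (x - xs)
  rw [dotProduct_smul, dotProduct_smul, smul_dotProduct] at h3
  simp only [smul_eq_mul] at h3
  have h6 : n * stepSize n (k + 2) * (1 / (n : ℝ) * (d ⬝ᵥ A *ᵥ (x - xs)))
      = stepSize n (k + 2) * (d ⬝ᵥ A *ᵥ (x - xs)) := by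
    field_simp
  have h7 : 1 / 4 * (1 / (n : ℝ) * (1 / n * (A *ᵥ (x - xs) ⬝ᵥ A *ᵥ (x - xs))))
      ≤ 1 / 2 * lamSq A (x - xs) := by
    calc _ ≤ 1 / 4 * (1 / (n : ℝ) * (1 / n * (n * lamSq A (x - xs)))) := by gcongr
      _ = 1 / 4 * (1 / (n : ℝ)) * lamSq A (x - xs) := by field_simp
      _ ≤ _ := by
        gcongr
        have : 1 / (n : ℝ) ≤ 1 := by rw [div_le_one (by linarith)]; linarith
        linarith
  linarith

end Path

/-! ## Expectations -/

section Expectation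

/-- A function of a sequence that depends on the first `k` entries only. -/
def DependsOnPrefix {α : Type*} (k : ℕ) (F : (ℕ → Fin n) → α) : Prop :=
  ∀ j j' : ℕ → Fin n, (∀ i < k, j i = j' i) → F j = F j'

/-- A sequence with a given prefix. -/
def extendPrefix (c : Fin n) (k : ℕ) (r : Finset.range k → Fin n) (i : ℕ) : Fin n :=
  if h : i ∈ Finset.range k then r ⟨i, h⟩ else c

theorem DependsOnPrefix.eq_extendPrefix {α : Type*} {k : ℕ} {F : (ℕ → Fin n) → α}
    (hF : DependsOnPrefix k F) (c : Fin n) (j : ℕ → Fin n) :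
    F j = F (extendPrefix c k fun i => j i) :=
  hF _ _ fun i hi => by simp [extendPrefix, hi]

variable {Ω : Type*} [MeasurableSpace Ω] {P : Measure Ω} {j : ℕ → Ω → Fin n}

theorem UniformSamples.measurable_prefix (hj : UniformSamples P j) (k : ℕ) :
    Measurable fun ω (i : Finset.range k) => j i ω :=
  measurable_pi_lambda _ fun i => hj.measurable i

variable [IsProbabilityMeasure P]

theorem UniformSamples.integrable (hj : UniformSamples P j) {k : ℕ}
    {F : (ℕ → Fin n) → ℝ} (hF : DependsOnPrefix k F) :
    Integrable (fun ω => F fun i => j i ω) P := by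
  -- `extendPrefix` needs a default coordinate; if there is none, `Ω` is empty.
  rcases isEmpty_or_nonempty (Fin n) with h | ⟨⟨c⟩⟩
  · have : IsEmpty Ω := ⟨fun ω => h.elim (j 0 ω)⟩
    rw [Measure.eq_zero_of_isEmpty P]
    exact integrable_zero_measure
  have h1 : (fun ω => F fun i => j i ω)
      = (fun r => F (extendPrefix c k r)) ∘ fun ω (i : Finset.range k) => j i ω :=
    funext fun ω => hF.eq_extendPrefix c _
  rw [h1]
  exact Integrable.comp_measurable Integrable.of_finite (hj.measurable_prefix k)

/-- Averaging over the fresh sample: the integrand is split by the value `c` of `j k`, and the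
indicator of `j k = c` is independent of the first `k` samples, with mean `1 / n`. -/
theorem UniformSamples.integral_comp_sample (hj : UniformSamples P j) {k : ℕ}
    {F : (ℕ → Fin n) → Fin n → ℝ} (hF : DependsOnPrefix k F) :
    ∫ ω, F (fun i => j i ω) (j k ω) ∂P = ∫ ω, 1 / (n : ℝ) * ∑ c, F (fun i => j i ω) c ∂P := by
  rcases isEmpty_or_nonempty (Fin n) with h | ⟨⟨c₀⟩⟩
  · have : IsEmpty Ω := ⟨fun ω => h.elim (j 0 ω)⟩
    rw [Measure.eq_zero_of_isEmpty P]
    simp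
  have h1 : ∀ ω, F (fun i => j i ω) (j k ω)
      = ∑ c, F (fun i => j i ω) c * Set.indicator {c} (fun _ => (1 : ℝ)) (j k ω) := fun ω => by
    rw [Finset.sum_eq_single (j k ω)]
    · simp
    · intro c _ hc
      simp [hc.symm]
    · simp
  have hFc : ∀ c, DependsOnPrefix k fun j => F j c := fun c j j' h =>
    congrFun (hF j j' h) c
  have h2 : ∀ c, Integrable (fun ω => F (fun i => j i ω) c) P := fun c => hj.integrable (hFc c)
  have h3 : ∀ c, Integrable (fun ω => Set.indicator {c} (fun _ => (1 : ℝ)) (j k ω)) P := fun c =>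
    Integrable.comp_measurable (g := Set.indicator {c} fun _ => (1 : ℝ)) Integrable.of_finite
      (hj.measurable k)
  have hind : ∀ c, IndepFun (fun ω => F (fun i => j i ω) c)
      (fun ω => Set.indicator {c} (fun _ => (1 : ℝ)) (j k ω)) P := fun c => by
    have := (hj.indep.indepFun_finset (Finset.range k) {k} (by simp) hj.measurable).comp
      (φ := fun r => F (extendPrefix c₀ k r) c)
      (ψ := fun r : ({k} : Finset ℕ) → Fin n =>
        Set.indicator {c} (fun _ => (1 : ℝ)) (r ⟨k, by simp⟩))
      (measurable_of_finite _) (measurable_of_finite _)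
    have h5 : (fun ω => F (fun i => j i ω) c) = (fun r => F (extendPrefix c₀ k r) c) ∘
        fun ω (i : Finset.range k) => j i ω := funext fun ω => (hFc c).eq_extendPrefix c₀ _
    rw [h5]
    exact this
  have h4 : ∀ c, ∫ ω, Set.indicator {c} (fun _ => (1 : ℝ)) (j k ω) ∂P = 1 / (n : ℝ) := fun c => by
    have h5 : (fun ω => Set.indicator {c} (fun _ => (1 : ℝ)) (j k ω))
        = Set.indicator {ω | j k ω = c} 1 := by
      funext ω
      simp [Set.indicator]
    rw [h5, integral_indicator_one, hj.uniform]
    exact hj.measurable k (measurableSet_singleton c)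
  have hint : ∀ c ∈ Finset.univ, Integrable (fun ω =>
      F (fun i => j i ω) c * Set.indicator {c} (fun _ => (1 : ℝ)) (j k ω)) P := fun c _ =>
    (hind c).integrable_mul (h2 c) (h3 c)
  simp only [h1]
  rw [integral_finsetSum _ hint, integral_const_mul,
    integral_finsetSum _ fun c _ => h2 c, Finset.mul_sum]
  refine Finset.sum_congr rfl fun c _ => ?_
  rw [(hind c).integral_fun_mul_eq_mul_integral (h2 c).aestronglyMeasurable
    (h3 c).aestronglyMeasurable, h4, mul_comm]

variable {A : Matrix (Fin m) (Fin n) ℝ} {x₀ xs : Fin n → ℝ}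

/-- `n` copies of the inner product minus `n` times the sum of its terms: sampling with weight `n`
is unbiased. -/
theorem sum_noise (j : ℕ → Fin n) (k : ℕ) : ∑ c, noise A x₀ xs j k c = 0 := by
  simp [noise, Finset.sum_sub_distrib, ← Finset.mul_sum, dotProduct]

theorem dependsOnPrefix_noise (A : Matrix (Fin m) (Fin n) ℝ) (x₀ xs : Fin n → ℝ) (k : ℕ) :
    DependsOnPrefix k fun j => noise A x₀ xs j k := fun j j' h => by
  funext c
  simp only [noise, iterate_congr A x₀ k h]

theorem UniformSamples.integrable_noise (hj : UniformSamples P j) (k : ℕ) :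
    Integrable (fun ω => noise A x₀ xs (fun i => j i ω) k (j k ω)) P :=
  hj.integrable (k := k + 1) (F := fun j => noise A x₀ xs j k (j k)) fun j j' h => by
    simp only [h k k.lt_succ_self]
    exact congrFun (dependsOnPrefix_noise A x₀ xs k j j' fun i hi =>
      h i (hi.trans k.lt_succ_self)) _

theorem UniformSamples.integral_noise (hj : UniformSamples P j) (k : ℕ) :
    ∫ ω, noise A x₀ xs (fun i => j i ω) k (j k ω) ∂P = 0 := by
  rw [hj.integral_comp_sample (dependsOnPrefix_noise A x₀ xs k)]
  simp [sum_noise]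

theorem UniformSamples.integrable_totalNoise (hj : UniformSamples P j) (K : ℕ) :
    Integrable (fun ω => totalNoise A x₀ xs (fun i => j i ω) K) P :=
  integrable_finsetSum _ fun k _ => (hj.integrable_noise (k + 1)).const_mul _

theorem UniformSamples.integral_totalNoise (hj : UniformSamples P j) (K : ℕ) :
    ∫ ω, totalNoise A x₀ xs (fun i => j i ω) K ∂P = 0 := by
  unfold totalNoise
  rw [integral_finsetSum _ fun k _ => (hj.integrable_noise (k + 1)).const_mul _]
  simp only [integral_const_mul, hj.integral_noise, mul_zero, Finset.sum_const_zero]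

theorem output_nonneg (hn : 4 ≤ n) (hc : ∀ j, ∃ i, A i j ≠ 0) (j : ℕ → Fin n) {K : ℕ}
    (hK : 2 ≤ K) (i : Fin n) : 0 ≤ output A x₀ j K i := by
  obtain ⟨k, rfl⟩ := Nat.exists_eq_add_of_le' hK
  exact xt_nonneg x₀ j hn hc (k + 1) i

theorem dependsOnPrefix_output (A : Matrix (Fin m) (Fin n) ℝ) (x₀ : Fin n → ℝ) (K : ℕ) :
    DependsOnPrefix K fun j => output A x₀ j K := fun j j' h => by
  simp only [output, iterate_congr A x₀ K h]

theorem UniformSamples.integrable_output (hj : UniformSamples P j) (K : ℕ)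
    (g : (Fin n → ℝ) → ℝ) : Integrable (fun ω => g (output A x₀ (fun i => j i ω) K)) P :=
  hj.integrable (F := fun j => g (output A x₀ j K)) fun j j' h =>
    congrArg g (dependsOnPrefix_output A x₀ K j j' h)

theorem UniformSamples.integral_objective_sub_le (hj : UniformSamples P j) (hn : 4 ≤ n)
    (hA : ∀ i j, 0 ≤ A i j) (hc : ∀ j, ∃ i, A i j ≠ 0) (hxs : xs ∈ minimizers A) {K : ℕ}
    (hK : 2 ≤ K) :
    ∫ ω, (objective A (output A x₀ (fun k => j k ω) K) - objective A xs) ∂P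
      ≤ phi0 A x₀ xs / stepSum n K := by
  obtain ⟨k, rfl⟩ := Nat.exists_eq_add_of_le' hK
  rw [le_div_iff₀' (stepSum_pos hn (k + 1)), ← integral_const_mul]
  refine (integral_mono
    ((hj.integrable_output (k + 2) fun x => objective A x - objective A xs).const_mul _)
    ((integrable_const _).add (hj.integrable_totalNoise (k + 1)))
    fun ω => gap_le_totalNoise (fun i => j i ω) hn hA hc hxs k).trans_eq ?_
  simp only [Pi.add_apply]
  rw [integral_add (integrable_const _) (hj.integrable_totalNoise (k + 1)),
    hj.integral_totalNoise]
  simp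

theorem UniformSamples.integral_gradient_le (hj : UniformSamples P j) (hn : 4 ≤ n)
    (hA : ∀ i j, 0 ≤ A i j) (hc : ∀ j, ∃ i, A i j ≠ 0) (hxs : xs ∈ minimizers A) {K : ℕ}
    (hK : 2 ≤ K) :
    ∫ ω, gradient A (output A x₀ (fun k => j k ω) K) ⬝ᵥ
        (output A x₀ (fun k => j k ω) K - xs) ∂P
      ≤ 2 * (phi0 A x₀ xs / stepSum n K) := by
  refine (integral_mono (hj.integrable_output K fun x => gradient A x ⬝ᵥ (x - xs))
    ((hj.integrable_output K fun x => objective A x - objective A xs).const_mul 2)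
    fun ω => gradient_dotProduct_sub_le hxs (output_nonneg hn hc _ hK)).trans ?_
  rw [integral_const_mul]
  exact mul_le_mul_of_nonneg_left (hj.integral_objective_sub_le hn hA hc hxs hK) two_pos.le

/-- `6n / √ε` squares to `36 n² / ε`, which matches the denominator of the growth bound. -/
theorem one_div_le_stepSum (hn : 4 ≤ n) {ε : ℝ} (hε : 0 < ε) {K : ℕ}
    (hK : 5 / 2 * (n : ℝ) * Real.log n + 6 * n / √ε ≤ K) : 1 / ε ≤ stepSum n K := by
  have h0 : (4 : ℝ) ≤ n := by exact_mod_cast hn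
  have hs := Real.sqrt_pos.2 hε
  have h1 : 0 < 6 * (n : ℝ) / √ε := by positivity
  refine le_trans ?_ (stepSum_lower_bound hn (by linarith))
  rw [le_div_iff₀ (by positivity)]
  calc 1 / ε * (36 * (n : ℝ) ^ 2) = (6 * n / √ε) ^ 2 := by
        rw [div_pow, Real.sq_sqrt hε.le]; ring
    _ ≤ _ := by gcongr; linarith

theorem two_le_of_le (hn : 4 ≤ n) {ε : ℝ} {K : ℕ}
    (hK : 5 / 2 * (n : ℝ) * Real.log n + 6 * n / √ε ≤ K) : 2 ≤ K := by
  have h0 : (4 : ℝ) ≤ n := by exact_mod_cast hn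
  have h1 : 0 ≤ 6 * (n : ℝ) / √ε := by positivity
  have h2 := one_lt_log hn
  have : (2 : ℝ) ≤ K := by nlinarith
  exact_mod_cast this

theorem UniformSamples.integral_objective_sub_le_mul (hj : UniformSamples P j) (hn : 4 ≤ n)
    (hA : ∀ i j, 0 ≤ A i j) (hc : ∀ j, ∃ i, A i j ≠ 0) (hxs : xs ∈ minimizers A)
    (h : phi0 A x₀ xs ≤ |objective A xs|) {ε : ℝ} (hε : 0 < ε) {K : ℕ}
    (hK : 5 / 2 * (n : ℝ) * Real.log n + 6 * n / √ε ≤ K) :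
    ∫ ω, (objective A (output A x₀ (fun k => j k ω) K) - objective A xs) ∂P
      ≤ ε * |objective A xs| := by
  have h1 := one_div_le_stepSum hn hε hK
  have h2 : 0 < 1 / ε := by positivity
  refine (hj.integral_objective_sub_le hn hA hc hxs (two_le_of_le hn hK)).trans ?_
  rw [div_le_iff₀ (h2.trans_le h1)]
  calc phi0 A x₀ xs ≤ |objective A xs| := h
    _ = ε * |objective A xs| * (1 / ε) := by field_simp
    _ ≤ _ := by gcongr

end Expectation

/-! ## Sparse matrices -/

section Sparse

variable {A : Matrix (Fin m) (Fin n) ℝ} (S : SparseMatrix A)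

/-- The number of non-zero entries of column `j`. -/
def SparseMatrix.count (j : ℕ) : ℕ := S.ptr (j + 1) - S.ptr j

theorem SparseMatrix.count_eq (j : Fin n) : S.count j = {i : Fin m | A i j ≠ 0}.ncard := by
  rw [count, S.ptr_succ]; omega

/-- The format fixes no order and does not forbid duplicates explicitly. Each non-zero entry has a
position, distinct rows have distinct positions, and there are exactly as many positions as non-zero
entries, so this is a bijection. -/
theorem SparseMatrix.sum_column_apply (j : Fin n) (F : ℕ → ℝ → ℝ) (hF : ∀ i, F i 0 = 0) :
    ∑ q ∈ Finset.range (S.count j), F (S.row (S.ptr j + q)) (S.val (S.ptr j + q))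
      = ∑ i : Fin m, F i (A i j) := by
  classical
  have h0 : ∀ i : Fin m, A i j ≠ 0 → ∃ q, q < S.count j ∧ S.row (S.ptr j + q) = i ∧
      S.val (S.ptr j + q) = A i j := fun i hi => by
    obtain ⟨p, h1, h2, h3, h4⟩ := S.entry j i hi
    have h5 : S.ptr j + (p - S.ptr j) = p := by omega
    exact ⟨p - S.ptr j, by rw [count]; omega, by rw [h5, h3], by rw [h5, h4]⟩
  choose! q hq hrow hval using h0
  have hinj : Set.InjOn q (Finset.univ.filter fun i => A i j ≠ 0) := fun a ha b hb h => by
    have h1 := hrow a (by simpa using ha)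
    rw [h, hrow b (by simpa using hb)] at h1
    exact Fin.ext h1.symm
  have himg : (Finset.univ.filter fun i => A i j ≠ 0).image q = Finset.range (S.count j) := by
    apply Finset.eq_of_subset_of_card_le
    · intro a ha
      obtain ⟨i, hi, rfl⟩ := Finset.mem_image.1 ha
      exact Finset.mem_range.2 (hq i (by simpa using hi))
    · rw [Finset.card_image_of_injOn hinj, Finset.card_range, S.count_eq,
        Set.ncard_eq_toFinset_card', Set.toFinset_ofPred]
  rw [← himg, Finset.sum_image hinj]
  calc _ = ∑ i with A i j ≠ 0, F i (A i j) := Finset.sum_congr rfl fun i hi => by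
        have h1 := (Finset.mem_filter.1 hi).2
        rw [hrow i h1, hval i h1]
    _ = _ := Finset.sum_subset (Finset.filter_subset _ _) fun i _ hi => by
        have : A i j = 0 := by simpa using hi
        rw [this, hF]

theorem SparseMatrix.sum_column (j : Fin n) (g : ℕ → ℝ) :
    ∑ q ∈ Finset.range (S.count j), S.val (S.ptr j + q) * g (S.row (S.ptr j + q))
      = ∑ i, A i j * g i :=
  S.sum_column_apply j (fun i v => v * g i) fun _ => zero_mul _

theorem SparseMatrix.sum_column_sq (j : Fin n) :
    ∑ q ∈ Finset.range (S.count j), S.val (S.ptr j + q) * S.val (S.ptr j + q) = colSq A j := by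
  rw [S.sum_column_apply j (fun _ v => v * v) fun _ => zero_mul _]
  simp only [colSq, sq]

theorem SparseMatrix.sum_column_add (j : Fin n) (b k : ℕ) (c : ℝ) :
    (∑ q ∈ Finset.range (S.count j), S.val (S.ptr j + q) *
        if b + S.row (S.ptr j + q) = k then c else 0)
      = ∑ i : Fin m, A i j * if b + i = k then c else 0 :=
  S.sum_column j fun i => if b + i = k then c else 0

theorem SparseMatrix.sum_count : ∑ j : Fin n, S.count j = nnz A := by
  classical
  simp only [S.count_eq, nnz, Set.ncard_eq_toFinset_card', Set.toFinset_ofPred, Finset.card_filter]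
  rw [Fintype.sum_prod_type_right]

end Sparse

/-! ## The semantics of the machine -/

section Machine

/-- Invariant rule for loops. The bound is evaluated once, in the initial state, and the counter is
written before each pass. -/
theorem run_loop (tape : ℕ → ℕ) (a : ℕ) (bound : NatExpr) (body : Program) (s : Machine)
    (Inv : ℕ → Machine → Prop)
    (h0 : Inv 0 { s with time := s.time + bound.cost })
    (hs : ∀ t < bound.eval s.ints, ∀ s', Inv t s' →
      Inv (t + 1) (body.run tape (s'.writeNat a 0 t 1))) :
    Inv (bound.eval s.ints) ((Program.loop a bound body).run tape s) := by
  have : ∀ N ≤ bound.eval s.ints, Inv N (Nat.rec { s with time := s.time + bound.cost }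
      (fun t s' => body.run tape (s'.writeNat a 0 t 1)) N : Machine) := by
    intro N
    induction N with
    | zero => exact fun _ => h0
    | succ N ih => exact fun hN => hs N (by omega) _ (ih (by omega))
  exact this _ le_rfl

end Machine

/-! ## The program

Integer arrays: `3` and `4` hold the counters of the outer and of the inner loops, `5` holds the
current column and the bases of the current and of the next segment of the real array `9`.

Real arrays: `2` output, `3` squared column norms, `4` the point `x`, `5` the accumulated linear
part, `6` the correction `r` with `A_k x̃_k = A_k x_k + r_k`, `7` the vector `A x`, `8` the vector
`A r`, `9` the vectors `A (x_k - x_{k-1})`, one segment for each iteration, and `10` scalars: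
`0` step size, `1` and `2` step sums, `3` and `4` multipliers of the update, `5`, `6` and `7`
multipliers of the gradient estimate, `8` inner product, `9` increment. -/

section Program

open Program

/-- The dimension or iteration count stored in entry `i` of the integer array `0`. -/
def dimExpr (i : ℕ) : NatExpr := .get 0 (.const i)

/-- The current column. -/
def colExpr : NatExpr := .get 5 (.const 0)

/-- The base of the current segment. -/
def baseExpr : NatExpr := .get 5 (.const 1)

/-- The base of the next segment. -/
def nextBaseExpr : NatExpr := .get 5 (.const 2)

/-- The number of non-zero entries of the current column. -/
def countExpr : NatExpr := .sub (.get 1 (.add colExpr (.const 1))) (.get 1 colExpr)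

/-- The current position in the current column. -/
def posExpr : NatExpr := .add (.get 1 colExpr) (.get 4 (.const 0))

/-- The row of the current entry. -/
def rowExpr : NatExpr := .get 2 posExpr

/-- The value of the current entry. -/
def valExpr : RealExpr := .get 0 posExpr

/-- A scalar variable. -/
def scalar (i : ℕ) : RealExpr := .get 10 (.const i)

/-- Assignment to a scalar variable. -/
def setScalar (i : ℕ) (e : RealExpr) : Program := .setReal 10 (.const i) e

/-- Accumulates the inner product of the current column and the extrapolated point. -/
def dotLoop : Program :=
  .loop 4 countExpr (setScalar 8 (.add (scalar 8) (.mul valExpr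
    (.add (.add (.mul (scalar 5) (.get 7 rowExpr)) (.mul (scalar 6) (.get 8 rowExpr)))
      (.mul (scalar 7) (.get 9 (.add baseExpr rowExpr)))))))

/-- Adds multiples of the current column to the stored products with `A`. -/
def updateLoop : Program :=
  .loop 4 countExpr (.seq (.setReal 7 rowExpr (.add (.get 7 rowExpr) (.mul valExpr (scalar 9))))
    (.seq (.setReal 8 rowExpr
        (.add (.get 8 rowExpr) (.mul valExpr (.mul (scalar 4) (scalar 9)))))
      (.setReal 9 (.add nextBaseExpr rowExpr)
        (.add (.get 9 (.add nextBaseExpr rowExpr)) (.mul valExpr (scalar 9))))))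

/-- Updates the accumulated linear part and the point in the current coordinate. -/
def coordinateUpdate : Program :=
  .seq (.setReal 5 colExpr (.add (.get 5 colExpr)
      (.mul (scalar 3) (.sub (scalar 8) (.ofNat (.const 1))))))
    (.seq (setScalar 9 (.sub (.max (.ofNat (.const 0)) (.min
        (.div (.ofNat (.const 1)) (.get 3 colExpr))
        (.sub (.get 1 colExpr) (.div (.get 5 colExpr) (.get 3 colExpr))))) (.get 4 colExpr)))
      (.seq (.setReal 4 colExpr (.add (.get 4 colExpr) (scalar 9)))
        (.setReal 6 colExpr (.add (.get 6 colExpr) (.mul (scalar 4) (scalar 9))))))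

/-- A step of the algorithm in the current coordinate. -/
def stepProgram : Program :=
  .seq (setScalar 8 (.ofNat (.const 0))) (.seq dotLoop (.seq coordinateUpdate updateLoop))

/-- Computes the squared norm of the current column, and adds its contribution to `A x₀`. -/
def setupLoop : Program :=
  .loop 4 countExpr (.seq (.setReal 3 colExpr (.add (.get 3 colExpr) (.mul valExpr valExpr)))
    (.seq (.setReal 7 rowExpr (.add (.get 7 rowExpr) (.mul valExpr (.get 1 colExpr))))
      (.setReal 9 rowExpr (.add (.get 9 rowExpr) (.mul valExpr (.get 1 colExpr))))))

/-- Makes the counter of the outer loop the current column. -/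
def selectColumn : Program := .setNat 5 (.const 0) (.get 3 (.const 0))

/-- Sets the point and the products with `A` to their initial values. -/
def setupProgram : Program :=
  .loop 3 (dimExpr 1)
    (.seq selectColumn (.seq (.setReal 4 colExpr (.get 1 colExpr)) setupLoop))

/-- Initial values of the scalars. -/
def setupScalars : Program :=
  .seq (setScalar 0 (.div (.ofNat (.const 1)) (.mul (.sqrt (.ofNat (.const 2)))
      (.mul (.ofNat (dimExpr 1)) (.sqrt (.ofNat (dimExpr 1)))))))
    (.seq (setScalar 3 (scalar 0)) (.seq (setScalar 7 (.ofNat (.const 1)))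
      (.setNat 5 (.const 2) (dimExpr 0))))

/-- The full step of the first iteration. -/
def firstIteration : Program := .loop 3 (dimExpr 1) (.seq selectColumn stepProgram)

/-- The scalars after the first iteration; the first sample is dropped. -/
def firstScalars : Program :=
  .seq (setScalar 1 (scalar 0))
    (.seq (setScalar 7 (.sub (.ofNat (dimExpr 1)) (.ofNat (.const 1))))
      (.seq (setScalar 0 (.div (scalar 0) (scalar 7)))
        (.seq (setScalar 5 (.ofNat (.const 1)))
          (.seq (.setNat 5 (.const 1) nextBaseExpr)
            (.seq (.setNat 5 (.const 2) (.add nextBaseExpr (dimExpr 0)))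
              (.sample 5 (.const 0)))))))

/-- The scalars before a step, and the sample. -/
def beforeStep : Program :=
  .seq (setScalar 3 (.mul (.ofNat (dimExpr 1)) (scalar 0)))
    (.seq (setScalar 2 (scalar 1)) (.seq (setScalar 1 (.add (scalar 1) (scalar 0)))
      (.seq (setScalar 4 (.sub (scalar 3) (scalar 1))) (.sample 5 (.const 0)))))

/-- The scalars after a step. -/
def afterStep : Program :=
  .seq (setScalar 8 (scalar 0))
    (.seq (setScalar 0 (.min
        (.div (scalar 3) (.sub (.ofNat (dimExpr 1)) (.ofNat (.const 1))))
        (.div (.sqrt (scalar 1)) (.mul (.ofNat (.const 2)) (.ofNat (dimExpr 1))))))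
      (.seq (setScalar 9 (.mul (.div (scalar 8) (scalar 0)) (.div (scalar 8) (scalar 2))))
        (.seq (setScalar 6 (.div (.sub (.ofNat (.const 1)) (scalar 9)) (scalar 1)))
          (.seq (setScalar 7 (.mul (scalar 9) (.sub (.ofNat (dimExpr 1)) (.ofNat (.const 1)))))
            (.seq (.setNat 5 (.const 1) nextBaseExpr)
              (.setNat 5 (.const 2) (.add nextBaseExpr (dimExpr 0))))))))

/-- All iterations but the first. -/
def mainLoop : Program :=
  .loop 3 (.sub (dimExpr 2) (.const 1)) (.seq beforeStep (.seq stepProgram afterStep))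

/-- Writes the output. -/
def outputLoop : Program :=
  .loop 3 (dimExpr 1) (.setReal 2 (.get 3 (.const 0))
    (.add (.get 4 (.get 3 (.const 0))) (.div (.get 6 (.get 3 (.const 0))) (scalar 1))))

/-- The implementation of SI-NNLS+. -/
def nnlsProgram : Program :=
  .seq setupProgram (.seq setupScalars (.seq firstIteration (.seq firstScalars
    (.seq mainLoop outputLoop))))

end Program

/-! ### Effects of the inner loops and of the coordinate update. -/

section Semantics

variable {A : Matrix (Fin m) (Fin n) ℝ} {S : SparseMatrix A} {s : Machine} {j : Fin n}
  (tape : ℕ → ℕ)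

/-- The sparse matrix is in memory, and `j` is the current column. -/
structure AtColumn (S : SparseMatrix A) (s : Machine) (j : Fin n) : Prop where
  ptr : s.ints 1 = S.ptr
  row : s.ints 2 = S.row
  val : s.reals 0 = S.val
  col : s.ints 5 0 = j

theorem eval_countExpr (h : AtColumn S s j) : countExpr.eval s.ints = S.count j := by
  simp [countExpr, colExpr, NatExpr.eval, h.ptr, h.col, SparseMatrix.count]

/-- The effect of `dotLoop`. -/
theorem run_dotLoop (h : AtColumn S s j) :
    (∀ a, a ≠ 4 → (dotLoop.run tape s).ints a = s.ints a) ∧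
    (∀ a, a ≠ 10 → (dotLoop.run tape s).reals a = s.reals a) ∧
    (∀ i, i ≠ 8 → (dotLoop.run tape s).reals 10 i = s.reals 10 i) ∧
    (dotLoop.run tape s).draws = s.draws ∧
    (dotLoop.run tape s).time = s.time + countExpr.cost + S.count j * 52 ∧
    (dotLoop.run tape s).reals 10 8 = s.reals 10 8 + ∑ i, A i j *
      (s.reals 10 5 * s.reals 7 i + s.reals 10 6 * s.reals 8 i
        + s.reals 10 7 * s.reals 9 (s.ints 5 1 + i)) := by
  rw [← S.sum_column j fun i => s.reals 10 5 * s.reals 7 i + s.reals 10 6 * s.reals 8 i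
        + s.reals 10 7 * s.reals 9 (s.ints 5 1 + i), ← eval_countExpr h]
  refine run_loop tape 4 countExpr _ s (fun t s' =>
    (∀ a, a ≠ 4 → s'.ints a = s.ints a) ∧
    (∀ a, a ≠ 10 → s'.reals a = s.reals a) ∧
    (∀ i, i ≠ 8 → s'.reals 10 i = s.reals 10 i) ∧
    s'.draws = s.draws ∧
    s'.time = s.time + countExpr.cost + t * 52 ∧
    s'.reals 10 8 = s.reals 10 8 + ∑ q ∈ Finset.range t, S.val (S.ptr j + q) *
      (s.reals 10 5 * s.reals 7 (S.row (S.ptr j + q))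
        + s.reals 10 6 * s.reals 8 (S.row (S.ptr j + q))
        + s.reals 10 7 * s.reals 9 (s.ints 5 1 + S.row (S.ptr j + q)))) ?_ ?_
  · simp
  · rintro t - s' ⟨h1, h2, h3, h4, h5, h6⟩
    refine ⟨fun a ha => ?_, fun a ha => ?_, fun i hi => ?_, h4, ?_, ?_⟩
    · simp [Program.run, setScalar, Machine.writeNat, Machine.writeReal, ha, h1]
    · simp [Program.run, setScalar, Machine.writeNat, Machine.writeReal, ha, h2]
    · simp [Program.run, setScalar, Machine.writeNat, Machine.writeReal, hi, h3, NatExpr.eval]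
    · simp [Program.run, setScalar, Machine.writeNat, Machine.writeReal, NatExpr.cost,
        RealExpr.cost, scalar, valExpr, rowExpr, posExpr, colExpr, baseExpr, h5]
      ring
    · simp [Program.run, setScalar, Machine.writeNat, Machine.writeReal, NatExpr.eval,
        RealExpr.eval, scalar, valExpr, rowExpr, posExpr, colExpr, baseExpr, h1, h2, h3, h6, h.ptr,
        h.row, h.val, h.col, Finset.sum_range_succ, add_assoc]

end Semantics

section Semantics

variable {A : Matrix (Fin m) (Fin n) ℝ} {S : SparseMatrix A} {s : Machine} {j : Fin n}
  (tape : ℕ → ℕ)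

/-- The effect of `updateLoop`. -/
theorem run_updateLoop (h : AtColumn S s j) :
    (∀ a, a ≠ 4 → (updateLoop.run tape s).ints a = s.ints a) ∧
    (∀ a, a ≠ 7 → a ≠ 8 → a ≠ 9 → (updateLoop.run tape s).reals a = s.reals a) ∧
    (updateLoop.run tape s).draws = s.draws ∧
    (updateLoop.run tape s).time = s.time + countExpr.cost + S.count j * 91 ∧
    (∀ i, (updateLoop.run tape s).reals 7 i = s.reals 7 i
      + ∑ k : Fin m, A k j * if (k : ℕ) = i then s.reals 10 9 else 0) ∧
    (∀ i, (updateLoop.run tape s).reals 8 i = s.reals 8 i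
      + ∑ k : Fin m, A k j * if (k : ℕ) = i then s.reals 10 4 * s.reals 10 9 else 0) ∧
    ∀ i, (updateLoop.run tape s).reals 9 i = s.reals 9 i
      + ∑ k : Fin m, A k j * if s.ints 5 2 + (k : ℕ) = i then s.reals 10 9 else 0 := by
  have hsum := fun i c => S.sum_column_add j 0 i c
  simp only [zero_add] at hsum
  simp only [← hsum, ← S.sum_column_add, ← eval_countExpr h]
  refine run_loop tape 4 countExpr _ s (fun t s' =>
    (∀ a, a ≠ 4 → s'.ints a = s.ints a) ∧
    (∀ a, a ≠ 7 → a ≠ 8 → a ≠ 9 → s'.reals a = s.reals a) ∧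
    s'.draws = s.draws ∧
    s'.time = s.time + countExpr.cost + t * 91 ∧
    (∀ i, s'.reals 7 i = s.reals 7 i + ∑ q ∈ Finset.range t, S.val (S.ptr j + q) *
      if S.row (S.ptr j + q) = i then s.reals 10 9 else 0) ∧
    (∀ i, s'.reals 8 i = s.reals 8 i + ∑ q ∈ Finset.range t, S.val (S.ptr j + q) *
      if S.row (S.ptr j + q) = i then s.reals 10 4 * s.reals 10 9 else 0) ∧
    ∀ i, s'.reals 9 i = s.reals 9 i + ∑ q ∈ Finset.range t, S.val (S.ptr j + q) *
      if s.ints 5 2 + S.row (S.ptr j + q) = i then s.reals 10 9 else 0) ?_ ?_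
  · simp
  · rintro t - s' ⟨h1, h2, h3, h4, h5, h6, h7⟩
    refine ⟨fun a ha => ?_, fun a ha ha' ha'' => ?_, h3, ?_, fun i => ?_, fun i => ?_, fun i => ?_⟩
    · simp [Program.run, Machine.writeNat, Machine.writeReal, ha, h1]
    · simp [Program.run, Machine.writeNat, Machine.writeReal, ha, ha', ha'', h2]
    · simp [Program.run, Machine.writeNat, Machine.writeReal, NatExpr.cost,
        RealExpr.cost, scalar, valExpr, rowExpr, posExpr, colExpr, nextBaseExpr, h4]
      ring
    · rw [Finset.sum_range_succ, ← add_assoc, ← h5]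
      simp [Program.run, Machine.writeNat, Machine.writeReal, NatExpr.eval,
        RealExpr.eval, scalar, valExpr, rowExpr, posExpr, colExpr, h1, h2, h.ptr, h.row, h.val,
        h.col, Function.update_apply]
      by_cases hi : i = S.row (S.ptr j + t)
      · subst hi; simp
      · simp [hi, Ne.symm hi]
    · rw [Finset.sum_range_succ, ← add_assoc, ← h6]
      simp [Program.run, Machine.writeNat, Machine.writeReal, NatExpr.eval,
        RealExpr.eval, scalar, valExpr, rowExpr, posExpr, colExpr, h1, h2, h.ptr, h.row, h.val,
        h.col, Function.update_apply]
      by_cases hi : i = S.row (S.ptr j + t)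
      · subst hi; simp
      · simp [hi, Ne.symm hi]
    · rw [Finset.sum_range_succ, ← add_assoc, ← h7]
      simp [Program.run, Machine.writeNat, Machine.writeReal, NatExpr.eval,
        RealExpr.eval, scalar, valExpr, rowExpr, posExpr, colExpr, nextBaseExpr, h1, h2, h.ptr,
        h.row, h.val, h.col, Function.update_apply]
      by_cases hi : i = s.ints 5 2 + S.row (S.ptr j + t)
      · subst hi; simp
      · simp [hi, Ne.symm hi]

/-- The effect of `setupLoop`. -/
theorem run_setupLoop (h : AtColumn S s j) :
    (∀ a, a ≠ 4 → (setupLoop.run tape s).ints a = s.ints a) ∧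
    (∀ a, a ≠ 3 → a ≠ 7 → a ≠ 9 → (setupLoop.run tape s).reals a = s.reals a) ∧
    (setupLoop.run tape s).draws = s.draws ∧
    (setupLoop.run tape s).time = s.time + countExpr.cost + S.count j * 79 ∧
    (∀ i, (setupLoop.run tape s).reals 3 i = s.reals 3 i + if i = j then colSq A j else 0) ∧
    (∀ i, (setupLoop.run tape s).reals 7 i = s.reals 7 i
      + ∑ k : Fin m, A k j * if (k : ℕ) = i then s.reals 1 j else 0) ∧
    ∀ i, (setupLoop.run tape s).reals 9 i = s.reals 9 i
      + ∑ k : Fin m, A k j * if (k : ℕ) = i then s.reals 1 j else 0 := by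
  have hsum := fun i c => S.sum_column_add j 0 i c
  simp only [zero_add] at hsum
  simp only [← hsum, ← S.sum_column_sq, ← eval_countExpr h]
  refine run_loop tape 4 countExpr _ s (fun t s' =>
    (∀ a, a ≠ 4 → s'.ints a = s.ints a) ∧
    (∀ a, a ≠ 3 → a ≠ 7 → a ≠ 9 → s'.reals a = s.reals a) ∧
    s'.draws = s.draws ∧
    s'.time = s.time + countExpr.cost + t * 79 ∧
    (∀ i, s'.reals 3 i = s.reals 3 i + if i = j then ∑ q ∈ Finset.range t,
      S.val (S.ptr j + q) * S.val (S.ptr j + q) else 0) ∧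
    (∀ i, s'.reals 7 i = s.reals 7 i + ∑ q ∈ Finset.range t, S.val (S.ptr j + q) *
      if S.row (S.ptr j + q) = i then s.reals 1 j else 0) ∧
    ∀ i, s'.reals 9 i = s.reals 9 i + ∑ q ∈ Finset.range t, S.val (S.ptr j + q) *
      if S.row (S.ptr j + q) = i then s.reals 1 j else 0) ?_ ?_
  · simp
  · rintro t - s' ⟨h1, h2, h3, h4, h5, h6, h7⟩
    refine ⟨fun a ha => ?_, fun a ha ha' ha'' => ?_, h3, ?_, fun i => ?_, fun i => ?_, fun i => ?_⟩
    · simp [Program.run, Machine.writeNat, Machine.writeReal, ha, h1]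
    · simp [Program.run, Machine.writeNat, Machine.writeReal, ha, ha', ha'', h2]
    · simp [Program.run, Machine.writeNat, Machine.writeReal, NatExpr.cost,
        RealExpr.cost, valExpr, rowExpr, posExpr, colExpr, h4]
      ring
    · have h5' := h5 i
      simp [Program.run, Machine.writeNat, Machine.writeReal, NatExpr.eval,
        RealExpr.eval, valExpr, posExpr, colExpr, h1, h2, h.ptr, h.val,
        h.col, Function.update_apply, Finset.sum_range_succ]
      by_cases hi : i = j
      · subst hi
        simp [h5', add_assoc]
      · simp [hi, h5']
    · rw [Finset.sum_range_succ, ← add_assoc, ← h6]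
      simp [Program.run, Machine.writeNat, Machine.writeReal, NatExpr.eval,
        RealExpr.eval, valExpr, rowExpr, posExpr, colExpr, h1, h2, h.ptr, h.row, h.val,
        h.col, Function.update_apply]
      by_cases hi : i = S.row (S.ptr j + t)
      · subst hi; simp
      · simp [hi, Ne.symm hi]
    · rw [Finset.sum_range_succ, ← add_assoc, ← h7]
      simp [Program.run, Machine.writeNat, Machine.writeReal, NatExpr.eval,
        RealExpr.eval, valExpr, rowExpr, posExpr, colExpr, h1, h2, h.ptr, h.row, h.val,
        h.col, Function.update_apply]
      by_cases hi : i = S.row (S.ptr j + t)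
      · subst hi; simp
      · simp [hi, Ne.symm hi]

/-- The effect of `coordinateUpdate`. -/
theorem run_coordinateUpdate (hcol : s.ints 5 0 = j) {p δ : ℝ}
    (hp : p = s.reals 5 j + s.reals 10 3 * (s.reals 10 8 - 1))
    (hδ : δ = max 0 (min (1 / s.reals 3 j) (s.reals 1 j - p / s.reals 3 j)) - s.reals 4 j) :
    (coordinateUpdate.run tape s).ints = s.ints ∧
    (∀ a, a ≠ 4 → a ≠ 5 → a ≠ 6 → a ≠ 10 → (coordinateUpdate.run tape s).reals a = s.reals a) ∧
    (coordinateUpdate.run tape s).draws = s.draws ∧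
    (coordinateUpdate.run tape s).time = s.time + 63 ∧
    (∀ i, i ≠ 9 → (coordinateUpdate.run tape s).reals 10 i = s.reals 10 i) ∧
    (coordinateUpdate.run tape s).reals 10 9 = δ ∧
    (coordinateUpdate.run tape s).reals 4 = Function.update (s.reals 4) j (s.reals 4 j + δ) ∧
    (coordinateUpdate.run tape s).reals 5 = Function.update (s.reals 5) j p ∧
    (coordinateUpdate.run tape s).reals 6
      = Function.update (s.reals 6) j (s.reals 6 j + s.reals 10 4 * δ) := by
  subst hp hδ
  refine ⟨rfl, fun a h4 h5 h6 h10 => ?_, rfl, ?_, fun i hi => ?_, ?_, ?_, ?_, ?_⟩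
  · simp [coordinateUpdate, setScalar, Program.run, Machine.writeReal, h4, h5, h6, h10]
  · simp [coordinateUpdate, setScalar, Program.run, Machine.writeReal, NatExpr.cost,
        RealExpr.cost, scalar, colExpr]
  · simp [coordinateUpdate, setScalar, Program.run, Machine.writeReal, NatExpr.eval, hi]
  all_goals
    simp [coordinateUpdate, setScalar, Program.run, Machine.writeReal, NatExpr.eval,
      RealExpr.eval, scalar, colExpr, hcol]

end Semantics

/-! ### Memory contents, and a full coordinate step. -/

section States

/-- The vectors that the program keeps in memory. -/
structure Vectors (m n : ℕ) where
  norms : Fin n → ℝ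
  point : Fin n → ℝ
  linear : Fin n → ℝ
  corr : Fin n → ℝ
  prod : Fin m → ℝ
  prodCorr : Fin m → ℝ
  seg : Fin m → ℝ
  next : Fin m → ℝ

variable {A : Matrix (Fin m) (Fin n) ℝ} {S : SparseMatrix A} {x₀ : Fin n → ℝ} {K b : ℕ}
  {s : Machine} {V : Vectors m n} {j : Fin n} (tape : ℕ → ℕ)

/-- The input and the vectors `V` are in memory; the current segment starts at `b`. -/
structure Holds (S : SparseMatrix A) (x₀ : Fin n → ℝ) (K b : ℕ) (s : Machine) (V : Vectors m n) :
    Prop where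
  rows : s.ints 0 0 = m
  cols : s.ints 0 1 = n
  iters : s.ints 0 2 = K
  ptr : s.ints 1 = S.ptr
  row : s.ints 2 = S.row
  val : s.reals 0 = S.val
  start : ∀ i : Fin n, s.reals 1 i = x₀ i
  norms : ∀ i : Fin n, s.reals 3 i = V.norms i
  point : ∀ i : Fin n, s.reals 4 i = V.point i
  linear : ∀ i : Fin n, s.reals 5 i = V.linear i
  corr : ∀ i : Fin n, s.reals 6 i = V.corr i
  prod : ∀ i : Fin m, s.reals 7 i = V.prod i
  prodCorr : ∀ i : Fin m, s.reals 8 i = V.prodCorr i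
  seg : ∀ i : Fin m, s.reals 9 (b + i) = V.seg i
  next : ∀ i : Fin m, s.reals 9 (b + m + i) = V.next i
  fresh : ∀ i, b + m + m ≤ i → s.reals 9 i = 0

/-- `Holds` does not mention the counters, the segment bases or the scalars, so programs that write
only those preserve it. -/
theorem Holds.congr (H : Holds S x₀ K b s V) {s' : Machine}
    (hi : ∀ a, a < 3 → s'.ints a = s.ints a) (hr : ∀ a, a < 10 → s'.reals a = s.reals a) :
    Holds S x₀ K b s' V := by
  refine ⟨?_, ?_, ?_, ?_, ?_, ?_, ?_, ?_, ?_, ?_, ?_, ?_, ?_, ?_, ?_, ?_⟩ <;>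
    simp only [hi, hr, Nat.reduceLT, Nat.ofNat_pos, Nat.one_lt_ofNat]
  exacts [H.rows, H.cols, H.iters, H.ptr, H.row, H.val, H.start, H.norms, H.point, H.linear,
    H.corr, H.prod, H.prodCorr, H.seg, H.next, H.fresh]

/-- Moving on to untouched memory provides a zero vector for free; clearing a vector in each
iteration would cost `m` steps. -/
theorem Holds.shift (H : Holds S x₀ K b s V) :
    Holds S x₀ K (b + m) s { V with seg := V.next, next := 0 } :=
  { H with
    seg := H.next
    next := fun i => H.fresh _ (Nat.le_add_right _ _)
    fresh := fun i hi => H.fresh i (by omega) }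

theorem sum_mul_ite (A : Matrix (Fin m) (Fin n) ℝ) (j : Fin n) (c : ℝ) (i : Fin m) :
    (∑ k : Fin m, A k j * if (k : ℕ) = i then c else 0) = (A *ᵥ Pi.single j c) i := by
  simp only [← Fin.ext_iff]
  simp

theorem sum_mul_ite_add (A : Matrix (Fin m) (Fin n) ℝ) (j : Fin n) (c : ℝ) (b : ℕ) (i : Fin m) :
    (∑ k : Fin m, A k j * if b + (k : ℕ) = b + i then c else 0) = (A *ᵥ Pi.single j c) i := by
  simp only [add_right_inj, sum_mul_ite]

theorem sum_mul_ite_eq_zero {b i : ℕ} (A : Matrix (Fin m) (Fin n) ℝ) (j : Fin n) (c : ℝ)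
    (h : i < b ∨ b + m ≤ i) : (∑ k : Fin m, A k j * if b + (k : ℕ) = i then c else 0) = 0 :=
  Finset.sum_eq_zero fun k _ => by rw [if_neg (by omega), mul_zero]

theorem update_eq_add_single {x : Fin n → ℝ} {a : ℕ → ℝ} (h : ∀ i : Fin n, a i = x i) (j : Fin n)
    (δ : ℝ) (i : Fin n) : Function.update a j (a j + δ) i = (x + Pi.single j δ : Fin n → ℝ) i := by
  rcases eq_or_ne i j with rfl | hi
  · simp [h]
  · have : (i : ℕ) ≠ j := fun h => hi (Fin.ext h)
    simp [h, hi, this]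

/-- The increment of the accumulated linear part in a step in coordinate `j`. -/
noncomputable def slope (A : Matrix (Fin m) (Fin n) ℝ) (s : Machine) (V : Vectors m n)
    (j : Fin n) : ℝ :=
  s.reals 10 3 * (∑ i, A i j * (s.reals 10 5 * V.prod i + s.reals 10 6 * V.prodCorr i
    + s.reals 10 7 * V.seg i) - 1)

/-- The increment of the point in a step in coordinate `j`. -/
noncomputable def increment (A : Matrix (Fin m) (Fin n) ℝ) (x₀ : Fin n → ℝ) (s : Machine)
    (V : Vectors m n) (j : Fin n) : ℝ :=
  max 0 (min (1 / V.norms j) (x₀ j - (V.linear j + slope A s V j) / V.norms j)) - V.point j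

/-- The effect of `stepProgram`. -/
theorem Holds.run_stepProgram (H : Holds S x₀ K b s V) (hcol : s.ints 5 0 = j)
    (hb : s.ints 5 1 = b) (hb' : s.ints 5 2 = b + m) :
    Holds S x₀ K b (stepProgram.run tape s)
      { V with
        point := V.point + Pi.single j (increment A x₀ s V j)
        linear := V.linear + Pi.single j (slope A s V j)
        corr := V.corr + Pi.single j (s.reals 10 4 * increment A x₀ s V j)
        prod := V.prod + A *ᵥ Pi.single j (increment A x₀ s V j)
        prodCorr := V.prodCorr + A *ᵥ Pi.single j (s.reals 10 4 * increment A x₀ s V j)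
        next := V.next + A *ᵥ Pi.single j (increment A x₀ s V j) } ∧
    (∀ a, a ≠ 4 → (stepProgram.run tape s).ints a = s.ints a) ∧
    (∀ i, i < 8 → (stepProgram.run tape s).reals 10 i = s.reals 10 i) ∧
    (stepProgram.run tape s).draws = s.draws ∧
    (stepProgram.run tape s).time = s.time + 85 + S.count j * 143 := by
  set s₁ := (setScalar 8 (.ofNat (.const 0))).run tape s with hs₁
  have hi₁ : s₁.ints = s.ints := rfl
  have hd₁ : s₁.draws = s.draws := rfl
  have ht₁ : s₁.time = s.time + 4 := rfl
  have hr₁ : ∀ a, a ≠ 10 → s₁.reals a = s.reals a := fun a ha => by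
    simp [hs₁, setScalar, Program.run, Machine.writeReal, ha]
  have hr₁' : ∀ i, i ≠ 8 → s₁.reals 10 i = s.reals 10 i := fun i hi => by
    simp [hs₁, setScalar, Program.run, Machine.writeReal, NatExpr.eval, hi]
  have hg₁ : s₁.reals 10 8 = 0 := by
    simp [hs₁, setScalar, Program.run, Machine.writeReal, NatExpr.eval, RealExpr.eval]
  have hc₁ : AtColumn S s₁ j := ⟨H.ptr, H.row, by rw [hr₁ 0 (by norm_num), H.val], hcol⟩
  obtain ⟨hi₂, hr₂, hr₂', hd₂, ht₂, hg₂⟩ := run_dotLoop tape hc₁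
  set s₂ := dotLoop.run tape s₁ with hs₂
  have hg : s.reals 10 3 * (s₂.reals 10 8 - 1) = slope A s V j := by
    rw [hg₂, hg₁, zero_add, slope]
    simp only [hr₁' _ (by norm_num : (5 : ℕ) ≠ 8),
      hr₁' _ (by norm_num : (6 : ℕ) ≠ 8), hr₁' _ (by norm_num : (7 : ℕ) ≠ 8), hi₁, hb,
      hr₁ _ (by norm_num : (7 : ℕ) ≠ 10), hr₁ _ (by norm_num : (8 : ℕ) ≠ 10),
      hr₁ _ (by norm_num : (9 : ℕ) ≠ 10), H.prod, H.prodCorr, H.seg]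
  have hr₂s : ∀ a, a ≠ 10 → s₂.reals a = s.reals a := fun a ha => by rw [hr₂ a ha, hr₁ a ha]
  have hr₂s' : ∀ i, i ≠ 8 → s₂.reals 10 i = s.reals 10 i := fun i hi => by
    rw [hr₂' i hi, hr₁' i hi]
  have hi₂s : ∀ a, a ≠ 4 → s₂.ints a = s.ints a := fun a ha => by rw [hi₂ a ha, hi₁]
  have hcol₂ : s₂.ints 5 0 = j := by rw [hi₂s 5 (by norm_num), hcol]
  obtain ⟨hi₃, hr₃, hd₃, ht₃, hr₃', hδ₃, hx₃, hp₃, hc₃⟩ := run_coordinateUpdate (s := s₂) tape hcol₂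
    (p := V.linear j + slope A s V j) (δ := increment A x₀ s V j)
    (by rw [hr₂s 5 (by norm_num), hr₂s' 3 (by norm_num), hg, H.linear])
    (by rw [hr₂s 3 (by norm_num), hr₂s 1 (by norm_num), hr₂s 4 (by norm_num), H.norms, H.start,
      H.point, increment])
  set s₃ := coordinateUpdate.run tape s₂ with hs₃
  have hi₃s : ∀ a, a ≠ 4 → s₃.ints a = s.ints a := fun a ha => by rw [hi₃, hi₂s a ha]
  have hr₃s : ∀ a, a ≠ 4 → a ≠ 5 → a ≠ 6 → a ≠ 10 → s₃.reals a = s.reals a :=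
    fun a h4 h5 h6 h10 => by rw [hr₃ a h4 h5 h6 h10, hr₂s a h10]
  have hr₃s' : ∀ i, i ≠ 8 → i ≠ 9 → s₃.reals 10 i = s.reals 10 i := fun i h8 h9 => by
    rw [hr₃' i h9, hr₂s' i h8]
  have hcol₃ : AtColumn S s₃ j := ⟨by rw [hi₃s 1 (by norm_num), H.ptr],
    by rw [hi₃s 2 (by norm_num), H.row],
    by rw [hr₃s 0 (by norm_num) (by norm_num) (by norm_num) (by norm_num), H.val],
    by rw [hi₃s 5 (by norm_num), hcol]⟩
  obtain ⟨hi₄, hr₄, hd₄, ht₄, hu₄, hw₄, hn₄⟩ := run_updateLoop tape hcol₃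
  have hrun : stepProgram.run tape s = updateLoop.run tape s₃ := rfl
  rw [hrun]
  set s₄ := updateLoop.run tape s₃ with hs₄
  have hi₄s : ∀ a, a ≠ 4 → s₄.ints a = s.ints a := fun a ha => by rw [hi₄ a ha, hi₃s a ha]
  have hr₄s : ∀ a, a < 4 → s₄.reals a = s.reals a := fun a ha => by
    rw [hr₄ a (by omega) (by omega) (by omega), hr₃s a (by omega) (by omega) (by omega) (by omega)]
  rw [hδ₃] at hu₄ hw₄ hn₄
  rw [hr₃s' 4 (by norm_num) (by norm_num)] at hw₄
  rw [hi₃s 5 (by norm_num), hb'] at hn₄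
  rw [hr₃s 7 (by norm_num) (by norm_num) (by norm_num) (by norm_num)] at hu₄
  rw [hr₃s 8 (by norm_num) (by norm_num) (by norm_num) (by norm_num)] at hw₄
  rw [hr₃s 9 (by norm_num) (by norm_num) (by norm_num) (by norm_num)] at hn₄
  refine ⟨⟨?_, ?_, ?_, ?_, ?_, ?_, ?_, ?_, ?_, ?_, ?_, ?_, ?_, ?_, ?_, ?_⟩, hi₄s, ?_, ?_, ?_⟩
  · rw [hi₄s 0 (by norm_num), H.rows]
  · rw [hi₄s 0 (by norm_num), H.cols]
  · rw [hi₄s 0 (by norm_num), H.iters]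
  · rw [hi₄s 1 (by norm_num), H.ptr]
  · rw [hi₄s 2 (by norm_num), H.row]
  · rw [hr₄s 0 (by norm_num), H.val]
  · rw [hr₄s 1 (by norm_num)]; exact H.start
  · rw [hr₄s 3 (by norm_num)]; exact H.norms
  · rw [hr₄ 4 (by norm_num) (by norm_num) (by norm_num), hx₃, hr₂s 4 (by norm_num)]
    exact update_eq_add_single H.point j _
  · rw [hr₄ 5 (by norm_num) (by norm_num) (by norm_num), hp₃, hr₂s 5 (by norm_num), ← H.linear]
    exact update_eq_add_single H.linear j _
  · rw [hr₄ 6 (by norm_num) (by norm_num) (by norm_num), hc₃, hr₂s 6 (by norm_num),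
      hr₂s' 4 (by norm_num)]
    exact update_eq_add_single H.corr j _
  · exact fun i => by rw [hu₄, H.prod, sum_mul_ite]; rfl
  · exact fun i => by rw [hw₄, H.prodCorr, sum_mul_ite]; rfl
  · exact fun i => by rw [hn₄, H.seg, sum_mul_ite_eq_zero A j _ (by omega), add_zero]
  · exact fun i => by rw [hn₄, H.next, sum_mul_ite_add]; rfl
  · exact fun i hi => by
      rw [hn₄, H.fresh i hi, sum_mul_ite_eq_zero A j _ (by omega), add_zero]
  · exact fun i hi => by
      rw [hr₄ 10 (by norm_num) (by norm_num) (by norm_num), hr₃s' i (by omega) (by omega)]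
  · rw [hd₄, hd₃, hd₂, hd₁]
  · rw [ht₄, ht₃, ht₂, ht₁, show countExpr.cost = 9 from rfl]
    ring

end States

/-! ### Vectors that have been processed up to a given coordinate. -/

section Splice

/-- The vector that agrees with `x` in the first `t` entries and with `y` in the others. -/
def splice (x y : Fin n → ℝ) (t : ℕ) : Fin n → ℝ := fun i => if (i : ℕ) < t then x i else y i

theorem splice_zero (x y : Fin n → ℝ) : splice x y 0 = y := by
  funext i; simp [splice]

theorem splice_card (x y : Fin n → ℝ) : splice x y n = x := by
  funext i; simp [splice]

theorem splice_apply_self (x y : Fin n → ℝ) (j : Fin n) : splice x y j j = y j := by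
  simp [splice]

theorem splice_succ (x y : Fin n → ℝ) (j : Fin n) :
    splice x y (j + 1) = splice x y j + Pi.single j (x j - y j) := by
  funext i
  rcases eq_or_ne i j with rfl | hi
  · simp [splice]
  · have h : (i : ℕ) ≠ j := fun h => hi (Fin.ext h)
    have h' : (i : ℕ) < j + 1 ↔ (i : ℕ) < j := by omega
    simp [splice, hi, h']

end Splice

/-! ### Column norms, `A x₀` and the initial scalars. -/

section Phases

variable {A : Matrix (Fin m) (Fin n) ℝ} {S : SparseMatrix A} {x₀ : Fin n → ℝ} {K b : ℕ}
  {s : Machine} {V : Vectors m n} {j : Fin n} (tape : ℕ → ℕ)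

theorem run_selectColumn (s : Machine) (t : ℕ) :
    (∀ a, a ≠ 3 → a ≠ 5 → (selectColumn.run tape (s.writeNat 3 0 t 1)).ints a = s.ints a) ∧
    (selectColumn.run tape (s.writeNat 3 0 t 1)).ints 5 0 = t ∧
    (∀ i, i ≠ 0 → (selectColumn.run tape (s.writeNat 3 0 t 1)).ints 5 i = s.ints 5 i) ∧
    (selectColumn.run tape (s.writeNat 3 0 t 1)).reals = s.reals ∧
    (selectColumn.run tape (s.writeNat 3 0 t 1)).draws = s.draws ∧
    (selectColumn.run tape (s.writeNat 3 0 t 1)).time = s.time + 5 := by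
  refine ⟨fun a h3 h5 => ?_, ?_, fun i hi => ?_, rfl, rfl, rfl⟩
  · simp [selectColumn, Program.run, Machine.writeNat, h3, h5]
  · simp [selectColumn, Program.run, Machine.writeNat, NatExpr.eval]
  · simp [selectColumn, Program.run, Machine.writeNat, NatExpr.eval, hi]

/-- The vectors in memory after the setup of the first `t` columns. -/
noncomputable def setupVectors (A : Matrix (Fin m) (Fin n) ℝ) (x₀ : Fin n → ℝ) (t : ℕ) :
    Vectors m n where
  norms := splice (colSq A) 0 t
  point := splice x₀ 0 t
  linear := 0
  corr := 0
  prod := A *ᵥ splice x₀ 0 t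
  prodCorr := 0
  seg := A *ᵥ splice x₀ 0 t
  next := 0

theorem run_setupProgram (S : SparseMatrix A) (x₀ : Fin n → ℝ) (K : ℕ) :
    Holds S x₀ K 0 (setupProgram.run tape (startMachine S x₀ K)) (setupVectors A x₀ n) ∧
    (∀ i, i ≠ 0 → (setupProgram.run tape (startMachine S x₀ K)).ints 5 i = 0) ∧
    (∀ i, (setupProgram.run tape (startMachine S x₀ K)).reals 10 i = 0) ∧
    (setupProgram.run tape (startMachine S x₀ K)).draws = 0 ∧
    (setupProgram.run tape (startMachine S x₀ K)).time
      = 2 + ∑ t ∈ Finset.range n, (20 + S.count t * 79) := by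
  refine run_loop tape 3 (dimExpr 1) _ (startMachine S x₀ K) (fun t s' =>
    Holds S x₀ K 0 s' (setupVectors A x₀ t) ∧ (∀ i, i ≠ 0 → s'.ints 5 i = 0) ∧
    (∀ i, s'.reals 10 i = 0) ∧ s'.draws = 0 ∧
    s'.time = 2 + ∑ t ∈ Finset.range t, (20 + S.count t * 79)) ?_ ?_
  · refine ⟨⟨rfl, rfl, rfl, rfl, rfl, rfl, fun i => ?_, ?_, ?_, ?_, ?_, ?_, ?_, ?_, ?_, ?_⟩, ?_,
      ?_, rfl, rfl⟩
    all_goals simp [startMachine, setupVectors, splice_zero]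
  · rintro t ht s' ⟨H, h5, h10, hd, htime⟩
    obtain ⟨j, rfl⟩ : ∃ j : Fin n, t = j := ⟨⟨t, ht⟩, rfl⟩
    obtain ⟨hi₁, hj₁, hi₁', hr₁, hd₁, ht₁⟩ := run_selectColumn tape s' j
    set s₁ := selectColumn.run tape (s'.writeNat 3 0 j 1) with hs₁
    set s₂ := (Program.setReal 4 colExpr (.get 1 colExpr)).run tape s₁ with hs₂
    have hi₂ : s₂.ints = s₁.ints := rfl
    have hr₂ : ∀ a, a ≠ 4 → s₂.reals a = s'.reals a := fun a ha => by
      simp [hs₂, Program.run, Machine.writeReal, ha, hr₁]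
    -- The entry is still `0`, so overwriting it is the same as adding `x₀ j`.
    have hx₂ : s₂.reals 4 = Function.update (s'.reals 4) j (s'.reals 4 j + x₀ j) := by
      have : s'.reals 4 j = 0 := by rw [H.point]; exact splice_apply_self _ _ _
      simp [hs₂, Program.run, Machine.writeReal, hr₁, NatExpr.eval, RealExpr.eval, colExpr, hj₁,
        H.start, this]
    have hc₂ : AtColumn S s₂ j := ⟨by rw [hi₂, hi₁ 1 (by norm_num) (by norm_num), H.ptr],
      by rw [hi₂, hi₁ 2 (by norm_num) (by norm_num), H.row],
      by rw [hr₂ 0 (by norm_num), H.val], by rw [hi₂, hj₁]⟩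
    obtain ⟨hi₃, hr₃, hd₃, ht₃, hL₃, hu₃, hn₃⟩ := run_setupLoop tape hc₂
    have hrun : Program.run tape (.seq selectColumn (.seq (.setReal 4 colExpr (.get 1 colExpr))
      setupLoop)) (s'.writeNat 3 0 j 1) = setupLoop.run tape s₂ := rfl
    rw [hrun]
    set s₃ := setupLoop.run tape s₂ with hs₃
    have hi₃s : ∀ a, a < 3 → s₃.ints a = s'.ints a := fun a ha => by
      rw [hi₃ a (by omega), hi₂, hi₁ a (by omega) (by omega)]
    rw [hr₂ 1 (by norm_num), H.start] at hu₃ hn₃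
    rw [hr₂ 3 (by norm_num)] at hL₃
    rw [hr₂ 7 (by norm_num)] at hu₃
    rw [hr₂ 9 (by norm_num)] at hn₃
    have hr₃s : ∀ a, a ≠ 3 → a ≠ 4 → a ≠ 7 → a ≠ 9 → s₃.reals a = s'.reals a :=
      fun a h3 h4 h7 h9 => by rw [hr₃ a h3 h7 h9, hr₂ a h4]
    have hsplice : A *ᵥ splice x₀ 0 (j + 1) = A *ᵥ splice x₀ 0 j + A *ᵥ Pi.single j (x₀ j) := by
      rw [splice_succ, mulVec_add, Pi.zero_apply, sub_zero]
    refine ⟨⟨?_, ?_, ?_, ?_, ?_, ?_, ?_, ?_, ?_, ?_, ?_, ?_, ?_, ?_, ?_, ?_⟩, ?_, ?_, ?_, ?_⟩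
    · rw [hi₃s 0 (by norm_num), H.rows]
    · rw [hi₃s 0 (by norm_num), H.cols]
    · rw [hi₃s 0 (by norm_num), H.iters]
    · rw [hi₃s 1 (by norm_num), H.ptr]
    · rw [hi₃s 2 (by norm_num), H.row]
    · rw [hr₃s 0 (by norm_num) (by norm_num) (by norm_num) (by norm_num), H.val]
    · rw [hr₃s 1 (by norm_num) (by norm_num) (by norm_num) (by norm_num)]; exact H.start
    · intro i
      rw [hL₃, H.norms]
      simp only [setupVectors]
      rw [splice_succ, Pi.add_apply, Pi.zero_apply, sub_zero, Pi.single_apply]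
      simp only [Fin.ext_iff]
    · intro i
      rw [hr₃ 4 (by norm_num) (by norm_num) (by norm_num), hx₂]
      simp only [setupVectors]
      rw [splice_succ, Pi.zero_apply, sub_zero]
      exact update_eq_add_single H.point j _ i
    · rw [hr₃s 5 (by norm_num) (by norm_num) (by norm_num) (by norm_num)]; exact H.linear
    · rw [hr₃s 6 (by norm_num) (by norm_num) (by norm_num) (by norm_num)]; exact H.corr
    · intro i
      rw [hu₃, H.prod, sum_mul_ite]
      simp only [setupVectors, hsplice, Pi.add_apply]
    · rw [hr₃s 8 (by norm_num) (by norm_num) (by norm_num) (by norm_num)]; exact H.prodCorr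
    · intro i
      rw [zero_add, hn₃, sum_mul_ite, ← zero_add (i : ℕ), H.seg]
      simp only [setupVectors, hsplice, Pi.add_apply]
    · intro i
      have h := sum_mul_ite_eq_zero (b := 0) (i := 0 + m + i) A j (x₀ j) (by omega)
      simp only [zero_add] at h
      rw [hn₃, H.next, zero_add, h, add_zero]
      rfl
    · intro i hi
      have h := sum_mul_ite_eq_zero (b := 0) (i := i) A j (x₀ j) (by omega)
      simp only [zero_add] at h
      rw [hn₃, H.fresh i hi, h, add_zero]
    · exact fun i hi => by rw [hi₃ 5 (by norm_num), hi₂, hi₁' i hi, h5 i hi]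
    · rw [hr₃s 10 (by norm_num) (by norm_num) (by norm_num) (by norm_num)]; exact h10
    · rw [hd₃, ← hd]; exact hd₁
    · rw [ht₃, show s₂.time = s₁.time + 6 from rfl, ht₁, htime, Finset.sum_range_succ,
        show countExpr.cost = 9 from rfl]
      ring

/-- The vectors in memory when the first iteration has processed `t` columns. -/
noncomputable def firstVectors (A : Matrix (Fin m) (Fin n) ℝ) (x₀ x₁ p₁ : Fin n → ℝ) (t : ℕ) :
    Vectors m n where
  norms := colSq A
  point := splice x₁ x₀ t
  linear := splice p₁ 0 t
  corr := 0
  prod := A *ᵥ splice x₁ x₀ t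
  prodCorr := 0
  seg := A *ᵥ x₀
  next := A *ᵥ (splice x₁ x₀ t - x₀)

/-- The weights `0, 0, 1` make the gradient estimate read only the current segment, which holds `A
x₀`. It stays fixed during the full step, while array `7` follows the moving point. The zero
multiplier keeps the correction at `0`. -/
theorem run_setupScalars (H : Holds S x₀ K 0 s V) (h5 : ∀ i, i ≠ 0 → s.ints 5 i = 0)
    (h10 : ∀ i, s.reals 10 i = 0) :
    Holds S x₀ K 0 (setupScalars.run tape s) V ∧
    (setupScalars.run tape s).ints 5 1 = 0 ∧ (setupScalars.run tape s).ints 5 2 = m ∧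
    (setupScalars.run tape s).reals 10 0 = stepSize n 1 ∧
    (setupScalars.run tape s).reals 10 3 = stepSize n 1 ∧
    (∀ i, i = 4 ∨ i = 5 ∨ i = 6 → (setupScalars.run tape s).reals 10 i = 0) ∧
    (setupScalars.run tape s).reals 10 7 = 1 ∧
    (setupScalars.run tape s).draws = s.draws ∧
    (setupScalars.run tape s).time = s.time + 29 := by
  refine ⟨H.congr (fun a ha => ?_) (fun a ha => ?_), ?_, ?_, ?_, ?_, ?_, ?_, rfl, rfl⟩
  · have h : a ≠ 5 := by omega
    simp [setupScalars, setScalar, Program.run, Machine.writeReal, Machine.writeNat, h]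
  · have h : a ≠ 10 := by omega
    simp [setupScalars, setScalar, Program.run, Machine.writeReal, Machine.writeNat, h]
  · simp [setupScalars, setScalar, Program.run, Machine.writeReal, Machine.writeNat,
      NatExpr.eval, h5]
  · simp [setupScalars, setScalar, Program.run, Machine.writeReal, Machine.writeNat,
      NatExpr.eval, dimExpr, H.rows]
  · simp [setupScalars, setScalar, Program.run, Machine.writeReal, Machine.writeNat,
      NatExpr.eval, RealExpr.eval, dimExpr, H.cols, stepSize_one, rpow_three_halves]
  · simp [setupScalars, setScalar, Program.run, Machine.writeReal, Machine.writeNat,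
      NatExpr.eval, RealExpr.eval, dimExpr, scalar, H.cols, stepSize_one, rpow_three_halves]
  · rintro i (rfl | rfl | rfl) <;>
      simp [setupScalars, setScalar, Program.run, Machine.writeReal, Machine.writeNat,
        NatExpr.eval, h10]
  · simp [setupScalars, setScalar, Program.run, Machine.writeReal, Machine.writeNat,
      NatExpr.eval, RealExpr.eval]

end Phases

/-! ### The full first step and the sparse form of the iterates. -/

section Phases

variable {A : Matrix (Fin m) (Fin n) ℝ} {S : SparseMatrix A} {x₀ : Fin n → ℝ} {K b : ℕ}
  {s : Machine} {V : Vectors m n} {j : Fin n} (tape : ℕ → ℕ)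

/-- The full step is separable, so it can be run as `n` coordinate steps with the frozen gradient at
`A x₀`. -/
theorem run_firstIteration {p₁ x₁ : Fin n → ℝ} (hp : p₁ = stepSize n 1 • (Aᵀ *ᵥ (A *ᵥ x₀) - 1))
    (hx : x₁ = boxMin A x₀ p₁) (H : Holds S x₀ K 0 s (firstVectors A x₀ x₁ p₁ 0))
    (hb : s.ints 5 1 = 0) (hb' : s.ints 5 2 = m) (h3 : s.reals 10 3 = stepSize n 1)
    (h456 : ∀ i, i = 4 ∨ i = 5 ∨ i = 6 → s.reals 10 i = 0) (h7 : s.reals 10 7 = 1) :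
    Holds S x₀ K 0 (firstIteration.run tape s) (firstVectors A x₀ x₁ p₁ n) ∧
    (∀ i, i ≠ 0 → (firstIteration.run tape s).ints 5 i = s.ints 5 i) ∧
    (∀ i, i < 8 → (firstIteration.run tape s).reals 10 i = s.reals 10 i) ∧
    (firstIteration.run tape s).draws = s.draws ∧
    (firstIteration.run tape s).time
      = s.time + 2 + ∑ t ∈ Finset.range n, (90 + S.count t * 143) := by
  have hn : (dimExpr 1).eval s.ints = n := H.cols
  have := run_loop tape 3 (dimExpr 1) (.seq selectColumn stepProgram) s (fun t s' =>
    Holds S x₀ K 0 s' (firstVectors A x₀ x₁ p₁ t) ∧ (∀ i, i ≠ 0 → s'.ints 5 i = s.ints 5 i) ∧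
    (∀ i, i < 8 → s'.reals 10 i = s.reals 10 i) ∧ s'.draws = s.draws ∧
    s'.time = s.time + 2 + ∑ t ∈ Finset.range t, (90 + S.count t * 143)) ?_ ?_
  · rw [hn] at this
    exact this
  · refine ⟨H.congr (fun _ _ => rfl) fun _ _ => rfl, ?_⟩
    simp [dimExpr, NatExpr.cost]
  · rw [hn]
    rintro t ht s' ⟨H', h5, h10, hd, htime⟩
    obtain ⟨j, rfl⟩ : ∃ j : Fin n, t = j := ⟨⟨t, ht⟩, rfl⟩
    obtain ⟨hi₁, hj₁, hi₁', hr₁, hd₁, ht₁⟩ := run_selectColumn tape s' j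
    set s₁ := selectColumn.run tape (s'.writeNat 3 0 j 1) with hs₁
    have H₁ := H'.congr (s' := s₁) (fun a ha => hi₁ a (by omega) (by omega))
      (fun a ha => by rw [hr₁])
    obtain ⟨H₂, hi₂, hr₂, hd₂, ht₂⟩ := H₁.run_stepProgram tape hj₁
      (by rw [hi₁' 1 (by norm_num), h5 1 (by norm_num), hb])
      (by rw [hi₁' 2 (by norm_num), h5 2 (by norm_num), hb', zero_add])
    have hrun : Program.run tape (.seq selectColumn stepProgram) (s'.writeNat 3 0 j 1)
      = stepProgram.run tape s₁ := rfl
    rw [hrun]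
    have hr₁s : ∀ i, i < 8 → s₁.reals 10 i = s.reals 10 i := fun i hi => by rw [hr₁, h10 i hi]
    have h4 : s₁.reals 10 4 = 0 := by rw [hr₁s 4 (by norm_num), h456 4 (by norm_num)]
    have hslope : slope A s₁ (firstVectors A x₀ x₁ p₁ j) j = p₁ j := by
      rw [slope, hr₁s 3 (by norm_num), hr₁s 5 (by norm_num), hr₁s 6 (by norm_num),
        hr₁s 7 (by norm_num), h3, h456 5 (by norm_num), h456 6 (by norm_num), h7, hp]
      simp only [firstVectors, Pi.smul_apply, Pi.sub_apply, Pi.one_apply, zero_mul, zero_add,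
        one_mul, smul_eq_mul]
      rfl
    have hincr : increment A x₀ s₁ (firstVectors A x₀ x₁ p₁ j) j = x₁ j - x₀ j := by
      rw [increment, hslope, hx]
      simp only [firstVectors, splice_apply_self, Pi.zero_apply, zero_add]
      rfl
    rw [hslope, hincr, h4] at H₂
    refine ⟨?_, ?_, ?_, ?_, ?_⟩
    · convert H₂ using 1
      simp only [firstVectors, splice_succ, mulVec_add, Pi.zero_apply, sub_zero, zero_mul,
        Pi.single_zero, mulVec_zero, add_zero, mulVec_sub]
      congr 1
      abel
    · exact fun i hi => by rw [hi₂ 5 (by norm_num), hi₁' i hi, h5 i hi]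
    · exact fun i hi => by rw [hr₂ i hi, hr₁s i hi]
    · rw [hd₂, hd₁, hd]
    · rw [ht₂, ht₁, htime, Finset.sum_range_succ]
      ring

/-- The vector `r_k` with `A_k x̃_k = A_k x_k + r_k`. -/
noncomputable def correction (A : Matrix (Fin m) (Fin n) ℝ) (x₀ : Fin n → ℝ) (j : ℕ → Fin n) :
    ℕ → Fin n → ℝ
  | 0 => 0
  | 1 => 0
  | k + 2 => correction A x₀ j (k + 1) + (n * stepSize n (k + 2) - stepSum n (k + 2)) •
      ((iterate A x₀ j (k + 2)).x - (iterate A x₀ j (k + 1)).x)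

/-- Although `x̃_k` is dense, its correction changes by a multiple of `x_k - x_{k-1}`, that is in
one coordinate only. -/
theorem stepSum_smul_xt (hn : 4 ≤ n) (A : Matrix (Fin m) (Fin n) ℝ) (x₀ : Fin n → ℝ)
    (j : ℕ → Fin n) (k : ℕ) :
    stepSum n (k + 1) • (iterate A x₀ j (k + 1)).xt
      = stepSum n (k + 1) • (iterate A x₀ j (k + 1)).x + correction A x₀ j (k + 1) := by
  induction k with
  | zero => simp only [correction, add_zero]; rfl
  | succ k ih =>
    rw [stepSum_smul_xt_succ x₀ j hn, ih, correction, extrapolation, stepSum_succ n (k + 1)]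
    module

theorem xt_eq (hn : 4 ≤ n) (A : Matrix (Fin m) (Fin n) ℝ) (x₀ : Fin n → ℝ)
    (j : ℕ → Fin n) (k : ℕ) :
    (iterate A x₀ j (k + 1)).xt = (iterate A x₀ j (k + 1)).x
      + (stepSum n (k + 1))⁻¹ • correction A x₀ j (k + 1) := by
  have h := (stepSum_pos hn k).ne'
  rw [← inv_smul_smul₀ h (iterate A x₀ j (k + 1)).xt, stepSum_smul_xt hn, smul_add,
    inv_smul_smul₀ h]

/-- The weight `θ_k` of `A (n x_k - (n - 1) x_{k-1})` in the extrapolated point `ȳ_k`. -/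
noncomputable def ybarWeight (n k : ℕ) : ℝ :=
  stepSize n (k + 2) / stepSize n (k + 3) * (stepSize n (k + 2) / stepSum n (k + 1))

/-- Put `v = n x_k - (n - 1) x_{k-1}`. From `x̃_k - x̃_{k-1} = (a_k / A_{k-1}) (v - x̃_k)` one gets
`ȳ_k = (1 - θ) A x̃_k + θ A v`. Inserting `x̃_k = x_k + r_k / A_k` and `v = x_k + (n - 1)(x_k -
x_{k-1})` gives coefficient `1` for `A x_k`. -/
theorem ybar_succ_eq (hn : 4 ≤ n) (A : Matrix (Fin m) (Fin n) ℝ) (x₀ : Fin n → ℝ)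
    (j : ℕ → Fin n) (k : ℕ) :
    (iterate A x₀ j (k + 2)).ybar = A *ᵥ (iterate A x₀ j (k + 2)).x
      + ((1 - ybarWeight n k) / stepSum n (k + 2)) • A *ᵥ correction A x₀ j (k + 2)
      + (ybarWeight n k * ((n : ℝ) - 1)) •
        A *ᵥ ((iterate A x₀ j (k + 2)).x - (iterate A x₀ j (k + 1)).x) := by
  have h1 := (stepSum_pos hn k).ne'
  have h2 := (stepSum_pos hn (k + 1)).ne'
  have h3 := stepSum_smul_xt_succ (A := A) x₀ j hn k
  have h4 : (iterate A x₀ j (k + 2)).xt - (iterate A x₀ j (k + 1)).xt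
      = (stepSize n (k + 2) / stepSum n (k + 1)) •
        (extrapolation A x₀ j (k + 1) - (iterate A x₀ j (k + 2)).xt) := by
    have : stepSum n (k + 1) • ((iterate A x₀ j (k + 2)).xt - (iterate A x₀ j (k + 1)).xt)
        = stepSize n (k + 2) •
          (extrapolation A x₀ j (k + 1) - (iterate A x₀ j (k + 2)).xt) := by
      rw [stepSum_succ n (k + 1), add_smul] at h3
      rw [smul_sub, smul_sub, sub_eq_sub_iff_add_eq_add, h3, add_comm]
    rw [← inv_smul_smul₀ h1 ((iterate A x₀ j (k + 2)).xt - _), this, smul_smul]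
    congr 1
    ring
  rw [ybar_eq, y_eq A x₀ j hn, y_eq A x₀ j hn, ← mulVec_sub, h4, xt_eq hn, extrapolation]
  simp only [mulVec_smul, mulVec_add, mulVec_sub, ybarWeight]
  module

/-- The vectors in memory after iteration `k`. -/
noncomputable def mainVectors (A : Matrix (Fin m) (Fin n) ℝ) (x₀ : Fin n → ℝ) (j : ℕ → Fin n)
    (k : ℕ) : Vectors m n where
  norms := colSq A
  point := (iterate A x₀ j (k + 1)).x
  linear := dual A x₀ j (k + 1)
  corr := correction A x₀ j (k + 1)
  prod := A *ᵥ (iterate A x₀ j (k + 1)).x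
  prodCorr := A *ᵥ correction A x₀ j (k + 1)
  seg := A *ᵥ ((iterate A x₀ j (k + 1)).x - (iterate A x₀ j k).x)
  next := 0

/-- The state of the machine after iteration `k + 1`. -/
structure AfterIteration (S : SparseMatrix A) (x₀ : Fin n → ℝ) (K : ℕ) (j : ℕ → Fin n) (k : ℕ)
    (s : Machine) : Prop where
  holds : ∃ b, Holds S x₀ K b s (mainVectors A x₀ j k) ∧ s.ints 5 1 = b ∧ s.ints 5 2 = b + m
  draws : s.draws = k + 1
  size_eq : s.reals 10 0 = stepSize n (k + 2)
  sum_eq : s.reals 10 1 = stepSum n (k + 1)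
  extrapolated : ∀ i, s.reals 10 5 * (mainVectors A x₀ j k).prod i
    + s.reals 10 6 * (mainVectors A x₀ j k).prodCorr i
    + s.reals 10 7 * (mainVectors A x₀ j k).seg i = (iterate A x₀ j (k + 1)).ybar i
  prodWeight : s.reals 10 5 = 1

theorem firstVectors_zero (A : Matrix (Fin m) (Fin n) ℝ) (x₀ x₁ p₁ : Fin n → ℝ) :
    firstVectors A x₀ x₁ p₁ 0 = setupVectors A x₀ n := by
  simp [firstVectors, setupVectors, splice_zero, splice_card]

theorem run_firstScalars (hn : 4 ≤ n) (j : ℕ → Fin n)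
    (H : Holds S x₀ K 0 s (firstVectors A x₀ (iterate A x₀ j 1).x (dual A x₀ j 1) n))
    (hb' : s.ints 5 2 = m) (h0 : s.reals 10 0 = stepSize n 1) (h6 : s.reals 10 6 = 0)
    (hd : s.draws = 0) :
    AfterIteration S x₀ K j 0 (firstScalars.run tape s) ∧
    (firstScalars.run tape s).time = s.time + 36 := by
  have hV : { firstVectors A x₀ (iterate A x₀ j 1).x (dual A x₀ j 1) n with
      seg := (firstVectors A x₀ (iterate A x₀ j 1).x (dual A x₀ j 1) n).next
      next := 0 } = mainVectors A x₀ j 0 := by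
    simp only [firstVectors, mainVectors, splice_card, correction, mulVec_zero]
    rfl
  have h5 : (firstScalars.run tape s).reals 10 5 = 1 := by
    simp [firstScalars, setScalar, Program.run, Machine.writeReal, Machine.writeNat,
      NatExpr.eval, RealExpr.eval]
  refine ⟨⟨⟨m, ?_, ?_, ?_⟩, ?_, ?_, ?_, fun i => ?_, h5⟩, rfl⟩
  · have Hs := H.shift
    rw [zero_add] at Hs
    rw [← hV]
    refine Hs.congr (fun a ha => ?_) (fun a ha => ?_)
    · have h : a ≠ 5 := by omega
      simp [firstScalars, setScalar, Program.run, Machine.writeReal, Machine.writeNat, h]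
    · have h : a ≠ 10 := by omega
      simp [firstScalars, setScalar, Program.run, Machine.writeReal, Machine.writeNat, h]
  · simp [firstScalars, setScalar, Program.run, Machine.writeReal, Machine.writeNat,
      NatExpr.eval, nextBaseExpr, hb']
  · simp [firstScalars, setScalar, Program.run, Machine.writeReal, Machine.writeNat,
      NatExpr.eval, nextBaseExpr, dimExpr, hb', H.rows]
  · simp [firstScalars, setScalar, Program.run, Machine.writeReal, Machine.writeNat, hd]
  · simp [firstScalars, setScalar, Program.run, Machine.writeReal, Machine.writeNat,
      NatExpr.eval, RealExpr.eval, dimExpr, scalar, h0, H.cols, stepSize_two]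
  · simp [firstScalars, setScalar, Program.run, Machine.writeReal, Machine.writeNat,
      NatExpr.eval, RealExpr.eval, scalar, h0, stepSum_one]
  · have h6' : (firstScalars.run tape s).reals 10 6 = 0 := by
      simp [firstScalars, setScalar, Program.run, Machine.writeReal, Machine.writeNat,
        NatExpr.eval, h6]
    have h7 : (firstScalars.run tape s).reals 10 7 = n - 1 := by
      simp [firstScalars, setScalar, Program.run, Machine.writeReal, Machine.writeNat,
        NatExpr.eval, RealExpr.eval, dimExpr, H.cols]
    -- `a_1 / a_2 = n - 1` is the multiplier of the segment `A(x_1 - x_0)` in `ȳ_1`; there is no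
    -- correction yet.
    have h8 : stepSize n (0 + 1) / stepSize n (0 + 2) = n - 1 := by
      rw [div_eq_iff (stepSize_pos hn 1).ne']
      exact (sub_one_mul_stepSize_two hn).symm
    rw [h5, h6', h7, ybar_eq, h8, y_eq A x₀ j hn, y_eq A x₀ j hn, ← mulVec_sub]
    simp only [mainVectors, one_mul, zero_mul, add_zero]
    rfl

theorem run_beforeStep (H : Holds S x₀ K b s V) (hb : s.ints 5 1 = b) (hb' : s.ints 5 2 = b + m) :
    Holds S x₀ K b (beforeStep.run tape s) V ∧
    (beforeStep.run tape s).ints 5 0 = tape s.draws ∧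
    (beforeStep.run tape s).ints 5 1 = b ∧
    (beforeStep.run tape s).ints 5 2 = b + m ∧
    (beforeStep.run tape s).reals 10 0 = s.reals 10 0 ∧
    (beforeStep.run tape s).reals 10 1 = s.reals 10 1 + s.reals 10 0 ∧
    (beforeStep.run tape s).reals 10 2 = s.reals 10 1 ∧
    (beforeStep.run tape s).reals 10 3 = n * s.reals 10 0 ∧
    (beforeStep.run tape s).reals 10 4 = n * s.reals 10 0 - (s.reals 10 1 + s.reals 10 0) ∧
    (∀ i, 5 ≤ i → (beforeStep.run tape s).reals 10 i = s.reals 10 i) ∧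
    (beforeStep.run tape s).draws = s.draws + 1 ∧
    (beforeStep.run tape s).time = s.time + 28 := by
  refine ⟨H.congr (fun a ha => ?_) (fun a ha => ?_), ?_, ?_, ?_, ?_, ?_, ?_, ?_, ?_, fun i hi => ?_,
    rfl, rfl⟩
  · have h : a ≠ 5 := by omega
    simp [beforeStep, setScalar, Program.run, Machine.writeReal, Machine.writeNat, h]
  · have h : a ≠ 10 := by omega
    simp [beforeStep, setScalar, Program.run, Machine.writeReal, Machine.writeNat, h]
  · simp [beforeStep, setScalar, Program.run, Machine.writeReal, Machine.writeNat, NatExpr.eval]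
  · simp [beforeStep, setScalar, Program.run, Machine.writeReal, Machine.writeNat, NatExpr.eval,
      hb]
  · simp [beforeStep, setScalar, Program.run, Machine.writeReal, Machine.writeNat, NatExpr.eval,
      hb']
  any_goals
    simp [beforeStep, setScalar, Program.run, Machine.writeReal, Machine.writeNat, NatExpr.eval,
      RealExpr.eval, scalar, dimExpr, H.cols]
  have h1 : i ≠ 1 := by omega
  have h2 : i ≠ 2 := by omega
  have h3 : i ≠ 3 := by omega
  have h4 : i ≠ 4 := by omega
  simp [h1, h2, h3, h4]

theorem run_afterStep (H : Holds S x₀ K b s V) (hb' : s.ints 5 2 = b + m) {a θ : ℝ}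
    (ha : a = min (s.reals 10 3 / (n - 1)) (√(s.reals 10 1) / (2 * n)))
    (hθ : θ = s.reals 10 0 / a * (s.reals 10 0 / s.reals 10 2)) :
    Holds S x₀ K (b + m) (afterStep.run tape s) { V with seg := V.next, next := 0 } ∧
    (afterStep.run tape s).ints 5 1 = b + m ∧
    (afterStep.run tape s).ints 5 2 = b + m + m ∧
    (afterStep.run tape s).reals 10 0 = a ∧
    (afterStep.run tape s).reals 10 1 = s.reals 10 1 ∧
    (afterStep.run tape s).reals 10 5 = s.reals 10 5 ∧
    (afterStep.run tape s).reals 10 6 = (1 - θ) / s.reals 10 1 ∧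
    (afterStep.run tape s).reals 10 7 = θ * (n - 1) ∧
    (afterStep.run tape s).draws = s.draws ∧
    (afterStep.run tape s).time = s.time + 71 := by
  refine ⟨H.shift.congr (fun a ha => ?_) (fun a ha => ?_), ?_, ?_, ?_, ?_, ?_, ?_, ?_, rfl, rfl⟩
  · have h : a ≠ 5 := by omega
    simp [afterStep, setScalar, Program.run, Machine.writeReal, Machine.writeNat, h]
  · have h : a ≠ 10 := by omega
    simp [afterStep, setScalar, Program.run, Machine.writeReal, Machine.writeNat, h]
  all_goals
    simp [afterStep, setScalar, Program.run, Machine.writeReal, Machine.writeNat, NatExpr.eval,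
      RealExpr.eval, scalar, dimExpr, nextBaseExpr, H.cols, H.rows, hb', ha, hθ]

end Phases

/-! ### The invariant of the main loop, the output and the exact step count. -/

section Correctness

variable {A : Matrix (Fin m) (Fin n) ℝ} {S : SparseMatrix A} {x₀ : Fin n → ℝ} {K : ℕ}
  {s : Machine}

/-- The invariant says that the stored combination is `ȳ`, so the slope computed from one column is
the exact increment of the dual vector; by `x_succ` the increment of one coordinate determines the
new iterate. -/
theorem AfterIteration.succ (hn : 4 ≤ n) (hc : ∀ j, ∃ i, A i j ≠ 0) {j : ℕ → Fin n} {k : ℕ}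
    (I : AfterIteration S x₀ K j k s) :
    AfterIteration S x₀ K j (k + 1)
      (Program.run (fun t => (j t : ℕ)) (.seq beforeStep (.seq stepProgram afterStep)) s) ∧
    (Program.run (fun t => (j t : ℕ)) (.seq beforeStep (.seq stepProgram afterStep)) s).time
      = s.time + 184 + S.count (j (k + 1)) * 143 := by
  obtain ⟨b, H, hb, hb'⟩ := I.holds
  obtain ⟨H₁, hj₁, hb₁, hb₁', h0₁, h1₁, h2₁, h3₁, h4₁, h5₁, hd₁, ht₁⟩ :=
    run_beforeStep (fun t => (j t : ℕ)) H hb hb'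
  set s₁ := beforeStep.run (fun t => (j t : ℕ)) s with hs₁
  rw [I.draws] at hj₁
  obtain ⟨H₂, hi₂, hr₂, hd₂, ht₂⟩ := H₁.run_stepProgram (fun t => (j t : ℕ)) hj₁ hb₁ hb₁'
  set s₂ := stepProgram.run (fun t => (j t : ℕ)) s₁ with hs₂
  obtain ⟨H₃, hb₃, hb₃', h0₃, h1₃, h5₃, h6₃, h7₃, hd₃, ht₃⟩ := run_afterStep
    (fun t => (j t : ℕ)) H₂ (by rw [hi₂ 5 (by norm_num), hb₁']) rfl rfl
  have hrun : Program.run (fun t => (j t : ℕ)) (.seq beforeStep (.seq stepProgram afterStep)) s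
    = afterStep.run (fun t => (j t : ℕ)) s₂ := rfl
  rw [hrun]
  set s₃ := afterStep.run (fun t => (j t : ℕ)) s₂ with hs₃
  rw [I.size_eq, I.sum_eq] at h1₁ h4₁
  rw [I.size_eq] at h0₁ h3₁
  rw [I.sum_eq] at h2₁
  have hsum := stepSum_succ n (k + 1)
  rw [← hsum] at h1₁ h4₁
  have hslope : slope A s₁ (mainVectors A x₀ j k) (j (k + 1)) = n * stepSize n (k + 2) *
      (Aᵀ *ᵥ (iterate A x₀ j (k + 1)).ybar - 1) (j (k + 1)) := by
    rw [slope, h3₁, h5₁ 5 le_rfl, h5₁ 6 (by norm_num), h5₁ 7 (by norm_num)]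
    simp only [I.extrapolated]
    rfl
  have hx := x_succ x₀ j hc k
  have hincr : increment A x₀ s₁ (mainVectors A x₀ j k) (j (k + 1))
      = (iterate A x₀ j (k + 2)).x (j (k + 1)) - (iterate A x₀ j (k + 1)).x (j (k + 1)) := by
    rw [increment, hslope, x_eq x₀ j hc (k + 1)]
    simp only [mainVectors, boxMin, dual, Pi.add_apply, Pi.single_eq_same]
  rw [hslope, hincr, h4₁] at H₃
  generalize hδ : (iterate A x₀ j (k + 2)).x (j (k + 1)) - (iterate A x₀ j (k + 1)).x (j (k + 1))
    = δ at *
  have hδ' : Pi.single (j (k + 1)) δ = (iterate A x₀ j (k + 2)).x - (iterate A x₀ j (k + 1)).x := by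
    rw [hx, add_sub_cancel_left]
  have hsingle : (Pi.single (j (k + 1)) ((n * stepSize n (k + 2) - stepSum n (k + 2)) * δ) :
      Fin n → ℝ) = (n * stepSize n (k + 2) - stepSum n (k + 2)) •
        ((iterate A x₀ j (k + 2)).x - (iterate A x₀ j (k + 1)).x) := by
    rw [← hδ', ← Pi.single_smul, smul_eq_mul]
  have hV : Holds S x₀ K (b + m) s₃ (mainVectors A x₀ j (k + 1)) := by
    convert H₃ using 1
    simp only [mainVectors, hδ', hsingle, zero_add, ← mulVec_add, add_sub_cancel, correction, dual]
  have ha : s₃.reals 10 0 = stepSize n (k + 3) := by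
    rw [h0₃, hr₂ 3 (by norm_num), hr₂ 1 (by norm_num), h3₁, h1₁, stepSize_add_three]
  have h5 : s₃.reals 10 5 = 1 := by rw [h5₃, hr₂ 5 (by norm_num), h5₁ 5 le_rfl, I.prodWeight]
  rw [← h0₃, ha, hr₂ 0 (by norm_num), hr₂ 2 (by norm_num), h0₁, h2₁] at h6₃ h7₃
  rw [hr₂ 1 (by norm_num), h1₁] at h1₃ h6₃
  refine ⟨⟨⟨b + m, hV, hb₃, hb₃'⟩, ?_, ha, h1₃, fun i => ?_, h5⟩, ?_⟩
  · rw [hd₃, hd₂, hd₁, I.draws]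
  · rw [h5, h6₃, h7₃, ybar_succ_eq hn, one_mul]
    rfl
  · rw [ht₃, ht₂, ht₁]
    ring

theorem run_mainLoop (hn : 4 ≤ n) (hc : ∀ j, ∃ i, A i j ≠ 0) {j : ℕ → Fin n}
    (I : AfterIteration S x₀ K j 0 s) :
    AfterIteration S x₀ K j (K - 1) (mainLoop.run (fun t => (j t : ℕ)) s) ∧
    (mainLoop.run (fun t => (j t : ℕ)) s).time
      = s.time + 4 + ∑ k ∈ Finset.range (K - 1), (185 + S.count (j (k + 1)) * 143) := by
  obtain ⟨b, H, hb, hb'⟩ := I.holds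
  have hbound : (NatExpr.sub (dimExpr 2) (.const 1)).eval s.ints = K - 1 := by
    simp only [dimExpr, NatExpr.eval, H.iters]
  rw [← hbound]
  refine run_loop (fun t => (j t : ℕ)) 3 _ _ s (fun k s' => AfterIteration S x₀ K j k s' ∧
    s'.time = s.time + 4 + ∑ k ∈ Finset.range k, (185 + S.count (j (k + 1)) * 143)) ?_ ?_
  · exact ⟨⟨⟨b, H.congr (fun _ _ => rfl) fun _ _ => rfl, hb, hb'⟩, I.draws, I.size_eq, I.sum_eq,
      I.extrapolated, I.prodWeight⟩, rfl⟩
  · rintro k - s' ⟨I', ht⟩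
    have I₁ : AfterIteration S x₀ K j k (s'.writeNat 3 0 k 1) := by
      obtain ⟨b, H, hb, hb'⟩ := I'.holds
      refine ⟨⟨b, H.congr (fun a ha => ?_) fun _ _ => rfl, ?_, ?_⟩, I'.draws, I'.size_eq,
        I'.sum_eq, I'.extrapolated, I'.prodWeight⟩
      · have h : a ≠ 3 := by omega
        simp [Machine.writeNat, h]
      · simpa [Machine.writeNat] using hb
      · simpa [Machine.writeNat] using hb'
    obtain ⟨I₂, ht₂⟩ := I₁.succ hn hc
    refine ⟨I₂, ?_⟩
    rw [ht₂, show (s'.writeNat 3 0 k 1).time = s'.time + 1 from rfl, ht, Finset.sum_range_succ]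
    ring

theorem run_outputLoop (tape : ℕ → ℕ) {b : ℕ} {V : Vectors m n} (H : Holds S x₀ K b s V) :
    (∀ i : Fin n, (outputLoop.run tape s).reals 2 i = V.point i + V.corr i / s.reals 10 1) ∧
    (outputLoop.run tape s).time = s.time + 2 + n * 14 := by
  have hbound : (dimExpr 1).eval s.ints = n := H.cols
  have := run_loop tape 3 (dimExpr 1) (.setReal 2 (.get 3 (.const 0))
    (.add (.get 4 (.get 3 (.const 0))) (.div (.get 6 (.get 3 (.const 0))) (scalar 1)))) s
    (fun t s' => (∀ i : Fin n, i < t → s'.reals 2 i = V.point i + V.corr i / s.reals 10 1) ∧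
      (∀ a, a ≠ 2 → s'.reals a = s.reals a) ∧ s'.time = s.time + 2 + t * 14) ?_ ?_
  · rw [hbound] at this
    exact ⟨fun i => this.1 i i.2, this.2.2⟩
  · simp [dimExpr, NatExpr.cost]
  · rw [hbound]
    rintro t ht s' ⟨h1, h2, h3⟩
    obtain ⟨j, rfl⟩ : ∃ j : Fin n, t = j := ⟨⟨t, ht⟩, rfl⟩
    refine ⟨fun i hi => ?_, fun a ha => ?_, ?_⟩
    · rcases eq_or_ne i j with rfl | hij
      · simp [Program.run, Machine.writeReal, Machine.writeNat, NatExpr.eval, RealExpr.eval, scalar,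
          h2, H.point, H.corr]
      · have h : (i : ℕ) ≠ j := fun h => hij (Fin.ext h)
        have := h1 i (by omega)
        simp [Program.run, Machine.writeReal, Machine.writeNat, NatExpr.eval, h, this]
    · simp [Program.run, Machine.writeReal, Machine.writeNat, ha, h2]
    · simp [Program.run, Machine.writeReal, Machine.writeNat, NatExpr.cost, RealExpr.cost, scalar,
        h3]
      ring

theorem run_nnlsProgram (hn : 4 ≤ n) (hc : ∀ j, ∃ i, A i j ≠ 0) (S : SparseMatrix A)
    (x₀ : Fin n → ℝ) (hK : 2 ≤ K) (j : ℕ → Fin n) :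
    (∀ i : Fin n, (runOn nnlsProgram S x₀ K j).reals 2 i = output A x₀ j K i) ∧
    (runOn nnlsProgram S x₀ K j).time = 75 + n * 124 + nnz A * 222
      + ∑ k ∈ Finset.range (K - 1), (185 + S.count (j (k + 1)) * 143) := by
  obtain ⟨H₁, h5₁, h10₁, hd₁, ht₁⟩ := run_setupProgram (fun t => (j t : ℕ)) S x₀ K
  set s₁ := setupProgram.run (fun t => (j t : ℕ)) (startMachine S x₀ K)
  rw [← firstVectors_zero A x₀ (iterate A x₀ j 1).x (dual A x₀ j 1)] at H₁
  obtain ⟨H₂, hb₂, hb₂', h0₂, h3₂, h456₂, h7₂, hd₂, ht₂⟩ :=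
    run_setupScalars (fun t => (j t : ℕ)) H₁ h5₁ h10₁
  set s₂ := setupScalars.run (fun t => (j t : ℕ)) s₁
  obtain ⟨H₃, hi₃, hr₃, hd₃, ht₃⟩ := run_firstIteration (fun t => (j t : ℕ)) rfl
    (x_eq x₀ j hc 0) H₂ hb₂ hb₂' h3₂ h456₂ h7₂
  set s₃ := firstIteration.run (fun t => (j t : ℕ)) s₂
  obtain ⟨I₄, ht₄⟩ := run_firstScalars (fun t => (j t : ℕ)) hn j H₃
    (by rw [hi₃ 2 (by norm_num), hb₂']) (by rw [hr₃ 0 (by norm_num), h0₂])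
    (by rw [hr₃ 6 (by norm_num), h456₂ 6 (by norm_num)]) (by rw [hd₃, hd₂, hd₁])
  set s₄ := firstScalars.run (fun t => (j t : ℕ)) s₃
  obtain ⟨I₅, ht₅⟩ := run_mainLoop hn hc I₄
  set s₅ := mainLoop.run (fun t => (j t : ℕ)) s₄
  obtain ⟨b, H₅, -, -⟩ := I₅.holds
  obtain ⟨hout, ht₆⟩ := run_outputLoop (fun t => (j t : ℕ)) H₅
  have hrun : runOn nnlsProgram S x₀ K j = outputLoop.run (fun t => (j t : ℕ)) s₅ := rfl
  have hK' : K - 1 + 1 = K := by omega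
  refine ⟨fun i => ?_, ?_⟩
  · rw [hrun, hout, I₅.sum_eq, output]
    have h := congrFun (xt_eq hn A x₀ j (K - 1)) i
    simp only [mainVectors, hK', Pi.add_apply, Pi.smul_apply, smul_eq_mul] at h ⊢
    rw [h, div_eq_inv_mul]
  · have hcount : ∑ t ∈ Finset.range n, S.count t = nnz A := by
      rw [← S.sum_count, Finset.sum_range]
    rw [hrun, ht₆, ht₅, ht₄, ht₃, ht₂, ht₁]
    simp only [Finset.sum_add_distrib, ← Finset.sum_mul, hcount, Finset.sum_const,
      Finset.card_range, smul_eq_mul]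
    ring

theorem implements_nnlsProgram : Implements nnlsProgram :=
  fun _ _ _ hn _ hc S x₀ _ _ hK j => (run_nnlsProgram hn hc S x₀ hK j).1

end Correctness

/-! ## The expected cost -/

section Cost

variable {A : Matrix (Fin m) (Fin n) ℝ} {x₀ : Fin n → ℝ} {K : ℕ} {Ω : Type*} [MeasurableSpace Ω]
  {P : Measure Ω} [IsProbabilityMeasure P] {j : ℕ → Ω → Fin n}

/-- Lets the constant overhead of the iterations be charged to the non-zero entries. -/
theorem card_le_nnz (hc : ∀ j, ∃ i, A i j ≠ 0) : n ≤ nnz A := by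
  obtain ⟨S⟩ := sparseMatrix_nonempty A
  rw [← S.sum_count]
  calc n = ∑ _j : Fin n, 1 := by simp
    _ ≤ _ := Finset.sum_le_sum fun j _ => by
      rw [S.count_eq]
      exact (Set.ncard_pos (Set.toFinite _)).2 (hc j)

theorem UniformSamples.integrable_count (hj : UniformSamples P j) (S : SparseMatrix A) (k : ℕ) :
    Integrable (fun ω => (S.count (j k ω) : ℝ)) P :=
  hj.integrable (k := k + 1) (F := fun j => (S.count (j k) : ℝ)) fun j j' h => by
    simp only [h k k.lt_succ_self]

theorem UniformSamples.integral_count (hj : UniformSamples P j) (S : SparseMatrix A) (k : ℕ) :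
    ∫ ω, (S.count (j k ω) : ℝ) ∂P = nnz A / n := by
  rw [hj.integral_comp_sample (k := k) (F := fun _ c => (S.count c : ℝ)) fun _ _ _ => rfl,
    integral_const, probReal_univ, one_smul, ← Nat.cast_sum, S.sum_count]
  ring

theorem time_eq (hn : 4 ≤ n) (hc : ∀ j, ∃ i, A i j ≠ 0) (S : SparseMatrix A) (hK : 2 ≤ K)
    (j : ℕ → Fin n) : ((runOn nnlsProgram S x₀ K j).time : ℝ) = 75 + n * 124 + nnz A * 222
      + ∑ k ∈ Finset.range (K - 1), (185 + (S.count (j (k + 1)) : ℝ) * 143) := by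
  rw [(run_nnlsProgram hn hc S x₀ hK j).2]
  push_cast
  rfl

theorem UniformSamples.integrable_time (hj : UniformSamples P j) (hn : 4 ≤ n)
    (hc : ∀ j, ∃ i, A i j ≠ 0) (S : SparseMatrix A) (hK : 2 ≤ K) :
    Integrable (fun ω => ((runOn nnlsProgram S x₀ K fun k => j k ω).time : ℝ)) P := by
  simp only [time_eq hn hc S hK]
  exact (integrable_const _).add (integrable_finsetSum _ fun k _ =>
    (integrable_const _).add ((hj.integrable_count S (k + 1)).mul_const _))

theorem UniformSamples.integral_time (hj : UniformSamples P j) (hn : 4 ≤ n)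
    (hc : ∀ j, ∃ i, A i j ≠ 0) (S : SparseMatrix A) (hK : 2 ≤ K) :
    ∫ ω, ((runOn nnlsProgram S x₀ K fun k => j k ω).time : ℝ) ∂P
      = 75 + n * 124 + nnz A * 222 + (K - 1 : ℕ) * (185 + nnz A / n * 143) := by
  have h : ∀ k, Integrable (fun ω => 185 + (S.count (j (k + 1) ω) : ℝ) * 143) P := fun k =>
    (integrable_const _).add ((hj.integrable_count S (k + 1)).mul_const _)
  simp only [time_eq hn hc S hK]
  rw [integral_add (integrable_const _) (integrable_finsetSum _ fun k _ => h k),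
    integral_finsetSum _ fun k _ => h k]
  simp only [integral_add (integrable_const _) ((hj.integrable_count S _).mul_const _),
    integral_mul_const, hj.integral_count, integral_const, probReal_univ, one_smul,
    Finset.sum_const, Finset.card_range, nsmul_eq_mul]

theorem UniformSamples.integral_time_le (hj : UniformSamples P j) (hn : 4 ≤ n)
    (hc : ∀ j, ∃ i, A i j ≠ 0) (S : SparseMatrix A) {ε : ℝ}
    (hK : K = ⌈5 / 2 * (n : ℝ) * Real.log n + 6 * n / √ε⌉₊) :
    ∫ ω, ((runOn nnlsProgram S x₀ K fun k => j k ω).time : ℝ) ∂P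
      ≤ 2000 * (nnz A * (Real.log n + 1 / √ε)) := by
  have h0 : (4 : ℝ) ≤ n := by exact_mod_cast hn
  have hL := one_lt_log hn
  have hN : (n : ℝ) ≤ nnz A := by exact_mod_cast card_le_nnz hc
  have h2 : 2 ≤ K := two_le_of_le hn (hK ▸ Nat.le_ceil _)
  have hs : 0 ≤ 1 / √ε := by positivity
  rw [hj.integral_time hn hc S h2, Nat.cast_sub (by omega), Nat.cast_one]
  have hlt : (K : ℝ) < 5 / 2 * (n : ℝ) * Real.log n + 6 * n / √ε + 1 := by
    rw [hK]
    exact Nat.ceil_lt_add_one (by positivity)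
  -- The main loop makes `K - 1` passes, which cancels the `+ 1` from rounding up; `328 = 185 +
  -- 143`.
  have h3 : ((K : ℝ) - 1) * (185 + nnz A / n * 143)
      ≤ (5 / 2 * Real.log n + 6 * (1 / √ε)) * (328 * nnz A) := by
    calc ((K : ℝ) - 1) * (185 + nnz A / n * 143)
        ≤ (5 / 2 * (n : ℝ) * Real.log n + 6 * n / √ε) * (185 + nnz A / n * 143) := by
          gcongr
          linarith
      _ = (5 / 2 * Real.log n + 6 * (1 / √ε)) * (185 * n + 143 * nnz A) := by
          field_simp
      _ ≤ (5 / 2 * Real.log n + 6 * (1 / √ε)) * (328 * nnz A) := by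
          gcongr
          linarith
  have h4 : (nnz A : ℝ) ≤ nnz A * Real.log n := le_mul_of_one_le_right (by linarith) hL.le
  have h5 : 0 ≤ (nnz A : ℝ) * (1 / √ε) := by positivity
  -- `6 * 328 = 1968` for `1 / √ε`, and `5/2 * 328 + 75 + 124 + 222 = 1241` for `log n`; both are
  -- below `2000`.
  linarith

end Cost

end NNLS

theorem mainTheorem1 :
    -- the error bounds
    (∀ (m n : ℕ) (A : Matrix (Fin m) (Fin n) ℝ), 4 ≤ n → (∀ i j, 0 ≤ A i j) →
      (∀ j, ∃ i, A i j ≠ 0) → ∀ x₀ ∈ NNLS.box A, ∀ xs ∈ NNLS.minimizers A,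
      ∀ (Ω : Type*) [MeasurableSpace Ω] (P : Measure Ω) [IsProbabilityMeasure P]
        (j : ℕ → Ω → Fin n), NNLS.UniformSamples P j →
      -- the bounds in terms of `A_K`
      (∀ K : ℕ, 2 ≤ K →
        (∀ ω i, 0 ≤ NNLS.output A x₀ (fun k => j k ω) K i) ∧
        Integrable (fun ω =>
          NNLS.grad (NNLS.objective A) (NNLS.output A x₀ (fun k => j k ω) K) ⬝ᵥ
            (NNLS.output A x₀ (fun k => j k ω) K - xs)) P ∧
        ∫ ω, NNLS.grad (NNLS.objective A) (NNLS.output A x₀ (fun k => j k ω) K) ⬝ᵥ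
            (NNLS.output A x₀ (fun k => j k ω) K - xs) ∂P
          ≤ NNLS.lamSq A (x₀ - xs) / NNLS.stepSum n K ∧
        Integrable (fun ω =>
          NNLS.objective A (NNLS.output A x₀ (fun k => j k ω) K) - NNLS.objective A xs) P ∧
        ∫ ω, (NNLS.objective A (NNLS.output A x₀ (fun k => j k ω) K) - NNLS.objective A xs) ∂P
          ≤ NNLS.lamSq A (x₀ - xs) / (2 * NNLS.stepSum n K)) ∧
      -- the multiplicative guarantee
      (NNLS.phi0 A x₀ xs ≤ |NNLS.objective A xs| → ∀ ε : ℝ, 0 < ε →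
        ∀ K : ℕ, 5 / 2 * (n : ℝ) * Real.log n + 6 * n / √ε ≤ K →
        ∫ ω, (NNLS.objective A (NNLS.output A x₀ (fun k => j k ω) K) - NNLS.objective A xs) ∂P
          ≤ ε * |NNLS.objective A xs|) ∧
      (x₀ = 0 → NNLS.phi0 A x₀ xs ≤ |NNLS.objective A xs|)) ∧
    -- the growth of `A_K`
    (∀ n : ℕ, 4 ≤ n → ∀ K : ℕ, 5 / 2 * (n : ℝ) * Real.log n ≤ K →
      ((K : ℝ) - 5 / 2 * n * Real.log n) ^ 2 / (36 * (n : ℝ) ^ 2) ≤ NNLS.stepSum n K) ∧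
    -- the total cost
    (∃ (prog : NNLS.Program) (C : ℝ), NNLS.Implements prog ∧
      ∀ (m n : ℕ) (A : Matrix (Fin m) (Fin n) ℝ), 4 ≤ n → (∀ i j, 0 ≤ A i j) →
        (∀ j, ∃ i, A i j ≠ 0) → ∀ (S : NNLS.SparseMatrix A), ∀ x₀ ∈ NNLS.box A,
        ∀ (Ω : Type*) [MeasurableSpace Ω] (P : Measure Ω) [IsProbabilityMeasure P]
          (j : ℕ → Ω → Fin n), NNLS.UniformSamples P j →
        ∀ (ε : ℝ), 0 < ε →
        ∀ (K : ℕ), K = ⌈5 / 2 * (n : ℝ) * Real.log n + 6 * n / √ε⌉₊ →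
          Integrable (fun ω => ((NNLS.runOn prog S x₀ K (fun k => j k ω)).time : ℝ)) P ∧
          ∫ ω, ((NNLS.runOn prog S x₀ K (fun k => j k ω)).time : ℝ) ∂P
            ≤ C * (NNLS.nnz A * (Real.log n + 1 / √ε))) := by
  refine ⟨fun m n A hn hA hc x₀ _ xs hxs Ω _ P _ j hj => ⟨fun K hK => ?_, ?_, ?_⟩, ?_, ?_⟩
  · simp only [NNLS.grad_objective]
    have h := hj.integral_gradient_le (x₀ := x₀) hn hA hc hxs hK
    have h' := hj.integral_objective_sub_le (x₀ := x₀) hn hA hc hxs hK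
    refine ⟨fun ω => NNLS.output_nonneg hn hc _ hK,
      hj.integrable_output K fun x => NNLS.gradient A x ⬝ᵥ (x - xs), h.trans_eq ?_,
      hj.integrable_output K fun x => NNLS.objective A x - NNLS.objective A xs, h'.trans_eq ?_⟩ <;>
    · rw [NNLS.phi0, NNLS.lamSq_sub_comm]
      ring
  · exact fun h ε hε K hK => hj.integral_objective_sub_le_mul hn hA hc hxs h hε hK
  · rintro rfl
    exact NNLS.phi0_zero_le hA hxs
  · exact fun n hn K hK => NNLS.stepSum_lower_bound hn hK
  · refine ⟨NNLS.nnlsProgram, 2000, NNLS.implements_nnlsProgram, ?_⟩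
    intro m n A hn _ hc S x₀ _ Ω _ P _ j hj ε _ K hK
    exact ⟨hj.integrable_time hn hc S (NNLS.two_le_of_le hn (hK ▸ Nat.le_ceil _)),
      hj.integral_time_le hn hc S hK⟩
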